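/- **Setting.** Let $\sigma,S,\lambda,\tau>0$ and $\rho=e^{-\tau/\lambda}\in(0,1)$. The observed log-price is $p_t=p^\star_t+\eta_t$, $t\ge 0$, where $p^\star$ is a Brownian motion with volatility $\sigma$ (with arbitrary starting value), $\eta_t=S(X_t-\tfrac12)$ with $X_t$ Bernoulli$(1/2)$, the processes $p^\star$ and $\eta$ are independent, and $\mathrm{corr}(\eta_s,\eta_t)=e^{-|t-s|/\lambda}$ for all $s,t\ge0$. Moreover, with $Y_t=2X_t-1\in\{-1,1\}$, for all times $t_0\le t_1\le t_2\le\dots$ the variables $Y_{t_0},\,Y_{t_0}Y_{t_1},\,Y_{t_1}Y_{t_2},\dots$ are mutually independent. For $n$ observations $p_0,p_\tau,\dots,p_{(n-1)\tau}$, an integer $L\ge1$ and $v\in\{1,2,3\}$ let $$\widehat V_v(n,L)=\frac1{k_v(n,L)}\sum_{i=0}^{k_v(n,L)-1}\bigl(p_{(a_v(i)+L)\tau}-p_{a_v(i)\tau}\bigr)^2,$$ with $a_1(i)=i$, $a_2(i)=iL$, $a_3(i)=i+iL$ and $k_1=n-L$, $k_2=\lfloor (n-1)/L\rfloor$, $k_3=\lfloor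 n/(L+1)\rfloor$. Put $$\widehat{S^2_{3,v}}(n,L,L',\rho)=\frac{2(L'\widehat V_v(n,L)-L\widehat V_v(n,L'))}{L'(1-\rho^L)-L(1-\rho^{L'})},\qquad \widehat{\rho^{L}}=\sqrt{\left|\frac{2\widehat V_v(n,2L)-\widehat V_v(n,4L)}{2\widehat V_v(n,L)-\widehat V_v(n,2L)}\right|}-1 .$$ Let $V(L\tau)=L\tau\sigma^2+\frac{S^2}2(1-e^{-L\tau/\lambda})$, $(\zeta_1(L),\zeta_2(L),\zeta_3(L))=(1,L,L+1)$, and for $v\in\{2,3\}$ $$\sigma_{3,v}^2(L)=2L^2\tau^2\sigma^4+\tfrac{S^4}4(1-e^{-2L\tau/\lambda})+2L\tau\sigma^2S^2(1-e^{-L\tau/\lambda}),$$ while $$\sigma_{3,1}^2(L)=\sigma_{3,2}^2(L)+\tfrac23\tau^2\sigma^4(L-1)L(2L-1)+\tfrac{S^4}2e^{-2L\tau/\lambda}\bigl(f_L(\tfrac{2\tau}\lambda)-L+1\bigr)+2\tau\sigma^2S^2\bigl(2e^{-L\tau/\lambda}f_L'(\tfrac\tau\lambda)-f_L'(-\tfrac\tau\lambda)-e^{-2L\tau/\lambda}f_L'(\tfrac\tau\lambda)\bigr),$$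 where $f_L(x)=\frac{e^x-e^{xL}}{1-e^x}$ and $f_L'(x)=\frac{e^x-Le^{xL}+(L-1)e^{x(L+1)}}{(1-e^x)^2}$ for $x\neq0$. **Theorem.** Let $v\in\{1,2,3\}$. (0) For all integers $L,L'\ge1$ the limit $r_{3,v}(L,L')=\lim_{n\to\infty}\mathrm{corr}(\widehat V_v(n,L),\widehat V_v(n,L'))$ exists. (1) For all integers $L,L'\ge1$ with $L\ne L'$: $\widehat{S^2_{3,v}}(n,L,L',\rho)$ is integrable with mean $S^2$ for every $n>\max(L,L')$; it converges to $S^2$ in probability as $n\to\infty$; and $\sqrt n\,(\widehat{S^2_{3,v}}(n,L,L',\rho)-S^2)$ converges in distribution to $\mathcal N(0,\gamma_{3,v}(L,L',\rho))$, where $$\gamma_{3,v}(L,L',\rho)=\frac{4\bigl[L'^2\zeta_v(L)\sigma_{3,v}^2(L)+L^2\zeta_v(L')\sigma_{3,v}^2(L')-2LL'\sqrt{\zeta_v(L)\zeta_v(L')}\,\sigma_{3,v}(L)\sigma_{3,v}(L')r_{3,v}(L,L')\bigr]}{(L'(1-\rho^L)-L(1-\rho^{L'}))^2}\ \ge 0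 .$$ (2) For all integers $L,L',L''\ge1$ with $L\neq L'$, the plug-in estimator $\widehat{S^2_{3,v}}(n,L,L',(\widehat{\rho^{L''}})^{1/L''})$ converges to $S^2$ in probability. (3) For every integer $L\ge1$, $\sqrt n\,\bigl(\widehat{S^2_{3,v}}(n,L,2L,(\widehat{\rho^{L}})^{1/L})-S^2\bigr)$ converges in distribution to $\mathcal N(0,W^T\Sigma W)$, where $\Sigma_{ij}=\sqrt{\zeta_v(2^{i-1}L)\zeta_v(2^{j-1}L)}\,\sigma_{3,v}(2^{i-1}L)\sigma_{3,v}(2^{j-1}L)\,r_{3,v}(2^{i-1}L,2^{j-1}L)$ for $i,j\in\{1,2,3\}$, $W=\nabla h(V(L\tau),V(2L\tau),V(4L\tau))$ (the function $h$ being differentiable at this point) and $$h(x,y,z)=\frac{2(2x-y)^2}{(2\sqrt{2x-y}-\sqrt{2y-z})^2}.$$ The same consistency and asymptotic normality hold for the closed form of this estimator, $$\frac{2(2\widehat V_v(n,L)-\widehat V_v(n,2L))^2}{\bigl(2\sqrt{|2\widehat V_v(n,L)-\widehat V_v(n,2L)|}-\sqrt{|2\widehat V_v(n,2L)-\widehat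 V_v(n,4L)|}\bigr)^2}.$$ (Where a denominator vanishes or a non-integer power of a negative number occurs, any fixed measurable convention may be used; this does not affect the limits.) -/

import Mathlib

open MeasureTheory ProbabilityTheory Filter Topology
open scoped NNReal Matrix

noncomputable section

namespace SpreadEstimation

variable {Ω : Type*} [MeasurableSpace Ω]

/-! ### The market model -/

/-- Correlation coefficient of two real random variables. -/
def corr (μ : Measure Ω) (X Y : Ω → ℝ) : ℝ :=
  cov[X, Y; μ] / (√(Var[X; μ]) * √(Var[Y; μ]))

/-- `P` is a Brownian motion with volatility `σ`, started at an arbitrary (possibly random)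
value `P 0`: the process `(P t - P 0) / σ` is a standard Brownian motion. -/
structure IsBrownianWithVolatility (P : ℝ≥0 → Ω → ℝ) (σ : ℝ) (μ : Measure Ω) : Prop where
  aemeasurable : ∀ t, AEMeasurable (P t) μ
  brownian : IsBrownianReal (fun t ω => (P t ω - P 0 ω) / σ) μ

/-- The microstructure noise `η_t = S (X_t - 1/2)` for the trade direction `X`. -/
def noise (S : ℝ) (X : ℝ≥0 → Ω → ℝ) (t : ℝ≥0) (ω : Ω) : ℝ := S * (X t ω - 1 / 2)

/-- The observed log-price `p_t = p*_t + η_t`. -/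
def logPrice (S : ℝ) (P X : ℝ≥0 → Ω → ℝ) (t : ℝ≥0) (ω : Ω) : ℝ := P t ω + noise S X t ω

/-- The trade sign `Y_t = 2 X_t - 1`, with values in `{-1, 1}`. -/
def tradeSign (X : ℝ≥0 → Ω → ℝ) (t : ℝ≥0) (ω : Ω) : ℝ := 2 * X t ω - 1

/-- Along the times `t 0 ≤ t 1 ≤ …`, the initial sign `Y_{t 0}` followed by the sign changes
`Y_{t k} Y_{t (k+1)}`; since signs are `±1`, `Y_{t k}` is the product of the first `k + 1` of
these variables. -/
def signRatio (X : ℝ≥0 → Ω → ℝ) (t : ℕ → ℝ≥0) : ℕ → Ω → ℝ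
  | 0 => fun ω => tradeSign X (t 0) ω
  | k + 1 => fun ω => tradeSign X (t k) ω * tradeSign X (t (k + 1)) ω

/-- Autocorrelated trades: `X_t` is a Bernoulli(1/2) variable, the noise `η = S (X - 1/2)` has the
autocorrelation `exp (-|t - s| / lam)`, and along any nondecreasing sequence of times the initial
sign and the successive sign changes are mutually independent. -/
structure IsTradeDirection (X : ℝ≥0 → Ω → ℝ) (S lam : ℝ) (μ : Measure Ω) : Prop where
  law : ∀ t, HasLaw (X t) (bernoulliMeasure (1 : ℝ) 0 ⟨1 / 2, by norm_num, by norm_num⟩) μ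
  corr_eq : ∀ s t : ℝ≥0,
    corr μ (noise S X s) (noise S X t) = Real.exp (-|(t : ℝ) - (s : ℝ)| / lam)
  indep : ∀ t : ℕ → ℝ≥0, Monotone t → iIndepFun (signRatio X t) μ

/-! ### Empirical variances and estimators -/

/-- The three ways of extracting increments of a given lag from the observed series. -/
inductive Scheme
  | overlapping
  | nonOverlapping
  | disjoint

/-- The number `k_v(n, L)` of increments of lag `L` among `n` observations. -/
def Scheme.count : Scheme → ℕ → ℕ → ℕ
  | .overlapping, n, L => n - L
  | .nonOverlapping, n, L => (n - 1) / L
  | .disjoint, n, L => n / (L + 1)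

/-- The index at which the `i`-th increment of lag `L` starts; it ends `L` steps later. -/
def Scheme.start : Scheme → ℕ → ℕ → ℕ
  | .overlapping, _, i => i
  | .nonOverlapping, L, i => i * L
  | .disjoint, L, i => i + i * L

/-- `ζ_v(L)`, the limit of `n / k_v(n, L)`. -/
def Scheme.zeta : Scheme → ℕ → ℝ
  | .overlapping, _ => 1
  | .nonOverlapping, L => L
  | .disjoint, L => L + 1

/-- The empirical variance `V̂_v(n, L)` of the process `p` observed at times `0, τ, 2τ, …`. -/
def empVar (v : Scheme) (p : ℝ≥0 → Ω → ℝ) (τ : ℝ≥0) (n L : ℕ) (ω : Ω) : ℝ :=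
  (1 / (v.count n L : ℝ)) * ∑ i ∈ Finset.range (v.count n L),
    (p (((v.start L i + L : ℕ) : ℝ≥0) * τ) ω - p ((v.start L i : ℝ≥0) * τ) ω) ^ 2

/-- `Ŝ²_{3,v}` as a function of `x = V̂_v(n, L)`, `y = V̂_v(n, L')` and `ρ`. -/
def spreadFormula (L L' : ℕ) (ρ x y : ℝ) : ℝ :=
  2 * (L' * x - L * y) / (L' * (1 - ρ ^ L) - L * (1 - ρ ^ L'))

/-- The estimator `Ŝ²_{3,v}(n, L, L', ρ)` with known dependence parameter. -/
def spreadEst (v : Scheme) (p : ℝ≥0 → Ω → ℝ) (τ : ℝ≥0) (n L L' : ℕ) (ρ : ℝ) (ω : Ω) : ℝ :=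
  spreadFormula L L' ρ (empVar v p τ n L ω) (empVar v p τ n L' ω)

/-- The estimator of `ρ ^ L`. -/
def rhoPowEst (v : Scheme) (p : ℝ≥0 → Ω → ℝ) (τ : ℝ≥0) (n L : ℕ) (ω : Ω) : ℝ :=
  √|(2 * empVar v p τ n (2 * L) ω - empVar v p τ n (4 * L) ω) /
      (2 * empVar v p τ n L ω - empVar v p τ n (2 * L) ω)| - 1

/-- The plug-in estimator, in which `ρ` is replaced by the `1 / L''`-th power of the estimator of
`ρ ^ L''`. -/
def spreadPlugIn (v : Scheme) (p : ℝ≥0 → Ω → ℝ) (τ : ℝ≥0) (n L L' L'' : ℕ) (ω : Ω) : ℝ :=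
  spreadEst v p τ n L L' ((rhoPowEst v p τ n L'' ω) ^ (1 / (L'' : ℝ))) ω

/-- The closed form of the plug-in estimator for `(L', L'') = (2L, L)`, with absolute values keeping
the square roots defined. -/
def spreadClosed (v : Scheme) (p : ℝ≥0 → Ω → ℝ) (τ : ℝ≥0) (n L : ℕ) (ω : Ω) : ℝ :=
  2 * (2 * empVar v p τ n L ω - empVar v p τ n (2 * L) ω) ^ 2 /
    (2 * √|2 * empVar v p τ n L ω - empVar v p τ n (2 * L) ω|
      - √|2 * empVar v p τ n (2 * L) ω - empVar v p τ n (4 * L) ω|) ^ 2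

/-! ### The asymptotic variances -/

/-- `V(Lτ)`, the variance of a log-price increment of duration `Lτ`. -/
def priceVar (σ S lam τ : ℝ) (L : ℕ) : ℝ :=
  L * τ * σ ^ 2 + S ^ 2 / 2 * (1 - Real.exp (-(L * τ) / lam))

/-- `f_L(x) = ∑_{m=1}^{L-1} e^{xm}` in closed form, for `x ≠ 0`. -/
def geomSum (L : ℕ) (x : ℝ) : ℝ :=
  (Real.exp x - Real.exp (x * L)) / (1 - Real.exp x)

/-- `f_L'(x) = ∑_{m=1}^{L-1} m e^{xm}` in closed form, for `x ≠ 0`. -/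
def geomSumDeriv (L : ℕ) (x : ℝ) : ℝ :=
  (Real.exp x - L * Real.exp (x * L) + (L - 1) * Real.exp (x * (L + 1))) / (1 - Real.exp x) ^ 2

/-- `σ²_{3,v}(L)` for `v = 2, 3`. -/
def baseVar (σ S lam τ : ℝ) (L : ℕ) : ℝ :=
  2 * L ^ 2 * τ ^ 2 * σ ^ 4 + S ^ 4 / 4 * (1 - Real.exp (-(2 * L * τ) / lam))
    + 2 * L * τ * σ ^ 2 * S ^ 2 * (1 - Real.exp (-(L * τ) / lam))

/-- `σ²_{3,v}(L)`. -/
def sigmaSq (σ S lam τ : ℝ) : Scheme → ℕ → ℝ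
  | .overlapping, L =>
      baseVar σ S lam τ L
        + 2 / 3 * τ ^ 2 * σ ^ 4 * ((L - 1) * L * (2 * L - 1))
        + S ^ 4 / 2 * Real.exp (-(2 * L * τ) / lam) * (geomSum L (2 * τ / lam) - L + 1)
        + 2 * τ * σ ^ 2 * S ^ 2 *
          (2 * Real.exp (-(L * τ) / lam) * geomSumDeriv L (τ / lam)
            - geomSumDeriv L (-τ / lam)
            - Real.exp (-(2 * L * τ) / lam) * geomSumDeriv L (τ / lam))
  | .nonOverlapping, L => baseVar σ S lam τ L
  | .disjoint, L => baseVar σ S lam τ L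

/-- `r_{3,v}(L, L')`, the limit of the correlation of the empirical variances of lags `L`, `L'`. -/
def limCorr (μ : Measure Ω) (v : Scheme) (p : ℝ≥0 → Ω → ℝ) (τ : ℝ≥0) (L L' : ℕ) : ℝ :=
  limUnder atTop (fun n : ℕ => corr μ (empVar v p τ n L) (empVar v p τ n L'))

/-- The asymptotic covariance
`√(ζ_v(L) ζ_v(L')) σ_{3,v}(L) σ_{3,v}(L') r`, for a limit correlation `r`. -/
def asympCov (σ S lam τ : ℝ) (v : Scheme) (L L' : ℕ) (r : ℝ) : ℝ :=
  √(v.zeta L * v.zeta L') * √(sigmaSq σ S lam τ v L) * √(sigmaSq σ S lam τ v L') * r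

/-- `γ_{3,v}(L, L', ρ)`, where `r` is the limit correlation `r_{3,v}(L, L')`. -/
def gammaVar (σ S lam τ : ℝ) (v : Scheme) (L L' : ℕ) (ρ r : ℝ) : ℝ :=
  4 / (L' * (1 - ρ ^ L) - L * (1 - ρ ^ L')) ^ 2 *
    (L' ^ 2 * v.zeta L * sigmaSq σ S lam τ v L
      + L ^ 2 * v.zeta L' * sigmaSq σ S lam τ v L'
      - 2 * L * L' * asympCov σ S lam τ v L L' r)

/-- `h(x, y, z) = 2 (2x - y)² / (2 √(2x - y) - √(2y - z))²`. -/
def hFun (u : EuclideanSpace ℝ (Fin 3)) : ℝ :=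
  2 * (2 * u 0 - u 1) ^ 2 / (2 * √(2 * u 0 - u 1) - √(2 * u 1 - u 2)) ^ 2

/-- The point `(V(Lτ), V(2Lτ), V(4Lτ))`. -/
def priceVarVec (σ S lam τ : ℝ) (L : ℕ) : EuclideanSpace ℝ (Fin 3) :=
  !₂[priceVar σ S lam τ L, priceVar σ S lam τ (2 * L), priceVar σ S lam τ (4 * L)]

/-- The matrix `Σ` of asymptotic covariances at the lags `L, 2L, 4L`. -/
def covMatrix (μ : Measure Ω) (σ S lam : ℝ) (τ : ℝ≥0) (v : Scheme) (p : ℝ≥0 → Ω → ℝ) (L : ℕ) :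
    Matrix (Fin 3) (Fin 3) ℝ :=
  Matrix.of fun i j =>
    asympCov σ S lam τ v (2 ^ (i : ℕ) * L) (2 ^ (j : ℕ) * L)
      (limCorr μ v p τ (2 ^ (i : ℕ) * L) (2 ^ (j : ℕ) * L))

/-- `Wᵀ Σ W` with `W = ∇h(V(Lτ), V(2Lτ), V(4Lτ))`. -/
def plugInVar (μ : Measure Ω) (σ S lam : ℝ) (τ : ℝ≥0) (v : Scheme) (p : ℝ≥0 → Ω → ℝ) (L : ℕ) : ℝ :=
  (gradient hFun (priceVarVec σ S lam τ L)).ofLp ⬝ᵥ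
    (covMatrix μ σ S lam τ v p L *ᵥ (gradient hFun (priceVarVec σ S lam τ L)).ofLp)

/-- The statistics `T n` are asymptotically normal at rate `√n`, with centre `a` and asymptotic
variance `w ≥ 0`: `√n (T n - a)` converges in distribution to `N(0, w)`. -/
def AsymptoticallyNormal (μ : Measure Ω) [IsProbabilityMeasure μ] (T : ℕ → Ω → ℝ) (a w : ℝ) :
    Prop :=
  0 ≤ w ∧ TendstoInDistribution (fun (n : ℕ) ω => √(n : ℝ) * (T n ω - a)) atTop
    (id : ℝ → ℝ) (fun _ => μ) (gaussianReal 0 w.toNNReal)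

end SpreadEstimation

end

/-! Squaring forgets a global sign. The increment of the log-price from `aτ` to `(a+L)τ` may be
multiplied by `Y_a` before it is squared, and the result then involves only the sign changes `Y_j
Y_{j+1}` and the twisted efficient increments `Y_j (P_{j+1} - P_j)` with `a ≤ j < a + L`. Twisting
centred Gaussian increments by independent signs does not change their law, so these pairs form an
i.i.d. sequence (`hasLaw_driver`). Every empirical variance is therefore almost surely an average,
along shifts, of a function of finitely many coordinates of an i.i.d. sequence
(`sq_logPrice_sub_eq_sqIncr`, `IsTradeDirection.empVar_ae_eq`), and the limit theory can be done on
an infinite product space.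

There, averages with different lags and steps are regrouped into blocks of one common length, so
that a linear combination of them becomes a normalised sum of a stationary one-dependent sequence.
Dropping one term out of every `q + 2` leaves independent blocks, to which the classical central
limit theorem applies; the `L²` error is of order `1/√q` and vanishes as `q` grows
(`tendstoInDistribution_blockFactor`, `exists_limit_movingAvg`). Second moments converge to the same
limiting variance, so limits of scaled covariances exist by polarisation. The diagonal ones are
computed from the autocovariances of the squared increments (`integral_sq_logPrice_sub_mul`,
`sqAutocov_add_sum_step`); they are strictly positive (`sigmaSq_pos`), so the correlations converge
as well (`tendsto_corr_empVar`).

The estimators are functions of the vector of empirical variances. The combinations `L' V(L) - L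
V(L')` and `2 V(L) - V(2L)` cancel the Brownian part, which is linear in the lag, and isolate the
noise; this gives the value `S²` at the limit point. The deviations scaled by `√n` are bounded in
`L²`, so consistency follows from continuity there, and asymptotic normality from a delta method
that needs differentiability at that single point only (`tendstoInMeasure_delta_remainder`). -/

namespace SpreadEstimation

/-! ### Shifts of an i.i.d. sequence and independence of disjoint blocks. -/

section Shift

variable {E : Type*}

/-- The sequence `x` started at index `a`. -/
def shift (a : ℕ) (x : ℕ → E) : ℕ → E := fun i => x (a + i)

@[simp] lemma shift_apply (a : ℕ) (x : ℕ → E) (i : ℕ) : shift a x i = x (a + i) := rfl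

@[simp] lemma shift_shift (a b : ℕ) (x : ℕ → E) : shift a (shift b x) = shift (b + a) x := by
  ext i; simp [add_assoc]

@[simp] lemma shift_zero (x : ℕ → E) : shift 0 x = x := by ext i; simp

lemma DependsOn.comp_shift {β : Type*} {X : (ℕ → E) → β} {m a M : ℕ}
    (h : DependsOn X (Set.Iio m)) (hM : a + m ≤ M) :
    DependsOn (fun x => X (shift a x)) (Set.Iio M) := by
  intro x y hxy
  refine h fun i hi => hxy _ ?_
  simp only [Set.mem_Iio] at hi ⊢
  lia

variable [MeasurableSpace E]

@[fun_prop] lemma measurable_shift (a : ℕ) : Measurable (shift a : (ℕ → E) → ℕ → E) :=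
  measurable_pi_lambda _ fun i => measurable_pi_apply (a + i)

variable (ν : Measure E) [IsProbabilityMeasure ν]

lemma measurePreserving_shift (a : ℕ) :
    MeasurePreserving (shift a) (Measure.infinitePi fun _ : ℕ => ν)
      (Measure.infinitePi fun _ : ℕ => ν) where
  measurable := measurable_shift a
  map_eq := Measure.map_infinitePi_infinitePi_of_inj (P := fun _ : ℕ => ν)
    (f := fun i => a + i) (add_right_injective a)

/-- The `j`-th variable reads only the coordinates from `j * K` up to `(j + 1) * K`. Cutting the
sequence into these disjoint blocks is an injective reindexing by `ℕ × Fin K` followed by currying,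
and both carry product measures to product measures. -/
lemma iIndepFun_shift {X : ℕ → (ℕ → E) → ℝ} (hX : ∀ j, Measurable (X j)) {K : ℕ}
    (hK : ∀ j, DependsOn (X j) (Set.Iio K)) :
    iIndepFun (fun (j : ℕ) x => X j (shift (j * K) x)) (Measure.infinitePi fun _ : ℕ => ν) := by
  have hmeas : Measurable (fun (x : ℕ → E) (j : ℕ) (i : Fin K) => x (j * K + i)) :=
    measurable_pi_lambda _ fun j => measurable_pi_lambda _ fun i => measurable_pi_apply _
  have hlaw : HasLaw (fun (x : ℕ → E) (j : ℕ) (i : Fin K) => x (j * K + i))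
      (Measure.infinitePi fun _ : ℕ => Measure.infinitePi fun _ : Fin K => ν)
      (Measure.infinitePi fun _ : ℕ => ν) := by
    refine ⟨hmeas.aemeasurable, ?_⟩
    have hinj : Function.Injective (fun p : ℕ × Fin K => p.1 * K + p.2) := by
      rintro ⟨j, i⟩ ⟨j', i'⟩ h
      simp only at h
      have hKpos : 0 < K := i.pos
      have h1 : j = j' := by
        have := congrArg (· / K) h
        simpa [Nat.add_div_of_dvd_right, hKpos, Nat.div_eq_of_lt] using this
      subst h1
      simpa [Fin.ext_iff] using h
    have h1 := Measure.map_infinitePi_infinitePi_of_inj (P := fun _ : ℕ => ν) hinj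
    have h2 := Measure.infinitePi_map_curry (X := E)
      (fun (_ : ℕ) (_ : Fin K) => ν)
    rw [← h2, ← h1, Measure.map_map (by fun_prop) (by fun_prop)]
    rfl
  have hind : iIndepFun (fun (j : ℕ) (x : ℕ → E) (i : Fin K) => x (j * K + i))
      (Measure.infinitePi fun _ : ℕ => ν) := by
    refine (iIndepFun_iff_hasLaw_Pi_infinitePi
      (μ := fun _ : ℕ => Measure.infinitePi fun _ : Fin K => ν) (fun j => ?_) hmeas.aemeasurable).2 hlaw
    exact (measurePreserving_eval_infinitePi
      (fun _ : ℕ => Measure.infinitePi fun _ : Fin K => ν) j).hasLaw.comp hlaw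
  obtain ⟨e⟩ := nonempty_of_isProbabilityMeasure ν
  -- A block is completed to a full sequence by an arbitrary point; by `hK` the choice does not
  -- matter.
  let ext : (Fin K → E) → ℕ → E := fun y i => if h : i < K then y ⟨i, h⟩ else e
  have hext : Measurable ext := by
    refine measurable_pi_lambda _ fun i => ?_
    by_cases h : i < K
    · simpa [ext, h] using measurable_pi_apply _
    · simp [ext, h]
  convert hind.comp (fun j => X j ∘ ext) (fun j => (hX j).comp hext) using 2 with j
  ext x
  refine hK j fun i hi => ?_
  simp [ext, Set.mem_Iio.1 hi]

lemma indepFun_shift {X Z : (ℕ → E) → ℝ} (hX : Measurable X) (hZ : Measurable Z) {k : ℕ}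
    (hXk : DependsOn X (Set.Iio k)) (hZk : DependsOn Z (Set.Iio k)) :
    IndepFun X (fun x => Z (shift k x)) (Measure.infinitePi fun _ : ℕ => ν) := by
  have h := iIndepFun_shift ν (X := fun j => if j = 0 then X else Z) (K := k)
    (fun j => by by_cases hj : j = 0 <;> simp [hj, hX, hZ])
    (fun j => by by_cases hj : j = 0 <;> simp [hj, hXk, hZk])
  simpa using h.indepFun (zero_ne_one' ℕ)

end Shift

/-! ### Second moments of partial sums and `L²` norms. -/

section SecondMoment

variable {Ω : Type*} [MeasurableSpace Ω] {μ : Measure Ω}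

lemma memLp_sum_range {X : ℕ → Ω → ℝ} (hX : ∀ i, MemLp (X i) 2 μ) (s : Finset ℕ) :
    MemLp (fun ω => ∑ i ∈ s, X i ω) 2 μ :=
  memLp_finsetSum s fun i _ => hX i

lemma integral_sq_sum_succ {X : ℕ → Ω → ℝ} (hX : ∀ i, MemLp (X i) 2 μ) {r : ℕ → ℝ}
    (hr : ∀ i k, ∫ ω, X i ω * X (i + k) ω ∂μ = r k) (N : ℕ) :
    ∫ ω, (∑ i ∈ Finset.range (N + 1), X i ω) ^ 2 ∂μ =
      ∫ ω, (∑ i ∈ Finset.range N, X i ω) ^ 2 ∂μ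
        + (r 0 + 2 * ∑ k ∈ Finset.range N, r (k + 1)) := by
  have hS := memLp_sum_range hX (Finset.range N)
  have hint : ∀ i j, Integrable (fun ω => X i ω * X j ω) μ := fun i j =>
    (hX i).integrable_mul (hX j)
  have h1 : ∀ ω, (∑ i ∈ Finset.range (N + 1), X i ω) ^ 2 =
      (∑ i ∈ Finset.range N, X i ω) ^ 2
        + (X N ω * X N ω + 2 * ∑ i ∈ Finset.range N, X i ω * X N ω) := by
    intro ω
    rw [Finset.sum_range_succ, ← Finset.sum_mul]
    ring
  simp_rw [h1]
  rw [integral_add hS.integrable_sq, integral_add (hint N N), integral_const_mul,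
    integral_finsetSum _ fun i _ => hint i N]
  · congr 2
    · exact hr N 0
    · congr 1
      rw [← Finset.sum_range_reflect]
      refine Finset.sum_congr rfl fun j hj => ?_
      have hj' := Finset.mem_range.1 hj
      rw [← hr (N - 1 - j) (j + 1)]
      congr! 4
      lia
  · exact (integrable_finsetSum _ fun i _ => hint i N).const_mul 2
  · exact (hint N N).add ((integrable_finsetSum _ fun i _ => hint i N).const_mul 2)

/-- Grouping the double sum by the larger of its two indices makes the second moment itself a
partial sum; divided by `N`, it becomes a Cesàro mean. -/
lemma integral_sq_sum_eq {X : ℕ → Ω → ℝ} (hX : ∀ i, MemLp (X i) 2 μ) {r : ℕ → ℝ}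
    (hr : ∀ i k, ∫ ω, X i ω * X (i + k) ω ∂μ = r k) (N : ℕ) :
    ∫ ω, (∑ i ∈ Finset.range N, X i ω) ^ 2 ∂μ =
      ∑ M ∈ Finset.range N, (r 0 + 2 * ∑ k ∈ Finset.range M, r (k + 1)) := by
  induction N with
  | zero => simp
  | succ N ih => rw [integral_sq_sum_succ hX hr, ih, Finset.sum_range_succ]

/-- The sequence being averaged is constant from index `m` on, since longer lags contribute nothing.
-/
lemma tendsto_integral_sq_sum_div {X : ℕ → Ω → ℝ} (hX : ∀ i, MemLp (X i) 2 μ) {r : ℕ → ℝ}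
    (hr : ∀ i k, ∫ ω, X i ω * X (i + k) ω ∂μ = r k) {m : ℕ} (hm : ∀ k, m ≤ k → r (k + 1) = 0) :
    Tendsto (fun N : ℕ => (N : ℝ)⁻¹ * ∫ ω, (∑ i ∈ Finset.range N, X i ω) ^ 2 ∂μ) atTop
      (𝓝 (r 0 + 2 * ∑ k ∈ Finset.range m, r (k + 1))) := by
  simp_rw [integral_sq_sum_eq hX hr]
  refine Tendsto.cesaro ?_
  refine tendsto_const_nhds.congr' ?_
  filter_upwards [eventually_ge_atTop m] with M hM
  congr 2
  rw [← Finset.sum_range_add_sum_Ico _ hM, left_eq_add]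
  exact Finset.sum_eq_zero fun k hk => hm k (Finset.mem_Ico.1 hk).1

lemma lpNorm_two_sq {X : Ω → ℝ} (hX : MemLp X 2 μ) : lpNorm X 2 μ ^ 2 = ∫ ω, X ω ^ 2 ∂μ := by
  rw [lpNorm_eq_integral_norm_rpow_toReal (by simp) (by simp) hX.aestronglyMeasurable]
  have h0 : 0 ≤ ∫ ω, X ω ^ 2 ∂μ := integral_nonneg fun ω => sq_nonneg _
  have : ∀ ω, ‖X ω‖ ^ (2 : ENNReal).toReal = X ω ^ 2 := fun ω => by simp
  simp_rw [this]
  rw [← Real.rpow_natCast, ← Real.rpow_mul h0]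
  simp

lemma lpNorm_sum_of_orthogonal {X : ℕ → Ω → ℝ} (hX : ∀ i, MemLp (X i) 2 μ) {v : ℝ}
    (hv : ∀ i, ∫ ω, X i ω * X i ω ∂μ = v) (h0 : ∀ i k, ∫ ω, X i ω * X (i + (k + 1)) ω ∂μ = 0)
    (N : ℕ) : lpNorm (fun ω => ∑ i ∈ Finset.range N, X i ω) 2 μ = √N * √v := by
  have h := integral_sq_sum_eq hX (r := fun k => if k = 0 then v else 0) (fun i k => by
    cases k with
    | zero => simpa using hv i
    | succ k => simpa using h0 i k) N
  have h2 := lpNorm_two_sq (memLp_sum_range hX (Finset.range N))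
  rw [h] at h2
  simp only [↓reduceIte, Nat.add_eq_zero_iff, one_ne_zero, and_false, Finset.sum_const_zero,
    mul_zero, add_zero, Finset.sum_const, Finset.card_range, nsmul_eq_mul] at h2
  rw [← Real.sqrt_mul (by positivity), ← h2, Real.sqrt_sq lpNorm_nonneg]

lemma lpNorm_eq_sqrt {X : Ω → ℝ} (hX : MemLp X 2 μ) : lpNorm X 2 μ = √(∫ ω, X ω ^ 2 ∂μ) := by
  rw [← lpNorm_two_sq hX, Real.sqrt_sq lpNorm_nonneg]

lemma lpNorm_const_mul_two (c : ℝ) (X : Ω → ℝ) :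
    lpNorm (fun ω => c * X ω) 2 μ = |c| * lpNorm X 2 μ := by
  have := lpNorm_const_smul (p := 2) c X μ
  simpa [Pi.smul_def] using this

lemma lpNorm_sum_range_le {ι : Type*} {X : ι → Ω → ℝ} {s : Finset ι} (hX : ∀ i ∈ s, MemLp (X i) 2 μ)
    {C : ℝ} (hC : ∀ i ∈ s, lpNorm (X i) 2 μ ≤ C) :
    lpNorm (fun ω => ∑ i ∈ s, X i ω) 2 μ ≤ s.card * C := by
  have h := lpNorm_sum_le (s := s) (f := X) hX (by norm_num)
  have h2 : (∑ i ∈ s, X i) = fun ω => ∑ i ∈ s, X i ω := by ext; simp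
  rw [h2] at h
  refine h.trans ((Finset.sum_le_sum hC).trans ?_)
  simp

/-- The `L²` norms are squeezed by the triangle inequality. This carries limiting variances from
block sums over to the averages they approximate. -/
lemma tendsto_integral_sq_of_lpNorm_sub {X Y : ℕ → Ω → ℝ} {w : ℝ}
    (hX : ∀ n, MemLp (X n) 2 μ) (hY : ∀ n, MemLp (Y n) 2 μ)
    (hw : Tendsto (fun n => ∫ ω, X n ω ^ 2 ∂μ) atTop (𝓝 w))
    (h : Tendsto (fun n => lpNorm (Y n - X n) 2 μ) atTop (𝓝 0)) :
    Tendsto (fun n => ∫ ω, Y n ω ^ 2 ∂μ) atTop (𝓝 w) := by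
  have hw0 : 0 ≤ w := ge_of_tendsto' hw fun n => integral_nonneg fun ω => sq_nonneg _
  have h1 : Tendsto (fun n => lpNorm (X n) 2 μ) atTop (𝓝 √w) := by
    simp_rw [fun n => lpNorm_eq_sqrt (hX n)]
    exact (Real.continuous_sqrt.tendsto w).comp hw
  have h2 : Tendsto (fun n => lpNorm (Y n) 2 μ) atTop (𝓝 √w) := by
    refine tendsto_of_tendsto_of_tendsto_of_le_of_le (g := fun n => lpNorm (X n) 2 μ
      - lpNorm (Y n - X n) 2 μ) (h := fun n => lpNorm (X n) 2 μ
      + lpNorm (Y n - X n) 2 μ) (by simpa using h1.sub h) (by simpa using h1.add h) ?_ ?_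
    · intro n
      have := lpNorm_le_lpNorm_add_lpNorm_sub (f := X n) (hY n) (p := 2) (by norm_num)
      simp only
      linarith
    · intro n
      have := lpNorm_le_lpNorm_add_lpNorm_sub' (f := Y n) (hX n) (p := 2) (by norm_num)
      simp only
      linarith
  have h3 := h2.pow 2
  rw [Real.sq_sqrt hw0] at h3
  exact h3.congr fun n => lpNorm_two_sq (hY n)

end SecondMoment

/-! ### Convergence in distribution under `L²` approximation. -/

section Distribution

variable {Ω : Type*} [MeasurableSpace Ω] {μ : Measure Ω}

lemma tendstoInMeasure_zero_of_lpNorm {X : ℕ → Ω → ℝ} (hX : ∀ n, MemLp (X n) 2 μ)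
    (h : Tendsto (fun n => lpNorm (X n) 2 μ) atTop (𝓝 0)) :
    TendstoInMeasure μ X atTop 0 := by
  refine tendstoInMeasure_of_tendsto_eLpNorm (p := 2) (by simp)
    (fun n => (hX n).aestronglyMeasurable) aestronglyMeasurable_zero ?_
  have := ENNReal.tendsto_ofReal h
  simpa [ofReal_lpNorm (hX _)] using this

variable [IsProbabilityMeasure μ]

lemma _root_.MeasureTheory.TendstoInDistribution.comp_index {Ω' : Type*} [MeasurableSpace Ω']
    {μ' : Measure Ω'} [IsProbabilityMeasure μ'] {Z : Ω' → ℝ} {X : ℕ → Ω → ℝ}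
    (h : TendstoInDistribution X atTop Z (fun _ => μ) μ') {k : ℕ → ℕ}
    (hk : Tendsto k atTop atTop) :
    TendstoInDistribution (fun n => X (k n)) atTop Z (fun _ => μ) μ' where
  forall_aemeasurable n := h.forall_aemeasurable (k n)
  aemeasurable_limit := h.aemeasurable_limit
  tendsto := h.tendsto.comp hk

lemma tendstoInDistribution_of_lpNorm_sub {Ω' : Type*} [MeasurableSpace Ω'] {μ' : Measure Ω'}
    [IsProbabilityMeasure μ'] {Z : Ω' → ℝ} {X Y : ℕ → Ω → ℝ}
    (hX : ∀ n, MemLp (X n) 2 μ) (hY : ∀ n, MemLp (Y n) 2 μ)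
    (hZ : TendstoInDistribution X atTop Z (fun _ => μ) μ')
    (h : Tendsto (fun n => lpNorm (Y n - X n) 2 μ) atTop (𝓝 0)) :
    TendstoInDistribution Y atTop Z (fun _ => μ) μ' :=
  tendstoInDistribution_of_tendstoInMeasure_sub Y Z hZ
    (tendstoInMeasure_zero_of_lpNorm (fun n => (hY n).sub (hX n)) h)
    fun n => (hY n).aestronglyMeasurable.aemeasurable

/-- The map `x ↦ exp (i t x)` is `|t|`-Lipschitz, and on a probability space the `L¹` norm is at
most the `L²` norm. -/
lemma norm_charFun_sub_le {X Y : Ω → ℝ} (hX : MemLp X 2 μ) (hY : MemLp Y 2 μ) (t : ℝ) :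
    ‖charFun (μ.map X) t - charFun (μ.map Y) t‖ ≤ |t| * lpNorm (X - Y) 2 μ := by
  have hXm := hX.aestronglyMeasurable.aemeasurable
  have hYm := hY.aestronglyMeasurable.aemeasurable
  have hb : ∀ {Z : Ω → ℝ}, AEMeasurable Z μ →
      Integrable (fun ω => Complex.exp (t * Z ω * Complex.I)) μ := by
    intro Z hZ
    refine Integrable.of_bound (C := 1) (by fun_prop) (ae_of_all _ fun ω => ?_)
    rw [← Complex.ofReal_mul, Complex.norm_exp_ofReal_mul_I]
  rw [charFun_apply_real, charFun_apply_real, integral_map hXm (by fun_prop),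
    integral_map hYm (by fun_prop), ← integral_sub (hb hXm) (hb hYm)]
  have h1 : ∀ ω, ‖Complex.exp (t * X ω * Complex.I) - Complex.exp (t * Y ω * Complex.I)‖ ≤
      |t| * ‖(X - Y) ω‖ := by
    intro ω
    have h2 : Complex.exp (t * X ω * Complex.I) - Complex.exp (t * Y ω * Complex.I) =
        Complex.exp (((t * Y ω : ℝ) : ℂ) * Complex.I) *
          (Complex.exp (Complex.I * ((t * (X ω - Y ω) : ℝ) : ℂ)) - 1) := by
      rw [mul_sub, ← Complex.exp_add]
      push_cast
      ring_nf
    rw [h2, norm_mul, Complex.norm_exp_ofReal_mul_I, one_mul]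
    refine (Real.norm_exp_I_mul_ofReal_sub_one_le).trans ?_
    simp
  have hint : Integrable (X - Y) μ := (hX.sub hY).integrable (by norm_num)
  refine (norm_integral_le_of_norm_le (hint.norm.const_mul _) (ae_of_all _ h1)).trans ?_
  rw [integral_const_mul]
  gcongr
  rw [← lpNorm_one_eq_integral_norm hint.aestronglyMeasurable,
    ← toReal_eLpNorm hint.aestronglyMeasurable, ← toReal_eLpNorm hint.aestronglyMeasurable]
  exact ENNReal.toReal_mono (hX.sub hY).eLpNorm_ne_top
    (eLpNorm_le_eLpNorm_of_exponent_le (by norm_num) hint.aestronglyMeasurable)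

lemma tendstoInDistribution_of_iid {X : ℕ → Ω → ℝ} {v : ℝ} (hX2 : MemLp (X 0) 2 μ)
    (hindep : iIndepFun X μ) (hident : ∀ i, IdentDistrib (X i) (X 0) μ μ)
    (h0 : ∫ ω, X 0 ω ∂μ = 0) (hv : ∫ ω, X 0 ω ^ 2 ∂μ = v) :
    TendstoInDistribution (fun (n : ℕ) ω => (√(n : ℝ))⁻¹ * ∑ k ∈ Finset.range n, X k ω) atTop
      (id : ℝ → ℝ) (fun _ => μ) (gaussianReal 0 v.toNNReal) := by
  have hvar : Var[X 0; μ] = v := by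
    rw [variance_of_integral_eq_zero hX2.aestronglyMeasurable.aemeasurable h0, ← hv]
  have hlaw : HasLaw (id : ℝ → ℝ) (gaussianReal 0 Var[X 0; μ].toNNReal)
      (gaussianReal 0 v.toNNReal) := by
    rw [hvar]; exact HasLaw.id
  have := tendstoInDistribution_inv_sqrt_mul_sum_sub hlaw hX2 hindep hident
  simpa only [h0, mul_zero, sub_zero] using this

/-- Convergence in distribution to a centred Gaussian through `L²` approximations. -/
lemma tendstoInDistribution_gaussian_of_approx {Y : ℕ → Ω → ℝ} {X : ℕ → ℕ → Ω → ℝ}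
    {w : ℝ} {wq a : ℕ → ℝ} {b : ℕ → ℕ → ℝ}
    (hX : ∀ q n, MemLp (X q n) 2 μ) (hY : ∀ n, MemLp (Y n) 2 μ)
    (hXd : ∀ q, TendstoInDistribution (X q) atTop (id : ℝ → ℝ) (fun _ => μ)
      (gaussianReal 0 (wq q).toNNReal))
    (hw : Tendsto wq atTop (𝓝 w)) (ha : Tendsto a atTop (𝓝 0))
    (hb : ∀ q, Tendsto (b q) atTop (𝓝 0))
    (hab : ∀ q n, lpNorm (Y n - X q n) 2 μ ≤ a q + b q n) :
    TendstoInDistribution Y atTop (id : ℝ → ℝ) (fun _ => μ) (gaussianReal 0 w.toNNReal) where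
  forall_aemeasurable n := (hY n).aestronglyMeasurable.aemeasurable
  tendsto := by
    refine ProbabilityMeasure.tendsto_iff_tendsto_charFun.2 fun t => ?_
    have hXc : ∀ q, Tendsto (fun n => charFun (μ.map (X q n)) t) atTop
        (𝓝 (charFun (gaussianReal 0 (wq q).toNNReal) t)) := fun q => by
      simpa using ProbabilityMeasure.tendsto_iff_tendsto_charFun.1 (hXd q).tendsto t
    have hg : Tendsto (fun q => charFun (gaussianReal 0 (wq q).toNNReal) t) atTop
        (𝓝 (charFun (gaussianReal 0 w.toNNReal) t)) := by
      simp_rw [charFun_gaussianReal]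
      have h1 : Tendsto (fun q => (((wq q).toNNReal : ℝ) : ℂ)) atTop (𝓝 ((w.toNNReal : ℝ) : ℂ)) :=
        (Complex.continuous_ofReal.tendsto _).comp
          ((NNReal.continuous_coe.tendsto _).comp ((continuous_real_toNNReal.tendsto _).comp hw))
      have h2 : Continuous (fun z : ℂ => Complex.exp (t * (0 : ℝ) * Complex.I - z * t ^ 2 / 2)) := by
        fun_prop
      exact (h2.tendsto _).comp h1
    simp only [ProbabilityMeasure.coe_mk, Measure.map_id]
    rw [Metric.tendsto_atTop']
    intro ε hε
    have e1 : ∀ᶠ q in atTop, dist (charFun (gaussianReal 0 (wq q).toNNReal) t)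
        (charFun (gaussianReal 0 w.toNNReal) t) < ε / 4 :=
      Metric.tendsto_nhds.1 hg _ (by positivity)
    have e2 : ∀ᶠ q in atTop, |t| * a q < ε / 4 := by
      have := ha.const_mul |t|
      rw [mul_zero] at this
      exact this.eventually (gt_mem_nhds (by positivity))
    -- The order of choices matters: `b q n` tends to `0` only for a fixed `q`, so `q` is chosen
    -- before `n`.
    obtain ⟨q, hq1, hq2⟩ := (e1.and e2).exists
    have e3 : ∀ᶠ n in atTop, |t| * b q n < ε / 4 := by
      have := (hb q).const_mul |t|
      rw [mul_zero] at this
      exact this.eventually (gt_mem_nhds (by positivity))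
    have e4 := Metric.tendsto_nhds.1 (hXc q) (ε / 4) (by positivity)
    obtain ⟨N, hN⟩ := eventually_atTop.1 (e3.and e4)
    refine ⟨N, fun n hn => ?_⟩
    obtain ⟨h3, h4⟩ := hN n hn.le
    have h5 : dist (charFun (μ.map (Y n)) t) (charFun (μ.map (X q n)) t) ≤
        |t| * a q + |t| * b q n := by
      rw [dist_eq_norm]
      refine (norm_charFun_sub_le (hY n) (hX q n) t).trans ?_
      rw [← mul_add]
      gcongr
      exact hab q n
    have h6 := dist_triangle4 (charFun (μ.map (Y n)) t) (charFun (μ.map (X q n)) t)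
      (charFun (gaussianReal 0 (wq q).toNNReal) t) (charFun (gaussianReal 0 w.toNNReal) t)
    linarith

end Distribution

/-! ### Central limit theorem for stationary one-dependent sequences by big blocks. -/

lemma sum_range_mul_eq {M : Type*} [AddCommMonoid M] (f : ℕ → M) (n Q : ℕ) :
    ∑ i ∈ Finset.range (n * Q), f i =
      ∑ j ∈ Finset.range n, ∑ i ∈ Finset.range Q, f (j * Q + i) := by
  induction n with
  | zero => simp
  | succ n ih => rw [Nat.succ_mul, Finset.sum_range_add, ih, Finset.sum_range_succ]

lemma abs_sub_mul_div_le (n B : ℕ) (hB : 0 < B) : |(n : ℝ) - B * (n / B : ℕ)| ≤ B := by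
  have h1 : ((B * (n / B) + n % B : ℕ) : ℝ) = n := by rw [Nat.div_add_mod]
  have h2 : ((n % B : ℕ) : ℝ) ≤ B := by exact_mod_cast (Nat.mod_lt n hB).le
  have h3 : (0 : ℝ) ≤ (n % B : ℕ) := by positivity
  push_cast at h1
  rw [abs_le]
  constructor <;> linarith

section BlockFactor

variable {E : Type*} [MeasurableSpace E] (ν : Measure E) [IsProbabilityMeasure ν]

local notation "ν∞" => Measure.infinitePi (fun _ : ℕ => ν)

lemma integral_comp_shift (X : (ℕ → E) → ℝ) (hX : Measurable X) (a : ℕ) :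
    ∫ x, X (shift a x) ∂ν∞ = ∫ x, X x ∂ν∞ := by
  rw [← integral_map (measurable_shift a).aemeasurable hX.aestronglyMeasurable,
    (measurePreserving_shift ν a).map_eq]

lemma memLp_comp_shift {X : (ℕ → E) → ℝ} (hX : MemLp X 2 ν∞) (a : ℕ) :
    MemLp (fun x => X (shift a x)) 2 ν∞ :=
  hX.comp_measurePreserving (measurePreserving_shift ν a)

lemma lpNorm_comp_shift {X : (ℕ → E) → ℝ} (hX : MemLp X 2 ν∞) (hXm : Measurable X) (a : ℕ) :
    lpNorm (fun x => X (shift a x)) 2 ν∞ = lpNorm X 2 ν∞ := by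
  rw [lpNorm_eq_sqrt hX, lpNorm_eq_sqrt (memLp_comp_shift ν hX a),
    integral_comp_shift ν (fun x => X x ^ 2) (by fun_prop)]

lemma integral_mul_shift_eq_zero {X Z : (ℕ → E) → ℝ} (hX : Measurable X) (hZ : Measurable Z)
    {k : ℕ} (hXk : DependsOn X (Set.Iio k)) (hZk : DependsOn Z (Set.Iio k))
    (h0 : ∫ x, X x ∂ν∞ = 0) : ∫ x, X x * Z (shift k x) ∂ν∞ = 0 := by
  have h := (indepFun_shift ν hX hZ hXk hZk).integral_fun_mul_eq_mul_integral
    hX.aestronglyMeasurable (hZ.comp (measurable_shift k)).aestronglyMeasurable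
  rw [h, h0, zero_mul]

variable {X : (ℕ → E) → ℝ} {B : ℕ}

lemma integral_shift_mul_shift (hX : Measurable X) (i k : ℕ) :
    ∫ x, X (shift (i * B) x) * X (shift ((i + k) * B) x) ∂ν∞ =
      ∫ x, X x * X (shift (k * B) x) ∂ν∞ := by
  rw [← integral_comp_shift ν (fun x => X x * X (shift (k * B) x)) (by fun_prop) (i * B)]
  simp [add_mul]

lemma integral_mul_shift_of_two_le (hX : Measurable X) (hB : DependsOn X (Set.Iio (2 * B)))
    (h0 : ∫ x, X x ∂ν∞ = 0) {k : ℕ} (hk : 2 ≤ k) :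
    ∫ x, X x * X (shift (k * B) x) ∂ν∞ = 0 := by
  have h : Set.Iio (2 * B) ⊆ Set.Iio (k * B) := Set.Iio_subset_Iio (Nat.mul_le_mul_right B hk)
  exact integral_mul_shift_eq_zero ν hX hX (hB.mono h) (hB.mono h) h0

/-- **Central limit theorem** for the stationary one-dependent sequence `X ∘ shift (i * B)`:
second moments. -/
lemma tendsto_integral_sq_blockSum (hX : Measurable X) (hX2 : MemLp X 2 ν∞)
    (hB : DependsOn X (Set.Iio (2 * B))) (h0 : ∫ x, X x ∂ν∞ = 0) :
    Tendsto (fun N : ℕ => (N : ℝ)⁻¹ *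
      ∫ x, (∑ i ∈ Finset.range N, X (shift (i * B) x)) ^ 2 ∂ν∞) atTop
      (𝓝 (∫ x, X x * X x ∂ν∞ + 2 * ∫ x, X x * X (shift B x) ∂ν∞)) := by
  have := tendsto_integral_sq_sum_div (X := fun i x => X (shift (i * B) x))
    (r := fun k => ∫ x, X x * X (shift (k * B) x) ∂ν∞) (m := 1) (μ := ν∞)
    (fun i => memLp_comp_shift ν hX2 _) (fun i k => integral_shift_mul_shift ν hX i k)
    (fun k hk => integral_mul_shift_of_two_le ν hX hB h0 (by lia))
  simpa using this

/-- The sum of the first `q + 1` terms in a block of `q + 2` terms, normalised by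
`√(q + 2)`. -/
noncomputable def blockSum (X : (ℕ → E) → ℝ) (B q : ℕ) (x : ℕ → E) : ℝ :=
  (√((q : ℝ) + 2))⁻¹ * ∑ i ∈ Finset.range (q + 1), X (shift (i * B) x)

@[fun_prop] lemma measurable_blockSum (hX : Measurable X) (q : ℕ) :
    Measurable (blockSum X B q) := by
  unfold blockSum
  fun_prop

lemma memLp_blockSum (hX2 : MemLp X 2 ν∞) (q : ℕ) : MemLp (blockSum X B q) 2 ν∞ :=
  (memLp_sum_range (fun i => memLp_comp_shift ν hX2 (i * B)) _).const_mul _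

omit [MeasurableSpace E] in
-- The last retained term starts at `q * B` and reads `2 * B` coordinates, so it stops at the
-- block's end. The omitted term would straddle two blocks; leaving it out is what makes the block
-- sums independent.
lemma dependsOn_blockSum (hB : DependsOn X (Set.Iio (2 * B))) (q : ℕ) :
    DependsOn (blockSum X B q) (Set.Iio ((q + 2) * B)) := by
  intro x y hxy
  unfold blockSum
  congr 1
  refine Finset.sum_congr rfl fun i hi => ?_
  have hi' := Finset.mem_range.1 hi
  refine DependsOn.comp_shift hB (M := (q + 2) * B) ?_ hxy
  rw [← add_mul]
  exact Nat.mul_le_mul_right B (by lia)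

lemma integral_blockSum (hX : Measurable X) (hX2 : MemLp X 2 ν∞) (h0 : ∫ x, X x ∂ν∞ = 0) (q : ℕ) :
    ∫ x, blockSum X B q x ∂ν∞ = 0 := by
  unfold blockSum
  rw [integral_const_mul, integral_finsetSum]
  · simp [integral_comp_shift ν X hX, h0]
  · exact fun i _ => (memLp_comp_shift ν hX2 _).integrable (by norm_num)

lemma tendstoInDistribution_blockSum (hX : Measurable X) (hX2 : MemLp X 2 ν∞)
    (hB : DependsOn X (Set.Iio (2 * B))) (h0 : ∫ x, X x ∂ν∞ = 0) (q : ℕ) :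
    TendstoInDistribution (fun (M : ℕ) x => (√(M : ℝ))⁻¹ *
        ∑ j ∈ Finset.range M, blockSum X B q (shift (j * ((q + 2) * B)) x)) atTop
      (id : ℝ → ℝ) (fun _ => ν∞) (gaussianReal 0 (∫ x, blockSum X B q x ^ 2 ∂ν∞).toNNReal) := by
  have hA := measurable_blockSum (B := B) hX q
  have hA0 := integral_blockSum (B := B) ν hX hX2 h0 q
  have hident : ∀ i : ℕ, IdentDistrib (fun x => blockSum X B q (shift (i * ((q + 2) * B)) x))
      (fun x => blockSum X B q (shift (0 * ((q + 2) * B)) x)) ν∞ ν∞ := by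
    have hi : ∀ a, IdentDistrib (fun x => blockSum X B q (shift a x)) (blockSum X B q) ν∞ ν∞ := by
      refine fun a => ⟨by fun_prop, by fun_prop, ?_⟩
      have := Measure.map_map (μ := ν∞) hA (measurable_shift a)
      rw [(measurePreserving_shift ν a).map_eq] at this
      exact this.symm
    exact fun i => (hi _).trans (hi _).symm
  have hindep : iIndepFun (fun (j : ℕ) x => blockSum X B q (shift (j * ((q + 2) * B)) x)) ν∞ :=
    iIndepFun_shift ν (fun _ => hA) (fun _ => dependsOn_blockSum hB q)
  have hmem : MemLp (fun x => blockSum X B q (shift (0 * ((q + 2) * B)) x)) 2 ν∞ :=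
    memLp_comp_shift ν (memLp_blockSum ν hX2 q) _
  have hmean : ∫ x, blockSum X B q (shift (0 * ((q + 2) * B)) x) ∂ν∞ = 0 := by
    simpa using hA0
  have hsq : ∫ x, blockSum X B q (shift (0 * ((q + 2) * B)) x) ^ 2 ∂ν∞ =
      ∫ x, blockSum X B q x ^ 2 ∂ν∞ := by simp
  exact tendstoInDistribution_of_iid hmem hindep hident hmean hsq

end BlockFactor

section BlockFactor

variable {E : Type*} [MeasurableSpace E] (ν : Measure E) [IsProbabilityMeasure ν]

local notation "ν∞" => Measure.infinitePi (fun _ : ℕ => ν)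

variable {X : (ℕ → E) → ℝ} {B : ℕ}

omit [MeasurableSpace E] in
-- Retained terms, the one omitted term of each block, and the incomplete last block. Only the first
-- sum matters in the limit.
lemma sum_eq_blockSum_add (X : (ℕ → E) → ℝ) (B q N : ℕ) (x : ℕ → E) :
    ∑ i ∈ Finset.range N, X (shift (i * B) x) =
      √((q : ℝ) + 2) * ∑ j ∈ Finset.range (N / (q + 2)), blockSum X B q (shift (j * ((q + 2) * B)) x)
      + ∑ j ∈ Finset.range (N / (q + 2)), X (shift ((q + 1) * B) (shift (j * ((q + 2) * B)) x))
      + ∑ i ∈ Finset.range (N % (q + 2)), X (shift ((N / (q + 2) * (q + 2) + i) * B) x) := by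
  conv_lhs => rw [← Nat.div_add_mod' N (q + 2), Finset.sum_range_add, sum_range_mul_eq]
  congr 1
  rw [Finset.mul_sum, ← Finset.sum_add_distrib]
  refine Finset.sum_congr rfl fun j _ => ?_
  have h2 : √((q : ℝ) + 2) ≠ 0 := by positivity
  rw [Finset.sum_range_succ, blockSum, mul_inv_cancel_left₀ h2]
  simp only [shift_shift, add_mul, mul_assoc]

lemma lpNorm_sum_blockSum (hX : Measurable X) (hX2 : MemLp X 2 ν∞)
    (hB : DependsOn X (Set.Iio (2 * B))) (h0 : ∫ x, X x ∂ν∞ = 0) (q M : ℕ) :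
    lpNorm (fun x => ∑ j ∈ Finset.range M, blockSum X B q (shift (j * ((q + 2) * B)) x)) 2 ν∞ =
      √M * lpNorm (blockSum X B q) 2 ν∞ := by
  have hA := measurable_blockSum (B := B) hX q
  have hA2 := memLp_blockSum (B := B) ν hX2 q
  have hA0 := integral_blockSum (B := B) ν hX hX2 h0 q
  have hAB := dependsOn_blockSum hB q
  rw [lpNorm_eq_sqrt hA2]
  refine lpNorm_sum_of_orthogonal
    (X := fun j x => blockSum X B q (shift (j * ((q + 2) * B)) x))
    (fun j => memLp_comp_shift ν hA2 _) (fun j => ?_) (fun j k => ?_) M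
  · simp_rw [← pow_two]
    exact integral_comp_shift ν (fun x => blockSum X B q x ^ 2) (by fun_prop) _
  · rw [integral_shift_mul_shift ν hA j (k + 1)]
    have hs : Set.Iio ((q + 2) * B) ⊆ Set.Iio ((k + 1) * ((q + 2) * B)) :=
      Set.Iio_subset_Iio (Nat.le_mul_of_pos_left _ k.succ_pos)
    exact integral_mul_shift_eq_zero ν hA hA (hAB.mono hs) (hAB.mono hs) hA0

/-- Omitted terms of different blocks start at least `2 * B` apart, hence are orthogonal; their sum
grows like the square root of the number of blocks, which is small against the main term once `q` is
large. -/
lemma lpNorm_sum_gap (hX : Measurable X) (hX2 : MemLp X 2 ν∞)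
    (hB : DependsOn X (Set.Iio (2 * B))) (h0 : ∫ x, X x ∂ν∞ = 0) (q M : ℕ) :
    lpNorm (fun x => ∑ j ∈ Finset.range M,
      X (shift ((q + 1) * B) (shift (j * ((q + 2) * B)) x))) 2 ν∞ = √M * lpNorm X 2 ν∞ := by
  rw [lpNorm_eq_sqrt hX2]
  refine lpNorm_sum_of_orthogonal
    (X := fun j x => X (shift ((q + 1) * B) (shift (j * ((q + 2) * B)) x)))
    (fun j => ?_) (fun j => ?_) (fun j k => ?_) M
  · simp_rw [shift_shift]
    exact memLp_comp_shift ν hX2 _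
  · simp_rw [← pow_two, shift_shift]
    exact integral_comp_shift ν (fun x => X x ^ 2) (by fun_prop) _
  · rw [integral_shift_mul_shift ν (X := fun x => X (shift ((q + 1) * B) x)) (by fun_prop) j (k + 1)]
    have h := integral_mul_shift_of_two_le ν hX hB h0 (k := (k + 1) * (q + 2)) (by nlinarith)
    rw [← h, ← integral_comp_shift ν (fun x => X x * X (shift ((k + 1) * (q + 2) * B) x))
      (by fun_prop) ((q + 1) * B)]
    refine integral_congr_ae (ae_of_all _ fun x => ?_)
    simp only [shift_shift]
    ring_nf

lemma tendsto_sqrt_div_mul (Q : ℕ) (hQ : 0 < Q) :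
    Tendsto (fun N : ℕ => (√(N : ℝ))⁻¹ * √(Q : ℝ) * √((N / Q : ℕ) : ℝ)) atTop (𝓝 1) := by
  have h1 : Tendsto (fun N : ℕ => (Q : ℝ) * ((N / Q : ℕ) : ℝ) / N) atTop (𝓝 1) := by
    have h2 : Tendsto (fun N : ℕ => (Q : ℝ) / N) atTop (𝓝 0) :=
      tendsto_const_div_atTop_nhds_zero_nat _
    have h3 : Tendsto (fun N : ℕ => (Q : ℝ) * ((N / Q : ℕ) : ℝ) / N - 1) atTop (𝓝 0) := by
      refine squeeze_zero_norm' ?_ h2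
      filter_upwards [eventually_gt_atTop 0] with N hN
      have hN' : (0 : ℝ) < N := by exact_mod_cast hN
      have := abs_sub_mul_div_le N Q hQ
      rw [Real.norm_eq_abs, div_sub_one hN'.ne', abs_div, abs_of_pos hN', abs_sub_comm]
      gcongr
    simpa using h3.add_const 1
  have h4 := (Real.continuous_sqrt.tendsto 1).comp h1
  rw [Real.sqrt_one] at h4
  refine h4.congr fun N => ?_
  simp only [Function.comp_apply]
  rw [Real.sqrt_div (by positivity), Real.sqrt_mul (by positivity)]
  ring

/-- **Central limit theorem** for the stationary one-dependent sequence `X ∘ shift (i * B)`. -/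
theorem tendstoInDistribution_blockFactor (hX : Measurable X) (hX2 : MemLp X 2 ν∞)
    (hB : DependsOn X (Set.Iio (2 * B))) (h0 : ∫ x, X x ∂ν∞ = 0) :
    TendstoInDistribution (fun (N : ℕ) x => (√(N : ℝ))⁻¹ *
        ∑ i ∈ Finset.range N, X (shift (i * B) x)) atTop
      (id : ℝ → ℝ) (fun _ => ν∞) (gaussianReal 0
        (∫ x, X x * X x ∂ν∞ + 2 * ∫ x, X x * X (shift B x) ∂ν∞).toNNReal) := by
  set g := lpNorm X 2 ν∞ with hg
  have hg0 : 0 ≤ g := lpNorm_nonneg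
  have hXs : ∀ a, MemLp (fun x => X (shift a x)) 2 ν∞ := memLp_comp_shift ν hX2
  have hA2 := fun q => memLp_blockSum (B := B) ν hX2 q
  have hinv : Tendsto (fun N : ℕ => (√(N : ℝ))⁻¹) atTop (𝓝 0) :=
    tendsto_inv_atTop_zero.comp (Real.tendsto_sqrt_atTop.comp tendsto_natCast_atTop_atTop)
  -- `a q` bounds the contribution of the omitted terms; `b q N` bounds that of the incomplete block
  -- plus the error of replacing `√N` by `√(q + 2) * √(N / (q + 2))`.
  refine tendstoInDistribution_gaussian_of_approx
    (X := fun q N x => (√((N / (q + 2) : ℕ) : ℝ))⁻¹ *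
      ∑ j ∈ Finset.range (N / (q + 2)), blockSum X B q (shift (j * ((q + 2) * B)) x))
    (wq := fun q => ∫ x, blockSum X B q x ^ 2 ∂ν∞)
    (a := fun q => (√((q : ℝ) + 2))⁻¹ * g)
    (b := fun q N => (√(N : ℝ))⁻¹ * ((q + 2) * g) +
      |(√(N : ℝ))⁻¹ * √((q + 2 : ℕ) : ℝ) * √((N / (q + 2) : ℕ) : ℝ) - 1|
        * lpNorm (blockSum X B q) 2 ν∞) ?_ ?_ ?_ ?_ ?_ ?_ ?_
  · exact fun q n => (memLp_sum_range (fun j => memLp_comp_shift ν (hA2 q) _) _).const_mul _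
  · exact fun n => (memLp_sum_range (fun j => hXs _) _).const_mul _
  · exact fun q => (tendstoInDistribution_blockSum ν hX hX2 hB h0 q).comp_index
      (Nat.tendsto_div_const_atTop (by lia))
  -- A block sum has `q + 1` terms but is normalised by `√(q + 2)`, hence the correcting ratio `(q +
  -- 1) / (q + 2)`.
  · have h1 := (tendsto_integral_sq_blockSum ν hX hX2 hB h0).comp (tendsto_add_atTop_nat 1)
    have h2 : Tendsto (fun q : ℕ => ((q : ℝ) + 1) / (q + 2)) atTop (𝓝 1) := by
      have := tendsto_natCast_div_add_atTop (𝕜 := ℝ) 1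
      have h3 := this.comp (tendsto_add_atTop_nat 1)
      refine h3.congr fun q => ?_
      simp only [Function.comp_apply]
      push_cast
      ring
    have h4 := h2.mul h1
    rw [one_mul] at h4
    refine h4.congr fun q => ?_
    simp only [Function.comp_apply, blockSum, mul_pow]
    rw [integral_const_mul, inv_pow, Real.sq_sqrt (by positivity)]
    push_cast
    have : (q : ℝ) + 1 ≠ 0 := by positivity
    field_simp
  · have h1 := ((hinv.comp (tendsto_add_atTop_nat 2)).mul_const g)
    rw [zero_mul] at h1
    refine h1.congr fun q => ?_
    simp
  · intro q
    have h1 := hinv.mul_const (((q : ℝ) + 2) * g)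
    have h2 := (((tendsto_sqrt_div_mul (q + 2) (by lia)).sub_const 1).abs).mul_const
      (lpNorm (blockSum X B q) 2 ν∞)
    simpa using h1.add h2
  · intro q N
    set M := N / (q + 2) with hM
    have hq0 : (0 : ℝ) < √((q : ℝ) + 2) := by positivity
    set S : (ℕ → E) → ℝ := fun x =>
      ∑ j ∈ Finset.range M, blockSum X B q (shift (j * ((q + 2) * B)) x) with hS
    set D : (ℕ → E) → ℝ := fun x =>
      ∑ j ∈ Finset.range M, X (shift ((q + 1) * B) (shift (j * ((q + 2) * B)) x)) with hD
    set R : (ℕ → E) → ℝ := fun x =>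
      ∑ i ∈ Finset.range (N % (q + 2)), X (shift ((M * (q + 2) + i) * B) x) with hR
    have hS2 : MemLp S 2 ν∞ := memLp_sum_range (fun j => memLp_comp_shift ν (hA2 q) _) _
    have hD2 : MemLp D 2 ν∞ := by
      simp only [hD, shift_shift]
      exact memLp_sum_range (fun j => hXs _) _
    have hR2 : MemLp R 2 ν∞ := memLp_sum_range (fun j => hXs _) _
    have hdec : ((fun x => (√(N : ℝ))⁻¹ * ∑ i ∈ Finset.range N, X (shift (i * B) x)) -
        fun x => (√(M : ℝ))⁻¹ * S x) =
        (((√(N : ℝ))⁻¹ * √((q : ℝ) + 2) - (√(M : ℝ))⁻¹) • S) + ((√(N : ℝ))⁻¹ • D +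
          (√(N : ℝ))⁻¹ • R) := by
      ext x
      simp only [Pi.sub_apply, Pi.add_apply, Pi.smul_apply, smul_eq_mul]
      rw [sum_eq_blockSum_add X B q N x]
      simp only [hS, hD, hR, ← hM]
      ring
    rw [hdec]
    have hnS := lpNorm_sum_blockSum ν hX hX2 hB h0 q M
    have hnD := lpNorm_sum_gap ν hX hX2 hB h0 q M
    have hnR : lpNorm R 2 ν∞ ≤ (q + 2) * g := by
      refine (lpNorm_sum_range_le (C := g) (fun i _ => hXs _)
        (fun i _ => (lpNorm_comp_shift ν hX2 hX _).le)).trans ?_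
      have : ((N % (q + 2) : ℕ) : ℝ) ≤ q + 2 := by
        exact_mod_cast (Nat.mod_lt N (by lia)).le
      rw [Finset.card_range]
      gcongr
    refine (lpNorm_add_le (hS2.const_smul _) (by norm_num)).trans ?_
    have h3 := lpNorm_add_le (g := (√(N : ℝ))⁻¹ • R) (hD2.const_smul (√(N : ℝ))⁻¹)
      (p := 2) (by norm_num)
    rw [lpNorm_const_smul, lpNorm_const_smul] at h3
    rw [lpNorm_const_smul]
    simp only [coe_nnnorm, Real.norm_eq_abs, abs_inv, abs_of_nonneg (Real.sqrt_nonneg _)] at *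
    have e1 : |(√(N : ℝ))⁻¹ * √((q : ℝ) + 2) - (√(M : ℝ))⁻¹| * lpNorm S 2 ν∞ ≤
        |(√(N : ℝ))⁻¹ * √((q + 2 : ℕ) : ℝ) * √(M : ℝ) - 1| * lpNorm (blockSum X B q) 2 ν∞ := by
      rw [hnS, ← mul_assoc]
      refine mul_le_mul_of_nonneg_right ?_ lpNorm_nonneg
      push_cast
      rcases Nat.eq_zero_or_pos M with h | h
      · simp [h]
      · have hMs : √(M : ℝ) ≠ 0 := by positivity
        rw [← abs_of_nonneg (Real.sqrt_nonneg (M : ℝ)), ← abs_mul, sub_mul,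
          abs_of_nonneg (Real.sqrt_nonneg (M : ℝ)), inv_mul_cancel₀ hMs]
    have e2 : (√(N : ℝ))⁻¹ * lpNorm D 2 ν∞ ≤ (√((q : ℝ) + 2))⁻¹ * g := by
      rw [hnD, ← mul_assoc]
      refine mul_le_mul_of_nonneg_right ?_ hg0
      rcases Nat.eq_zero_or_pos N with h | h
      · simp [h]
      · have hN' : (0 : ℝ) < N := by exact_mod_cast h
        rw [inv_mul_le_iff₀ (by positivity), ← div_eq_mul_inv, le_div_iff₀ hq0,
          ← Real.sqrt_mul (by positivity)]
        refine Real.sqrt_le_sqrt ?_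
        exact_mod_cast Nat.div_mul_le_self N (q + 2)
    have e3 : (√(N : ℝ))⁻¹ * lpNorm R 2 ν∞ ≤ (√(N : ℝ))⁻¹ * ((q + 2) * g) := by gcongr
    linarith

end BlockFactor

/-! ### Joint central limit theorem for moving averages with different steps. -/

section MovingAverage

variable {E : Type*} [MeasurableSpace E] (ν : Measure E) [IsProbabilityMeasure ν]

local notation "ν∞" => Measure.infinitePi (fun _ : ℕ => ν)

/-- The average of the first `k` terms of the sequence `F ∘ shift (j * s)`. -/
noncomputable def movingAvg (F : (ℕ → E) → ℝ) (s k : ℕ) (x : ℕ → E) : ℝ :=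
  (1 / (k : ℝ)) * ∑ j ∈ Finset.range k, F (shift (j * s) x)

lemma memLp_movingAvg {F : (ℕ → E) → ℝ} (hF : MemLp F 2 ν∞) (s k : ℕ) :
    MemLp (movingAvg F s k) 2 ν∞ :=
  (memLp_sum_range (fun _ => memLp_comp_shift ν hF _) _).const_mul _

/-- Averages over `k ≈ n / s` terms and over `N d ≈ n / s` terms agree up to `O(1 / √n)` after
scaling with `√n`. -/
lemma lpNorm_movingAvg_sub_le {F : (ℕ → E) → ℝ} (hF : Measurable F) (hF2 : MemLp F 2 ν∞)
    {s d k n N : ℕ} {C b : ℝ} (hk : 0 < k) (hN : 0 < N) (hs : 0 < s) (hd : 0 < d)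
    (hC : |(n : ℝ) - s * k| ≤ C) (hb : |(n : ℝ) - (s * d : ℕ) * N| ≤ b) :
    lpNorm (fun x => √(n : ℝ) * (movingAvg F s k x - ∫ y, F y ∂ν∞) -
      (√(((s * d : ℕ) : ℝ) * N))⁻¹ * (s * ∑ j ∈ Finset.range (N * d),
        (F (shift (j * s) x) - ∫ y, F y ∂ν∞))) 2 ν∞ ≤
      2 * (C + b) * lpNorm (fun x => F x - ∫ y, F y ∂ν∞) 2 ν∞ *
        (√(((s * d : ℕ) : ℝ) * N))⁻¹ := by
  set G : (ℕ → E) → ℝ := fun x => F x - ∫ y, F y ∂ν∞ with hG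
  have hGm : Measurable G := by fun_prop
  have hG2 : MemLp G 2 ν∞ := hF2.sub (memLp_const _)
  set g := lpNorm G 2 ν∞ with hg
  have hg0 : 0 ≤ g := lpNorm_nonneg
  have hGs : ∀ a, MemLp (fun x => G (shift a x)) 2 ν∞ := memLp_comp_shift ν hG2
  have hGn : ∀ a, lpNorm (fun x => G (shift a x)) 2 ν∞ ≤ g := fun a =>
    (lpNorm_comp_shift ν hG2 hGm a).le
  have hk' : (0 : ℝ) < k := by exact_mod_cast hk
  have hN' : (0 : ℝ) < N := by exact_mod_cast hN
  have hs' : (0 : ℝ) < s := by exact_mod_cast hs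
  have hd' : (0 : ℝ) < d := by exact_mod_cast hd
  set β := √(((s * d : ℕ) : ℝ) * N) with hβ
  have hβ2 : β ^ 2 = s * d * N := by
    rw [hβ, Real.sq_sqrt (by positivity)]; push_cast; ring
  have hβ0 : 0 < β := by rw [hβ]; push_cast; positivity
  set α := √(n : ℝ) with hα
  have hα2 : α ^ 2 = n := Real.sq_sqrt (by positivity)
  have hα0 : 0 ≤ α := Real.sqrt_nonneg _
  have hb' : |α ^ 2 - β ^ 2| ≤ b := by
    rw [hα2, hβ2]; push_cast at hb; exact hb
  have havg : ∀ x, movingAvg F s k x - ∫ y, F y ∂ν∞ =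
      (1 / (k : ℝ)) * ∑ j ∈ Finset.range k, G (shift (j * s) x) := by
    intro x
    rw [movingAvg, hG]
    simp only [Finset.sum_sub_distrib, Finset.sum_const, Finset.card_range, nsmul_eq_mul]
    field_simp
  set S : ℕ → (ℕ → E) → ℝ := fun k x => ∑ j ∈ Finset.range k, G (shift (j * s) x) with hS
  have hS2 : ∀ k, MemLp (S k) 2 ν∞ := fun k => memLp_sum_range (fun j => hGs _) _
  have hdiff : ∀ {a c : ℕ}, a ≤ c → lpNorm (S c - S a) 2 ν∞ ≤ ((c : ℝ) - a) * g := by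
    intro a c hac
    have h1 : S c - S a = fun x => ∑ j ∈ Finset.Ico a c, G (shift (j * s) x) := by
      ext x
      simp only [hS, Pi.sub_apply]
      rw [Finset.sum_Ico_eq_sub _ hac]
    rw [h1]
    refine (lpNorm_sum_range_le (fun i _ => hGs _) (fun i _ => hGn _)).trans ?_
    rw [Nat.card_Ico, Nat.cast_sub hac]
  have hdiff' : lpNorm (S k - S (N * d)) 2 ν∞ ≤ |(k : ℝ) - (N * d : ℕ)| * g := by
    rcases le_total (N * d) k with h | h
    · rw [abs_of_nonneg (by simpa using (Nat.cast_le (α := ℝ)).2 h)]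
      exact hdiff h
    · rw [abs_sub_comm, abs_of_nonneg (by simpa using (Nat.cast_le (α := ℝ)).2 h), lpNorm_sub_comm]
      exact hdiff h
  have hSk : lpNorm (S k) 2 ν∞ ≤ k * g := by
    simpa using lpNorm_sum_range_le (s := Finset.range k) (fun i _ => hGs (i * s))
      (fun i _ => hGn (i * s))
  -- Two sources of error: the weight in front of the sum, and the number of summands. Each costs at
  -- most `(C + b) * g / β`.
  have hdec : (fun x => α * (movingAvg F s k x - ∫ y, F y ∂ν∞) - β⁻¹ * (s * S (N * d) x)) =
      (α * (1 / (k : ℝ)) - β⁻¹ * s) • S k + (β⁻¹ * s) • (S k - S (N * d)) := by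
    ext x
    simp only [Pi.add_apply, Pi.smul_apply, Pi.sub_apply, smul_eq_mul]
    rw [havg]
    ring
  change lpNorm (fun x => α * (movingAvg F s k x - ∫ y, F y ∂ν∞) - β⁻¹ * (s * S (N * d) x)) 2 ν∞ ≤ _
  rw [hdec]
  refine (lpNorm_add_le ((hS2 k).const_smul _) (by norm_num)).trans ?_
  rw [lpNorm_const_smul, lpNorm_const_smul]
  simp only [coe_nnnorm, Real.norm_eq_abs]
  have e1 : |α * (1 / (k : ℝ)) - β⁻¹ * s| * lpNorm (S k) 2 ν∞ ≤ (C + b) * g * β⁻¹ := by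
    refine (mul_le_mul_of_nonneg_left hSk (abs_nonneg _)).trans ?_
    rw [← mul_assoc, mul_right_comm]
    have h1 : |α * (1 / (k : ℝ)) - β⁻¹ * s| * k = |α * β - s * k| * β⁻¹ := by
      rw [← abs_of_pos hk', ← abs_mul, abs_of_pos hk']
      conv_rhs => rw [← abs_of_pos (inv_pos.2 hβ0), ← abs_mul]
      congr 1
      field_simp
    have h2 : |α * β - s * k| ≤ C + b := by
      -- `α * |α - β|` is at most `(α + β) * |α - β| = |α ^ 2 - β ^ 2|`, so no square root has to be
      -- estimated.
      have h3 : |α * β - α ^ 2| ≤ b := by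
        have h4 : |α - β| * (α + β) ≤ b := by
          refine le_of_eq_of_le ?_ hb'
          rw [show α ^ 2 - β ^ 2 = (α - β) * (α + β) by ring, abs_mul,
            abs_of_nonneg (by positivity : 0 ≤ α + β)]
        have h5 : |α * β - α ^ 2| = |α - β| * α := by
          rw [show α * β - α ^ 2 = -((α - β) * α) by ring, abs_neg, abs_mul, abs_of_nonneg hα0]
        rw [h5]
        refine le_trans ?_ h4
        gcongr
        linarith
      have h6 := abs_add_le (α * β - α ^ 2) (α ^ 2 - s * k)
      rw [sub_add_sub_cancel, hα2] at h6
      rw [hα2] at h3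
      linarith
    rw [mul_right_comm, h1, mul_right_comm _ g]
    gcongr
  have e2 : |β⁻¹ * s| * lpNorm (S k - S (N * d)) 2 ν∞ ≤ (C + b) * g * β⁻¹ := by
    refine (mul_le_mul_of_nonneg_left hdiff' (abs_nonneg _)).trans ?_
    have h1 : |β⁻¹ * s| * |(k : ℝ) - (N * d : ℕ)| = |(s : ℝ) * k - s * d * N| * β⁻¹ := by
      rw [← abs_mul]
      conv_rhs => rw [← abs_of_pos (inv_pos.2 hβ0), ← abs_mul]
      congr 1
      push_cast
      ring
    have h2 : |(s : ℝ) * k - s * d * N| ≤ C + b := by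
      rw [abs_sub_comm] at hC
      have := abs_add_le ((s : ℝ) * k - n) (n - s * d * N)
      rw [sub_add_sub_cancel] at this
      push_cast at hb
      linarith
    rw [← mul_assoc, h1, mul_right_comm _ g]
    gcongr
  calc _ ≤ (C + b) * g * β⁻¹ + (C + b) * g * β⁻¹ := add_le_add e1 e2
    _ = _ := by ring

/-- **Joint central limit theorem** for moving averages with different steps, in Cramér–Wold form,
with convergence of second moments. -/
theorem exists_limit_movingAvg {ι : Type*} [Fintype ι] (c : ι → ℝ) {F : ι → (ℕ → E) → ℝ}
    (hF : ∀ i, Measurable (F i)) (hF2 : ∀ i, MemLp (F i) 2 ν∞) {m s : ι → ℕ} (hs : ∀ i, 0 < s i)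
    (hm : ∀ i, DependsOn (F i) (Set.Iio (m i))) {k : ι → ℕ → ℕ} {C : ℝ}
    (hk : ∀ i (n : ℕ), |(n : ℝ) - s i * k i n| ≤ C) :
    ∃ w : ℝ,
      Tendsto (fun n : ℕ => ∫ x, (√(n : ℝ) * ∑ i, c i * (movingAvg (F i) (s i) (k i n) x
        - ∫ y, F i y ∂ν∞)) ^ 2 ∂ν∞) atTop (𝓝 w) ∧
      TendstoInDistribution (fun (n : ℕ) x => √(n : ℝ) * ∑ i, c i *
        (movingAvg (F i) (s i) (k i n) x - ∫ y, F i y ∂ν∞)) atTop (id : ℝ → ℝ)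
        (fun _ => ν∞) (gaussianReal 0 w.toNNReal) := by
  classical
  -- A common multiple of all steps, no smaller than any window length `m i`; a window starting in
  -- one block of length `B` then ends within the next.
  set B : ℕ := (∏ i, s i) * (1 + ∑ i, m i) with hBdef
  have hprod : 0 < ∏ i, s i := Finset.prod_pos fun i _ => hs i
  have hB : 0 < B := by positivity
  have hdvd : ∀ i, s i ∣ B := fun i => (Finset.dvd_prod_of_mem s (Finset.mem_univ i)).mul_right _
  choose d hd using hdvd
  have hd0 : ∀ i, 0 < d i := fun i => Nat.pos_of_mul_pos_left (hd i ▸ hB)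
  have hmB : ∀ i, m i ≤ B := fun i => by
    have h1 : m i ≤ ∑ i, m i := Finset.single_le_sum (fun _ _ => Nat.zero_le _) (Finset.mem_univ i)
    calc m i ≤ 1 * (1 + ∑ i, m i) := by lia
      _ ≤ B := Nat.mul_le_mul_right _ hprod
  set G : ι → (ℕ → E) → ℝ := fun i x => F i x - ∫ y, F i y ∂ν∞ with hG
  have hGm : ∀ i, Measurable (G i) := fun i => (hF i).sub_const _
  have hG2 : ∀ i, MemLp (G i) 2 ν∞ := fun i => (hF2 i).sub (memLp_const _)
  have hG0 : ∀ i, ∫ x, G i x ∂ν∞ = 0 := fun i => by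
    simp only [hG]
    rw [integral_sub ((hF2 i).integrable (by norm_num)) (integrable_const _)]
    simp
  have hGs : ∀ i a, MemLp (fun x => G i (shift a x)) 2 ν∞ := fun i => memLp_comp_shift ν (hG2 i)
  -- The contribution of one block of length `B`: the `i`-th average has `d i = B / s i` terms
  -- there, weighted by `s i` because its number of terms is about `n / s i`.
  set X : (ℕ → E) → ℝ := fun x => (√(B : ℝ))⁻¹ *
    ∑ i, c i * (s i * ∑ j ∈ Finset.range (d i), G i (shift (j * s i) x)) with hX
  have hXm : Measurable X := by
    have : ∀ i a, Measurable fun x => G i (shift a x) := fun i a =>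
      (hGm i).comp (measurable_shift a)
    fun_prop
  have hX2 : MemLp X 2 ν∞ :=
    (memLp_finsetSum _ fun i _ =>
      ((memLp_sum_range (fun j => hGs i _) _).const_mul _).const_mul _).const_mul _
  have hX0 : ∫ x, X x ∂ν∞ = 0 := by
    simp only [hX]
    rw [integral_const_mul, integral_finsetSum]
    · refine mul_eq_zero_of_right _ (Finset.sum_eq_zero fun i _ => ?_)
      rw [integral_const_mul, integral_const_mul, integral_finsetSum]
      · simp [integral_comp_shift ν (G i) (hGm i), hG0]
      · exact fun j _ => (hGs i _).integrable (by norm_num)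
    · exact fun i _ => (((memLp_sum_range (fun j => hGs i _) _).const_mul _).const_mul
        _).integrable (by norm_num)
  have hXB : DependsOn X (Set.Iio (2 * B)) := by
    intro x y hxy
    simp only [hX]
    congr 1
    refine Finset.sum_congr rfl fun i _ => ?_
    congr 2
    refine Finset.sum_congr rfl fun j hj => ?_
    simp only [hG]
    congr 1
    refine DependsOn.comp_shift (hm i) (M := 2 * B) ?_ hxy
    have h1 : j * s i ≤ d i * s i := Nat.mul_le_mul_right _ (Finset.mem_range.1 hj).le
    have h2 := hd i
    have h3 := hmB i
    rw [mul_comm] at h2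
    lia
  set w := ∫ x, X x * X x ∂ν∞ + 2 * ∫ x, X x * X (shift B x) ∂ν∞ with hw
  have hN : Tendsto (fun n : ℕ => n / B) atTop atTop := Nat.tendsto_div_const_atTop hB.ne'
  set R : ℕ → (ℕ → E) → ℝ := fun n x => (√((n / B : ℕ) : ℝ))⁻¹ *
    ∑ i ∈ Finset.range (n / B), X (shift (i * B) x) with hR
  have hR2 : ∀ n, MemLp (R n) 2 ν∞ := fun n =>
    (memLp_sum_range (fun j => memLp_comp_shift ν hX2 _) _).const_mul _
  have hRd := (tendstoInDistribution_blockFactor ν hXm hX2 hXB hX0).comp_index hN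
  have hRsq : Tendsto (fun n => ∫ x, R n x ^ 2 ∂ν∞) atTop (𝓝 w) := by
    refine ((tendsto_integral_sq_blockSum ν hXm hX2 hXB hX0).comp hN).congr fun n => ?_
    simp only [hR, mul_pow, Function.comp_apply]
    rw [integral_const_mul, inv_pow, Real.sq_sqrt (by positivity)]
  set Q : ℕ → (ℕ → E) → ℝ := fun n x => √(n : ℝ) * ∑ i, c i *
    (movingAvg (F i) (s i) (k i n) x - ∫ y, F i y ∂ν∞) with hQ
  have hQ2 : ∀ n, MemLp (Q n) 2 ν∞ := fun n =>
    (memLp_finsetSum _ fun i _ =>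
      ((memLp_movingAvg ν (hF2 i) _ _).sub (memLp_const _)).const_mul _).const_mul _
  have hRsum : ∀ n x, R n x = ∑ i, c i * ((√(((s i * d i : ℕ) : ℝ) * (n / B : ℕ)))⁻¹ *
      (s i * ∑ j ∈ Finset.range (n / B * d i), G i (shift (j * s i) x))) := by
    intro n x
    simp only [hR, hX, ← hd]
    rw [← Finset.mul_sum, Finset.sum_comm, Finset.mul_sum, Finset.mul_sum]
    refine Finset.sum_congr rfl fun i _ => ?_
    rw [← Finset.mul_sum, ← Finset.mul_sum, sum_range_mul_eq, Real.sqrt_mul (by positivity)]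
    have h1 : ∀ l j, G i (shift (j * s i) (shift (l * B) x)) =
        G i (shift ((l * d i + j) * s i) x) := by
      intro l j
      rw [shift_shift, add_mul, mul_assoc, mul_comm (d i), ← hd]
    simp only [h1]
    rw [mul_inv]
    ring
  have hsub : Tendsto (fun n => lpNorm (Q n - R n) 2 ν∞) atTop (𝓝 0) := by
    have hlim : Tendsto (fun n : ℕ => ∑ i, |c i| * (2 * (C + B) * lpNorm (G i) 2 ν∞ *
        (√((B : ℝ) * (n / B : ℕ)))⁻¹)) atTop (𝓝 0) := by
      have h1 : Tendsto (fun n : ℕ => (√((B : ℝ) * (n / B : ℕ)))⁻¹) atTop (𝓝 0) := by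
        refine tendsto_inv_atTop_zero.comp (Real.tendsto_sqrt_atTop.comp ?_)
        exact (tendsto_natCast_atTop_atTop.comp hN).const_mul_atTop (by positivity)
      have h2 := tendsto_finsetSum (Finset.univ : Finset ι) fun i _ =>
        ((h1.const_mul (2 * (C + B) * lpNorm (G i) 2 ν∞)).const_mul |c i|)
      simpa using h2
    refine squeeze_zero' (Eventually.of_forall fun n => lpNorm_nonneg) ?_ hlim
    -- `n ≥ B` ensures at least one block, and `n > C` ensures that no average is empty.
    filter_upwards [eventually_ge_atTop B, (tendsto_natCast_atTop_atTop (R := ℝ)).eventually_gt_atTop C]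
      with n hn hnC
    have hNpos : 0 < n / B := Nat.div_pos hn hB
    have hkpos : ∀ i, 0 < k i n := fun i => by
      rcases Nat.eq_zero_or_pos (k i n) with h | h
      · have := hk i n
        rw [h] at this
        simp only [Nat.cast_zero, mul_zero, sub_zero, Nat.abs_cast] at this
        linarith
      · exact h
    have hdec : Q n - R n = fun x => ∑ i, c i * (√(n : ℝ) * (movingAvg (F i) (s i) (k i n) x -
        ∫ y, F i y ∂ν∞) - (√(((s i * d i : ℕ) : ℝ) * (n / B : ℕ)))⁻¹ *
        (s i * ∑ j ∈ Finset.range (n / B * d i), G i (shift (j * s i) x))) := by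
      ext x
      simp only [Pi.sub_apply]
      rw [hRsum n x]
      simp only [hQ]
      rw [Finset.mul_sum, ← Finset.sum_sub_distrib]
      refine Finset.sum_congr rfl fun i _ => ?_
      ring
    have hmem : ∀ i, MemLp (fun x => (√(n : ℝ) * (movingAvg (F i) (s i) (k i n) x -
        ∫ y, F i y ∂ν∞) - (√(((s i * d i : ℕ) : ℝ) * (n / B : ℕ)))⁻¹ *
        (s i * ∑ j ∈ Finset.range (n / B * d i), G i (shift (j * s i) x)))) 2 ν∞ := fun i =>
      (((memLp_movingAvg ν (hF2 i) _ _).sub (memLp_const _)).const_mul _).sub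
        (((memLp_sum_range (fun j => hGs i _) _).const_mul _).const_mul _)
    have hle := lpNorm_sum_le (s := Finset.univ) (p := 2) (fun i _ => (hmem i).const_mul (c i))
      (by norm_num)
    rw [hdec]
    have heq : ∀ f : ι → (ℕ → E) → ℝ, (∑ i, f i) = fun x => ∑ i, f i x := fun f => by ext; simp
    rw [heq] at hle
    refine hle.trans (Finset.sum_le_sum fun i _ => ?_)
    rw [lpNorm_const_mul_two]
    gcongr
    have := lpNorm_movingAvg_sub_le ν (hF i) (hF2 i) (hkpos i) hNpos (hs i) (hd0 i) (hk i n)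
      (b := B) (by rw [← hd]; exact abs_sub_mul_div_le n B hB)
    rw [← hd i] at this
    rw [← hd i]
    exact this
  exact ⟨w, tendsto_integral_sq_of_lpNorm_sub hR2 hQ2 hRsq hsub,
    tendstoInDistribution_of_lpNorm_sub hR2 hQ2 hRd hsub⟩

end MovingAverage

/-! ### Moments and laws of the trade signs. -/

section TradeSign

variable {Ω : Type*} [MeasurableSpace Ω] {μ : Measure Ω} [IsProbabilityMeasure μ]
  {X : ℝ≥0 → Ω → ℝ} {S lam : ℝ}

omit [MeasurableSpace Ω] in
lemma noise_eq (S : ℝ) (X : ℝ≥0 → Ω → ℝ) (t : ℝ≥0) :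
    noise S X t = fun ω => S / 2 * tradeSign X t ω := by
  ext ω
  simp only [noise, tradeSign]
  ring

namespace IsTradeDirection

variable (hX : IsTradeDirection X S lam μ)
include hX

omit [IsProbabilityMeasure μ]

@[fun_prop] lemma aemeasurable_tradeSign (t : ℝ≥0) : AEMeasurable (tradeSign X t) μ := by
  have := (hX.law t).aemeasurable
  unfold tradeSign
  fun_prop

lemma ae_tradeSign (t : ℝ≥0) : ∀ᵐ ω ∂μ, tradeSign X t ω = 1 ∨ tradeSign X t ω = -1 := by
  have h : ∀ᵐ x ∂(bernoulliMeasure (1 : ℝ) 0 ⟨1 / 2, by norm_num, by norm_num⟩), x = 1 ∨ x = 0 := by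
    rw [bernoulliMeasure_def, ae_add_measure_iff]
    constructor <;> refine Measure.ae_smul_measure ?_ _ <;> simp [ae_dirac_eq]
  have h2 := (hX.law t).ae_iff (p := fun x => x = 1 ∨ x = 0)
    (by
      have : MeasurableSet {x : ℝ | x = 1 ∨ x = 0} :=
        (measurableSet_singleton 1).union (measurableSet_singleton 0)
      exact measurableSet_setOfPred.1 this)
  filter_upwards [h2.2 h] with ω hω
  unfold tradeSign
  rcases hω with h | h <;> rw [h] <;> norm_num

lemma ae_tradeSign_sq (t : ℝ≥0) : ∀ᵐ ω ∂μ, tradeSign X t ω ^ 2 = 1 := by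
  filter_upwards [hX.ae_tradeSign t] with ω h
  rcases h with h | h <;> rw [h] <;> norm_num

lemma ae_abs_tradeSign (t : ℝ≥0) : ∀ᵐ ω ∂μ, |tradeSign X t ω| = 1 := by
  filter_upwards [hX.ae_tradeSign t] with ω h
  rcases h with h | h <;> rw [h] <;> norm_num

lemma integral_tradeSign (t : ℝ≥0) : ∫ ω, tradeSign X t ω ∂μ = 0 := by
  have := (hX.law t).integral_comp (f := fun x : ℝ => 2 * x - 1) (by fun_prop)
  simp only [integral_bernoulliMeasure, smul_eq_mul, Function.comp_def] at this
  unfold tradeSign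
  rw [this]
  norm_num


lemma memLp_tradeSign [IsProbabilityMeasure μ] (t : ℝ≥0) (q : ENNReal) :
    MemLp (tradeSign X t) q μ :=
  MemLp.of_bound (hX.aemeasurable_tradeSign t).aestronglyMeasurable 1 (by
    filter_upwards [hX.ae_abs_tradeSign t] with ω h
    rw [Real.norm_eq_abs, h])

/-- The noise is `S / 2` times a centred sign of variance one, so its correlation is exactly the
mean product of the signs. -/
lemma integral_tradeSign_mul [IsProbabilityMeasure μ] (hS : 0 < S) (s t : ℝ≥0) :
    ∫ ω, tradeSign X s ω * tradeSign X t ω ∂μ = Real.exp (-|(t : ℝ) - (s : ℝ)| / lam) := by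
  have hvar : ∀ t, Var[noise S X t; μ] = (S / 2) ^ 2 := by
    intro t
    rw [noise_eq, variance_const_mul, variance_of_integral_eq_zero (hX.aemeasurable_tradeSign t)
      (hX.integral_tradeSign t)]
    have : ∫ ω, tradeSign X t ω ^ 2 ∂μ = 1 := by
      rw [integral_congr_ae (hX.ae_tradeSign_sq t)]
      simp
    rw [this, mul_one]
  have hc := hX.corr_eq s t
  rw [corr, hvar, hvar, Real.sqrt_sq (by positivity), noise_eq, noise_eq,
    covariance_const_mul_left, covariance_const_mul_right,
    covariance_eq_sub (hX.memLp_tradeSign s 2) (hX.memLp_tradeSign t 2),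
    hX.integral_tradeSign, zero_mul, sub_zero] at hc
  rw [← hc]
  simp only [Pi.mul_apply]
  field_simp

lemma integral_tradeSign_mul_mul [IsProbabilityMeasure μ] (hS : 0 < S) {a b c d : ℝ≥0}
    (hab : a ≤ b) (hbc : b ≤ c) (hcd : c ≤ d) :
    ∫ ω, (tradeSign X a ω * tradeSign X b ω) * (tradeSign X c ω * tradeSign X d ω) ∂μ =
      Real.exp (-((b : ℝ) - a) / lam) * Real.exp (-((d : ℝ) - c) / lam) := by
  -- Along these times the ratios of index `1` and `3` are the two products in the integrand; the
  -- sequence stays at `d` afterwards.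
  let t : ℕ → ℝ≥0
    | 0 => a
    | 1 => b
    | 2 => c
    | _ => d
  have ht : Monotone t := by
    refine monotone_nat_of_le_succ fun n => ?_
    match n with
    | 0 => exact hab
    | 1 => exact hbc
    | 2 => exact hcd
    | n + 3 => exact le_rfl
  have h := (hX.indep t ht).indepFun (show (1 : ℕ) ≠ 3 by norm_num)
  have h2 : ∀ k, AEStronglyMeasurable (signRatio X t (k + 1)) μ := fun k =>
    ((hX.aemeasurable_tradeSign _).mul (hX.aemeasurable_tradeSign _)).aestronglyMeasurable
  have h3 := h.integral_fun_mul_eq_mul_integral (h2 0) (h2 2)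
  simp only [signRatio, t] at h3
  rw [h3, hX.integral_tradeSign_mul hS, hX.integral_tradeSign_mul hS, abs_of_nonneg, abs_of_nonneg]
  · exact sub_nonneg.2 (by exact_mod_cast hcd)
  · exact sub_nonneg.2 (by exact_mod_cast hab)

end IsTradeDirection

/-- For values `±1`, `exp (i t U) = cos t + i U sin t` is affine in `U`. The mean thus determines
the law, and equality in law of the sign changes can be read off from the autocorrelation. -/
lemma charFun_map_of_ae_sign {U : Ω → ℝ} (hU : AEMeasurable U μ)
    (h1 : ∀ᵐ ω ∂μ, U ω = 1 ∨ U ω = -1) (t : ℝ) :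
    charFun (μ.map U) t = Complex.cos t + (∫ ω, U ω ∂μ : ℝ) * (Complex.sin t * Complex.I) := by
  have hint : Integrable U μ := Integrable.of_bound hU.aestronglyMeasurable 1 (by
    filter_upwards [h1] with ω h
    rcases h with h | h <;> rw [h] <;> norm_num)
  rw [charFun_apply_real, integral_map hU (by fun_prop)]
  have h2 : ∀ᵐ ω ∂μ, Complex.exp (t * U ω * Complex.I) =
      Complex.cos t + (U ω : ℂ) * (Complex.sin t * Complex.I) := by
    filter_upwards [h1] with ω h
    rw [Complex.exp_mul_I]
    rcases h with h | h <;> rw [h] <;> simp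
  rw [integral_congr_ae h2, integral_add (integrable_const _) (hint.ofReal.mul_const _),
    integral_mul_const, integral_complex_ofReal]
  simp

lemma map_eq_of_ae_sign {U V : Ω → ℝ} (hU : AEMeasurable U μ) (hV : AEMeasurable V μ)
    (hU1 : ∀ᵐ ω ∂μ, U ω = 1 ∨ U ω = -1) (hV1 : ∀ᵐ ω ∂μ, V ω = 1 ∨ V ω = -1)
    (h : ∫ ω, U ω ∂μ = ∫ ω, V ω ∂μ) : μ.map U = μ.map V := by
  have := Measure.isProbabilityMeasure_map hU
  have := Measure.isProbabilityMeasure_map hV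
  refine Measure.ext_of_charFun (funext fun t => ?_)
  rw [charFun_map_of_ae_sign hU hU1, charFun_map_of_ae_sign hV hV1, h]

end TradeSign

/-! ### The i.i.d. sequence that drives the sampled prices. -/

section ZipLaw

variable {α β : Type*} [MeasurableSpace α] [MeasurableSpace β] (υ : Measure α) (γ : Measure β)
  [IsProbabilityMeasure υ] [IsProbabilityMeasure γ]

/-- Both measures have the same finite-dimensional marginals, and a projective limit is unique. -/
lemma map_zip_infinitePi :
    ((Measure.infinitePi fun _ : ℕ => υ).prod (Measure.infinitePi fun _ : ℕ => γ)).map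
      (fun p j => (p.1 j, p.2 j)) = Measure.infinitePi fun _ : ℕ => υ.prod γ := by
  refine IsProjectiveLimit.unique (P := fun I : Finset ℕ => Measure.pi fun _ : I => υ.prod γ) ?_
    (Measure.isProjectiveLimit_infinitePi _)
  intro I
  have hz : Measurable (fun (p : (ℕ → α) × (ℕ → β)) (j : ℕ) => (p.1 j, p.2 j)) := by fun_prop
  rw [Measure.map_map (Finset.measurable_restrict I) hz]
  have h1 : (Finset.restrict I ∘ fun (p : (ℕ → α) × (ℕ → β)) (j : ℕ) => (p.1 j, p.2 j)) =
      (MeasurableEquiv.arrowProdEquivProdArrow α β I).symm ∘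
        Prod.map (Finset.restrict I) (Finset.restrict I) := by
    ext p j <;> rfl
  rw [h1, ← Measure.map_map (by fun_prop) (by fun_prop),
    ← Measure.map_prod_map _ _ (Finset.measurable_restrict I) (Finset.measurable_restrict I),
    Measure.infinitePi_map_restrict, Measure.infinitePi_map_restrict]
  exact (measurePreserving_arrowProdEquivProdArrow α β I (fun _ => υ) (fun _ => γ)).symm.map_eq

end ZipLaw

section Driver

variable {Ω : Type*} [MeasurableSpace Ω] {μ : Measure Ω} [IsProbabilityMeasure μ]
  {P X : ℝ≥0 → Ω → ℝ} {σ S lam : ℝ} {τ : ℝ≥0}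

/-- The increment of the efficient price over the `j`-th sampling interval. -/
def priceIncr (P : ℝ≥0 → Ω → ℝ) (τ : ℝ≥0) (j : ℕ) (ω : Ω) : ℝ :=
  P (((j + 1 : ℕ) : ℝ≥0) * τ) ω - P ((j : ℝ≥0) * τ) ω

/-- The trade sign at the `j`-th sampling time. -/
def gridSign (X : ℝ≥0 → Ω → ℝ) (τ : ℝ≥0) (j : ℕ) (ω : Ω) : ℝ := tradeSign X ((j : ℝ≥0) * τ) ω

/-- The independent and identically distributed sequence driving the sampled squared increments:
sign changes together with sign-twisted efficient increments. -/
def driver (P X : ℝ≥0 → Ω → ℝ) (τ : ℝ≥0) (ω : Ω) (j : ℕ) : ℝ × ℝ :=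
  (gridSign X τ j ω * gridSign X τ (j + 1) ω, gridSign X τ j ω * priceIncr P τ j ω)

omit [MeasurableSpace Ω] in
lemma IsBrownianWithVolatility.sub_eq (hσ : 0 < σ) (s t : ℝ≥0) (ω : Ω) :
    P t ω - P s ω = σ * ((P t ω - P 0 ω) / σ - (P s ω - P 0 ω) / σ) := by
  field_simp
  ring

omit [IsProbabilityMeasure μ] in
lemma IsBrownianWithVolatility.hasLaw_sub (hP : IsBrownianWithVolatility P σ μ) (hσ : 0 < σ)
    {s t : ℝ≥0} (hst : s ≤ t) :
    HasLaw (fun ω => P t ω - P s ω) (gaussianReal 0 (.mk (σ ^ 2) (sq_nonneg _) * (t - s))) μ := by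
  have h := gaussianReal_const_mul (hP.brownian.toIsPreBrownianReal.hasLaw_sub t s) σ
  have h1 : nndist t.1 s.1 = t - s := by
    have h2 : (s : ℝ) ≤ t := by exact_mod_cast hst
    ext
    rw [coe_nndist, NNReal.coe_sub hst, Real.dist_eq]
    exact abs_of_nonneg (sub_nonneg.2 h2)
  rw [h1, mul_zero] at h
  exact h.congr (ae_of_all _ fun ω => by
    simpa using IsBrownianWithVolatility.sub_eq hσ s t ω)

omit [IsProbabilityMeasure μ] in
lemma IsBrownianWithVolatility.iIndepFun_sub (hP : IsBrownianWithVolatility P σ μ) (hσ : 0 < σ)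
    {t : ℕ → ℝ≥0} (ht : Monotone t) :
    iIndepFun (fun i ω => P (t (i + 1)) ω - P (t i) ω) μ := by
  have h := (hP.brownian.toIsPreBrownianReal.hasIndepIncrements.nat ht).comp
    (fun _ x => σ * x) (fun _ => by fun_prop)
  convert h using 2 with i
  ext ω
  exact IsBrownianWithVolatility.sub_eq hσ _ _ ω

/-- The law of a single step of the driving sequence. -/
noncomputable def driverLaw (μ : Measure Ω) (X : ℝ≥0 → Ω → ℝ) (σ : ℝ) (τ : ℝ≥0) : Measure (ℝ × ℝ) :=
  (μ.map fun ω => gridSign X τ 0 ω * gridSign X τ 1 ω).prod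
    (gaussianReal 0 (.mk (σ ^ 2) (sq_nonneg _) * τ))

lemma monotone_grid (τ : ℝ≥0) : Monotone fun j : ℕ => (j : ℝ≥0) * τ := fun i j hij => by
  have : (i : ℝ≥0) ≤ j := by exact_mod_cast hij
  dsimp only
  gcongr

omit [IsProbabilityMeasure μ] in
lemma IsTradeDirection.aemeasurable_gridSign (hX : IsTradeDirection X S lam μ) (j : ℕ) :
    AEMeasurable (gridSign X τ j) μ := hX.aemeasurable_tradeSign _

/-- Symmetry of the centred Gaussian, for a fixed sign sequence; it is applied below conditionally
on the signs. -/
lemma map_twist_infinitePi (v : ℝ≥0) {y : ℕ → ℝ} (hy : ∀ j, y j = 1 ∨ y j = -1) :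
    (Measure.infinitePi fun _ : ℕ => gaussianReal 0 v).map (fun z j => y j * z j) =
      Measure.infinitePi fun _ : ℕ => gaussianReal 0 v := by
  rw [Measure.infinitePi_map_pi (fun _ : ℕ => gaussianReal 0 v) (f := fun j z => y j * z)
    (fun j => by fun_prop)]
  congr 1
  ext1 j
  rw [gaussianReal_map_const_mul]
  congr 1
  · simp
  · ext
    rcases hy j with h | h <;> simp [h]

variable (hσ : 0 < σ) (hS : 0 < S) (hP : IsBrownianWithVolatility P σ μ)
  (hX : IsTradeDirection X S lam μ)
  (hPX : IndepFun (fun ω t => P t ω) (fun ω t => noise S X t ω) μ)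

include hS hX in
-- Independence is the assumption on sign ratios with the initial sign left out. The laws agree
-- because all the means are `exp (-τ / lam)`.
lemma hasLaw_signChange : HasLaw (fun ω j => gridSign X τ j ω * gridSign X τ (j + 1) ω)
    (Measure.infinitePi fun _ : ℕ => μ.map fun ω => gridSign X τ 0 ω * gridSign X τ 1 ω) μ := by
  have hm : ∀ j, AEMeasurable (fun ω => gridSign X τ j ω * gridSign X τ (j + 1) ω) μ := fun j =>
    (hX.aemeasurable_gridSign j).mul (hX.aemeasurable_gridSign (j + 1))
  have hs : ∀ j, ∀ᵐ ω ∂μ, gridSign X τ j ω * gridSign X τ (j + 1) ω = 1 ∨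
      gridSign X τ j ω * gridSign X τ (j + 1) ω = -1 := fun j => by
    filter_upwards [hX.ae_tradeSign ((j : ℝ≥0) * τ),
      hX.ae_tradeSign (((j + 1 : ℕ) : ℝ≥0) * τ)] with ω h1 h2
    unfold gridSign
    rcases h1 with h | h <;> rcases h2 with h' | h' <;> rw [h, h'] <;> norm_num
  have hmean : ∀ j, ∫ ω, gridSign X τ j ω * gridSign X τ (j + 1) ω ∂μ =
      Real.exp (-(τ : ℝ) / lam) := fun j => by
    unfold gridSign
    rw [hX.integral_tradeSign_mul hS]
    congr 2
    push_cast
    rw [show ((j : ℝ) + 1) * τ - j * τ = τ by ring, abs_of_nonneg (NNReal.coe_nonneg τ)]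
  have hlaw : ∀ j, HasLaw (fun ω => gridSign X τ j ω * gridSign X τ (j + 1) ω)
      (μ.map fun ω => gridSign X τ 0 ω * gridSign X τ 1 ω) μ := fun j =>
    ⟨hm j, map_eq_of_ae_sign (hm j) (hm 0) (hs j) (hs 0) (by rw [hmean, ← hmean 0])⟩
  have hind : iIndepFun (fun j ω => gridSign X τ j ω * gridSign X τ (j + 1) ω) μ :=
    iIndepFun.precomp (g := fun j : ℕ => j + 1) (add_left_injective 1)
      (hX.indep _ (monotone_grid τ))
  exact hind.hasLaw_infinitePi hlaw (aemeasurable_pi_iff.2 hm)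

omit [IsProbabilityMeasure μ] in
include hσ hP in
lemma hasLaw_priceIncr : HasLaw (fun ω j => priceIncr P τ j ω)
    (Measure.infinitePi fun _ : ℕ => gaussianReal 0 (.mk (σ ^ 2) (sq_nonneg _) * τ)) μ := by
  have hlaw : ∀ j, HasLaw (priceIncr P τ j) (gaussianReal 0 (.mk (σ ^ 2) (sq_nonneg _) * τ)) μ := by
    intro j
    have h := hP.hasLaw_sub hσ (monotone_grid τ (Nat.le_succ j))
    have h1 : ((j + 1 : ℕ) : ℝ≥0) * τ - (j : ℝ≥0) * τ = τ := by
      rw [Nat.cast_succ, add_mul, one_mul, add_tsub_cancel_left]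
    simp only [h1] at h
    exact h
  exact (hP.iIndepFun_sub hσ (monotone_grid τ)).hasLaw_infinitePi hlaw
    (aemeasurable_pi_iff.2 fun j => (hlaw j).aemeasurable)

include hσ hS hP hX hPX in
/-- The driving sequence is independent and identically distributed. -/
theorem hasLaw_driver : HasLaw (driver P X τ)
    (Measure.infinitePi fun _ : ℕ => driverLaw μ X σ τ) μ := by
  set γ := gaussianReal 0 (.mk (σ ^ 2) (sq_nonneg _) * τ) with hγ
  have hY : AEMeasurable (fun ω j => gridSign X τ j ω) μ :=
    aemeasurable_pi_iff.2 fun j => hX.aemeasurable_gridSign j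
  have hZ := hasLaw_priceIncr (τ := τ) hσ hP
  have hU := hasLaw_signChange (τ := τ) hS hX
  have hind : IndepFun (fun ω j => gridSign X τ j ω) (fun ω j => priceIncr P τ j ω) μ := by
    have := hPX.symm.comp (φ := fun (η : ℝ≥0 → ℝ) (j : ℕ) => 2 / S * η ((j : ℝ≥0) * τ))
      (ψ := fun (p : ℝ≥0 → ℝ) (j : ℕ) => p (((j + 1 : ℕ) : ℝ≥0) * τ) - p ((j : ℝ≥0) * τ))
      (by fun_prop) (by fun_prop)
    convert this using 1
    · ext ω j
      simp only [gridSign, noise_eq, Function.comp_apply]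
      field_simp
    · rfl
  have hjoint := hind.map_prod_eq_prod_map_map hY hZ.aemeasurable
  rw [hZ.map_eq] at hjoint
  have : IsProbabilityMeasure (μ.map fun ω j => gridSign X τ j ω) :=
    Measure.isProbabilityMeasure_map hY
  set u : (ℕ → ℝ) → ℕ → ℝ := fun y j => y j * y (j + 1) with hu
  have hum : Measurable u := by fun_prop
  have hpres : MeasurePreserving u (μ.map fun ω j => gridSign X τ j ω)
      (Measure.infinitePi fun _ : ℕ => μ.map fun ω => gridSign X τ 0 ω * gridSign X τ 1 ω) := by
    refine ⟨hum, ?_⟩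
    rw [AEMeasurable.map_map_of_aemeasurable hum.aemeasurable hY, ← hU.map_eq]
    rfl
  have hae : ∀ᵐ y ∂(μ.map fun ω j => gridSign X τ j ω), ∀ j, y j = 1 ∨ y j = -1 := by
    rw [ae_all_iff]
    intro j
    rw [ae_map_iff hY]
    · exact hX.ae_tradeSign _
    · exact ((measurableSet_singleton (1 : ℝ)).union (measurableSet_singleton (-1))).preimage
        (measurable_pi_apply j)
  -- The base map sends signs to sign changes, and for almost every sign sequence the fibre map
  -- preserves the Gaussian product. The twisted increments are therefore independent of the sign
  -- changes, although the signs enter both.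
  have hskew := hpres.skew_product (μc := Measure.infinitePi fun _ : ℕ => γ)
    (g := fun (y z : ℕ → ℝ) (j : ℕ) => y j * z j) (by unfold Function.uncurry; fun_prop)
    (hae.mono fun y hy => map_twist_infinitePi _ hy)
  have hUp : IsProbabilityMeasure (μ.map fun ω => gridSign X τ 0 ω * gridSign X τ 1 ω) :=
    Measure.isProbabilityMeasure_map
      ((hX.aemeasurable_gridSign 0).mul (hX.aemeasurable_gridSign 1))
  have hzip := map_zip_infinitePi (μ.map fun ω => gridSign X τ 0 ω * gridSign X τ 1 ω) γ
  have hzm : Measurable (fun (p : (ℕ → ℝ) × (ℕ → ℝ)) (j : ℕ) => (p.1 j, p.2 j)) := by fun_prop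
  have hpair := hY.prodMk hZ.aemeasurable
  have hdr : driver P X τ = ((fun (p : (ℕ → ℝ) × (ℕ → ℝ)) (j : ℕ) => (p.1 j, p.2 j)) ∘
      fun p : (ℕ → ℝ) × (ℕ → ℝ) => (u p.1, fun j => p.1 j * p.2 j)) ∘
        fun ω => (fun j => gridSign X τ j ω, fun j => priceIncr P τ j ω) := rfl
  have hcomp := hzm.comp hskew.measurable
  refine ⟨hdr ▸ hcomp.comp_aemeasurable hpair, ?_⟩
  rw [hdr, ← AEMeasurable.map_map_of_aemeasurable hcomp.aemeasurable hpair, hjoint,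
    ← Measure.map_map hzm hskew.measurable, hskew.map_eq, hzip]
  rfl

end Driver

/-! ### Moments up to order four of Gaussian and mixed sums. -/

section Moments

variable {Ω : Type*} [MeasurableSpace Ω] {μ : Measure Ω}

/-- All moments of `X` are finite. -/
def HasAllMoments (X : Ω → ℝ) (μ : Measure Ω) : Prop :=
  ∀ q : ENNReal, q ≠ ⊤ → MemLp X q μ

namespace HasAllMoments

variable {X Z : Ω → ℝ}

lemma memLp_two (hX : HasAllMoments X μ) : MemLp X 2 μ := hX 2 (by simp)

lemma integrable (hX : HasAllMoments X μ) : Integrable X μ :=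
  memLp_one_iff_integrable.1 (hX 1 (by simp))

lemma aemeasurable (hX : HasAllMoments X μ) : AEMeasurable X μ :=
  hX.integrable.aestronglyMeasurable.aemeasurable

lemma add (hX : HasAllMoments X μ) (hZ : HasAllMoments Z μ) :
    HasAllMoments (fun ω => X ω + Z ω) μ := fun q hq => (hX q hq).add (hZ q hq)

lemma sub (hX : HasAllMoments X μ) (hZ : HasAllMoments Z μ) :
    HasAllMoments (fun ω => X ω - Z ω) μ := fun q hq => (hX q hq).sub (hZ q hq)

lemma const_mul (hX : HasAllMoments X μ) (c : ℝ) : HasAllMoments (fun ω => c * X ω) μ :=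
  fun q hq => (hX q hq).const_mul c

/-- Hölder's inequality with exponents `2q`, `2q`. A single `L^q` is not closed under products;
asking for all finite exponents makes integrability of every monomial automatic. -/
lemma mul (hX : HasAllMoments X μ) (hZ : HasAllMoments Z μ) :
    HasAllMoments (fun ω => X ω * Z ω) μ := fun q hq => by
  have : ENNReal.HolderTriple (2 * q) (2 * q) q := ⟨by
    rw [ENNReal.mul_inv (by simp) (by simp), ← add_mul, ENNReal.inv_two_add_inv_two, one_mul]⟩
  exact (hZ (2 * q) (ENNReal.mul_ne_top (by simp) hq)).mul
    (hX (2 * q) (ENNReal.mul_ne_top (by simp) hq))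

lemma pow [IsFiniteMeasure μ] (hX : HasAllMoments X μ) (n : ℕ) :
    HasAllMoments (fun ω => X ω ^ n) μ := by
  induction n with
  | zero => exact fun q _ => by simpa using memLp_const (1 : ℝ)
  | succ n ih => simpa only [pow_succ] using ih.mul hX

lemma of_hasLaw_gaussianReal {v : ℝ≥0} (h : HasLaw X (gaussianReal 0 v) μ) :
    HasAllMoments X μ := fun q hq => by
  have := memLp_id_gaussianReal' (μ := 0) (v := v) q hq
  rw [← h.map_eq, memLp_map_measure_iff (by fun_prop) h.aemeasurable] at this
  exact this

end HasAllMoments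

section Gaussian

variable [IsProbabilityMeasure μ]

omit [IsProbabilityMeasure μ] in
lemma integral_of_hasLaw_gaussianReal {X : Ω → ℝ} {v : ℝ≥0} (h : HasLaw X (gaussianReal 0 v) μ) :
    ∫ ω, X ω ∂μ = 0 := by
  rw [h.integral_eq, integral_id_gaussianReal]

omit [IsProbabilityMeasure μ] in
lemma integral_sq_of_hasLaw_gaussianReal {X : Ω → ℝ} {v : ℝ≥0}
    (h : HasLaw X (gaussianReal 0 v) μ) : ∫ ω, X ω ^ 2 ∂μ = v := by
  rw [← variance_of_integral_eq_zero h.aemeasurable (integral_of_hasLaw_gaussianReal h),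
    h.variance_eq, variance_id_gaussianReal]

/-- If `x`, `y` are independent copies, `x + y` has the law of `√2 x`. The fourth moment of the sum
is thus `4 m` by scaling and `2 m + 6 v²` by expansion, which forces `m = 3 v²`. -/
lemma integral_pow_four_gaussianReal (v : ℝ≥0) :
    ∫ x, x ^ 4 ∂(gaussianReal 0 v) = 3 * (v : ℝ) ^ 2 := by
  set γ := gaussianReal 0 v
  have h1 : HasLaw (fun p : ℝ × ℝ => p.1) γ (γ.prod γ) := measurePreserving_fst.hasLaw
  have h2 : HasLaw (fun p : ℝ × ℝ => p.2) γ (γ.prod γ) := measurePreserving_snd.hasLaw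
  have hind : IndepFun (fun p : ℝ × ℝ => p.1) (fun p : ℝ × ℝ => p.2) (γ.prod γ) :=
    indepFun_prod (X := fun x : ℝ => x) (Y := fun x : ℝ => x) measurable_id measurable_id
  have hsum : HasLaw (fun p : ℝ × ℝ => p.1 + p.2) (gaussianReal 0 (v + v)) (γ.prod γ) := by
    have := gaussianReal_add_gaussianReal_of_indepFun hind h1.map_eq h2.map_eq
    rw [add_zero] at this
    exact ⟨by fun_prop, this⟩
  have hsc : HasLaw (fun x : ℝ => √2 * x) (gaussianReal 0 (v + v)) γ := by
    have := gaussianReal_const_mul (HasLaw.id (μ := γ)) (√2)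
    rw [mul_zero] at this
    have h2 : NNReal.mk (√2 ^ 2) (sq_nonneg _) * v = v + v := by
      ext
      push_cast
      rw [Real.sq_sqrt (by norm_num), two_mul]
    rwa [h2] at this
  have e1 : ∫ p : ℝ × ℝ, (p.1 + p.2) ^ 4 ∂(γ.prod γ) = 4 * ∫ x, x ^ 4 ∂γ := by
    have a1 := hsum.integral_comp (f := fun x : ℝ => x ^ 4) (by fun_prop)
    have a2 := hsc.integral_comp (f := fun x : ℝ => x ^ 4) (by fun_prop)
    simp only [Function.comp_def] at a1 a2
    rw [a1, ← a2, ← integral_const_mul]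
    congr 1 with x
    rw [mul_pow, show (√2 : ℝ) ^ 4 = (√2 ^ 2) ^ 2 by ring, Real.sq_sqrt (by norm_num)]
    norm_num
  have m1 := HasAllMoments.of_hasLaw_gaussianReal h1
  have m2 := HasAllMoments.of_hasLaw_gaussianReal h2
  have hmom : ∀ i j : ℕ, Integrable (fun p : ℝ × ℝ => p.1 ^ i * p.2 ^ j) (γ.prod γ) := fun i j =>
    ((m1.pow i).mul (m2.pow j)).integrable
  have hval : ∀ i j : ℕ, ∫ p : ℝ × ℝ, p.1 ^ i * p.2 ^ j ∂(γ.prod γ) =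
      (∫ x, x ^ i ∂γ) * ∫ x, x ^ j ∂γ := fun i j => integral_prod_mul _ _
  have g1 : ∫ x, x ∂γ = 0 := integral_id_gaussianReal
  have g2 : ∫ x, x ^ 2 ∂γ = v := integral_sq_of_hasLaw_gaussianReal HasLaw.id
  have e2 : ∫ p : ℝ × ℝ, (p.1 + p.2) ^ 4 ∂(γ.prod γ) = 2 * (∫ x, x ^ 4 ∂γ) + 6 * (v : ℝ) ^ 2 := by
    have : ∀ p : ℝ × ℝ, (p.1 + p.2) ^ 4 = p.1 ^ 4 * p.2 ^ 0 + (4 * (p.1 ^ 3 * p.2 ^ 1) +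
        (6 * (p.1 ^ 2 * p.2 ^ 2) + (4 * (p.1 ^ 1 * p.2 ^ 3) + p.1 ^ 0 * p.2 ^ 4))) := fun p => by ring
    simp_rw [this]
    rw [integral_add (hmom _ _), integral_add ((hmom _ _).const_mul _),
      integral_add ((hmom _ _).const_mul _), integral_add ((hmom _ _).const_mul _) (hmom _ _)]
    · simp only [integral_const_mul, hval]
      simp only [pow_one, g1, g2, pow_zero, integral_const, probReal_univ,
        smul_eq_mul]
      ring
    · exact ((hmom _ _).const_mul _).fun_add (hmom _ _)
    · exact ((hmom _ _).const_mul _).fun_add (((hmom _ _).const_mul _).fun_add (hmom _ _))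
    · exact ((hmom _ _).const_mul _).fun_add
        (((hmom _ _).const_mul _).fun_add (((hmom _ _).const_mul _).fun_add (hmom _ _)))
  linarith

/-- Mixed fourth moment of two overlapping sums of independent centred Gaussian variables. -/
lemma integral_sq_mul_sq_gaussian {A : ℕ → Ω → ℝ} (hA : iIndepFun A μ) {v : ℕ → ℝ≥0}
    (hv : ∀ i, HasLaw (A i) (gaussianReal 0 (v i)) μ) :
    ∫ ω, (A 0 ω + A 1 ω) ^ 2 * (A 1 ω + A 2 ω) ^ 2 ∂μ =
      ((v 0 : ℝ) + v 1) * (v 1 + v 2) + 2 * (v 1 : ℝ) ^ 2 ∧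
    ∫ ω, (A 0 ω + A 1 ω) * (A 1 ω + A 2 ω) ∂μ = v 1 := by
  have hm : ∀ i, HasAllMoments (A i) μ := fun i => .of_hasLaw_gaussianReal (hv i)
  have g1 : ∀ i, ∫ ω, A i ω ∂μ = 0 := fun i => integral_of_hasLaw_gaussianReal (hv i)
  have g2 : ∀ i, ∫ ω, A i ω ^ 2 ∂μ = v i := fun i => integral_sq_of_hasLaw_gaussianReal (hv i)
  have g4 : ∫ ω, A 1 ω ^ 4 ∂μ = 3 * (v 1 : ℝ) ^ 2 := by
    have := (hv 1).integral_comp (f := fun x : ℝ => x ^ 4) (by fun_prop)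
    simp only [Function.comp_def] at this
    rw [this, integral_pow_four_gaussianReal]
  have hint : ∀ i j k : ℕ, Integrable (fun ω => A 0 ω ^ i * A 1 ω ^ j * A 2 ω ^ k) μ :=
    fun i j k => ((((hm 0).pow i).mul ((hm 1).pow j)).mul ((hm 2).pow k)).integrable
  have hval : ∀ i j k : ℕ, ∫ ω, A 0 ω ^ i * A 1 ω ^ j * A 2 ω ^ k ∂μ =
      (∫ ω, A 0 ω ^ i ∂μ) * (∫ ω, A 1 ω ^ j ∂μ) * ∫ ω, A 2 ω ^ k ∂μ := by
    intro i j k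
    have h01 := (hA.indepFun (zero_ne_one' ℕ)).comp (φ := fun x : ℝ => x ^ i)
      (ψ := fun x : ℝ => x ^ j) (by fun_prop) (by fun_prop)
    have h012 := (hA.indepFun_prodMk₀ (fun i => (hm i).aemeasurable) 0 1 2 (by norm_num)
      (by norm_num)).comp (φ := fun p : ℝ × ℝ => p.1 ^ i * p.2 ^ j)
      (ψ := fun x : ℝ => x ^ k) (by fun_prop) (by fun_prop)
    have e1 := h012.integral_fun_mul_eq_mul_integral
      (((hm 0).pow i).mul ((hm 1).pow j)).aemeasurable.aestronglyMeasurable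
      ((hm 2).pow k).aemeasurable.aestronglyMeasurable
    have e2 := h01.integral_fun_mul_eq_mul_integral
      ((hm 0).pow i).aemeasurable.aestronglyMeasurable
      ((hm 1).pow j).aemeasurable.aestronglyMeasurable
    simp only [Function.comp_apply] at e1 e2
    rw [e1, e2]
  constructor
  -- Powers `0` and `1` are kept explicit so that the one factorisation `hval` applies to every
  -- monomial.
  · have : ∀ ω, (A 0 ω + A 1 ω) ^ 2 * (A 1 ω + A 2 ω) ^ 2 =
        A 0 ω ^ 2 * A 1 ω ^ 2 * A 2 ω ^ 0 + (2 * (A 0 ω ^ 2 * A 1 ω ^ 1 * A 2 ω ^ 1) +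
        (A 0 ω ^ 2 * A 1 ω ^ 0 * A 2 ω ^ 2 + (2 * (A 0 ω ^ 1 * A 1 ω ^ 3 * A 2 ω ^ 0) +
        (4 * (A 0 ω ^ 1 * A 1 ω ^ 2 * A 2 ω ^ 1) + (2 * (A 0 ω ^ 1 * A 1 ω ^ 1 * A 2 ω ^ 2) +
        (A 0 ω ^ 0 * A 1 ω ^ 4 * A 2 ω ^ 0 + (2 * (A 0 ω ^ 0 * A 1 ω ^ 3 * A 2 ω ^ 1) +
        A 0 ω ^ 0 * A 1 ω ^ 2 * A 2 ω ^ 2))))))) := fun ω => by ring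
    simp_rw [this]
    have c := fun (a : ℝ) i j k => (hint i j k).const_mul a
    have i8 := (c 2 0 3 1).fun_add (hint 0 2 2)
    have i7 := (hint 0 4 0).fun_add i8
    have i6 := (c 2 1 1 2).fun_add i7
    have i5 := (c 4 1 2 1).fun_add i6
    have i4 := (c 2 1 3 0).fun_add i5
    have i3 := (hint 2 0 2).fun_add i4
    have i2 := (c 2 2 1 1).fun_add i3
    rw [integral_add (hint _ _ _) i2, integral_add (c _ _ _ _) i3, integral_add (hint _ _ _) i4,
      integral_add (c _ _ _ _) i5, integral_add (c _ _ _ _) i6, integral_add (c _ _ _ _) i7,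
      integral_add (hint _ _ _) i8, integral_add (c _ _ _ _) (hint _ _ _)]
    simp only [integral_const_mul, hval]
    simp only [pow_one, g1, g2, g4, pow_zero, integral_const,
      probReal_univ, smul_eq_mul]
    ring
  · have : ∀ ω, (A 0 ω + A 1 ω) * (A 1 ω + A 2 ω) =
        A 0 ω ^ 1 * A 1 ω ^ 1 * A 2 ω ^ 0 + (A 0 ω ^ 1 * A 1 ω ^ 0 * A 2 ω ^ 1 +
        (A 0 ω ^ 0 * A 1 ω ^ 2 * A 2 ω ^ 0 + A 0 ω ^ 0 * A 1 ω ^ 1 * A 2 ω ^ 1)) := fun ω => by ring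
    simp_rw [this]
    have i3 := (hint 0 2 0).fun_add (hint 0 1 1)
    have i2 := (hint 1 0 1).fun_add i3
    rw [integral_add (hint _ _ _) i2, integral_add (hint _ _ _) i3,
      integral_add (hint _ _ _) (hint _ _ _)]
    simp only [hval]
    simp only [pow_one, g1, g2, pow_zero, integral_const, probReal_univ, smul_eq_mul]
    ring

/-- Second and mixed fourth moments of `G + c H` and `G' + c H'` for `(G, G')` independent
of `(H, H')`. -/
lemma integral_sq_mul_sq_add {G G' H H' : Ω → ℝ} (hG : HasAllMoments G μ)
    (hG' : HasAllMoments G' μ) (hH : HasAllMoments H μ) (hH' : HasAllMoments H' μ)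
    (hind : IndepFun (fun ω => (G ω, G' ω)) (fun ω => (H ω, H' ω)) μ)
    (hG0 : ∫ ω, G ω ∂μ = 0) (hG'0 : ∫ ω, G' ω ∂μ = 0) (hH0 : ∫ ω, H ω ∂μ = 0)
    (hH'0 : ∫ ω, H' ω ∂μ = 0) (c : ℝ) :
    ∫ ω, (G ω + c * H ω) ^ 2 * (G' ω + c * H' ω) ^ 2 ∂μ =
      ∫ ω, G ω ^ 2 * G' ω ^ 2 ∂μ
        + c ^ 2 * ((∫ ω, G ω ^ 2 ∂μ) * (∫ ω, H' ω ^ 2 ∂μ) + (∫ ω, G' ω ^ 2 ∂μ) * ∫ ω, H ω ^ 2 ∂μ)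
        + 4 * c ^ 2 * ((∫ ω, G ω * G' ω ∂μ) * ∫ ω, H ω * H' ω ∂μ)
        + c ^ 4 * ∫ ω, H ω ^ 2 * H' ω ^ 2 ∂μ ∧
    ∫ ω, (G ω + c * H ω) ^ 2 ∂μ = ∫ ω, G ω ^ 2 ∂μ + c ^ 2 * ∫ ω, H ω ^ 2 ∂μ := by
  have hint : ∀ i j k l : ℕ,
      Integrable (fun ω => (G ω ^ i * G' ω ^ j) * (H ω ^ k * H' ω ^ l)) μ := fun i j k l =>
    (((hG.pow i).mul (hG'.pow j)).mul ((hH.pow k).mul (hH'.pow l))).integrable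
  have hval : ∀ i j k l : ℕ, ∫ ω, (G ω ^ i * G' ω ^ j) * (H ω ^ k * H' ω ^ l) ∂μ =
      (∫ ω, G ω ^ i * G' ω ^ j ∂μ) * ∫ ω, H ω ^ k * H' ω ^ l ∂μ := fun i j k l => by
    have h := hind.comp (φ := fun p : ℝ × ℝ => p.1 ^ i * p.2 ^ j)
      (ψ := fun p : ℝ × ℝ => p.1 ^ k * p.2 ^ l) (by fun_prop) (by fun_prop)
    exact h.integral_fun_mul_eq_mul_integral
      ((hG.pow i).mul (hG'.pow j)).aemeasurable.aestronglyMeasurable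
      ((hH.pow k).mul (hH'.pow l)).aemeasurable.aestronglyMeasurable
  have cc := fun (a : ℝ) i j k l => (hint i j k l).const_mul a
  constructor
  · have : ∀ ω, (G ω + c * H ω) ^ 2 * (G' ω + c * H' ω) ^ 2 =
        (G ω ^ 2 * G' ω ^ 2) * (H ω ^ 0 * H' ω ^ 0) +
        ((2 * c) * ((G ω ^ 2 * G' ω ^ 1) * (H ω ^ 0 * H' ω ^ 1)) +
        (c ^ 2 * ((G ω ^ 2 * G' ω ^ 0) * (H ω ^ 0 * H' ω ^ 2)) +
        ((2 * c) * ((G ω ^ 1 * G' ω ^ 2) * (H ω ^ 1 * H' ω ^ 0)) +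
        ((4 * c ^ 2) * ((G ω ^ 1 * G' ω ^ 1) * (H ω ^ 1 * H' ω ^ 1)) +
        ((2 * c ^ 3) * ((G ω ^ 1 * G' ω ^ 0) * (H ω ^ 1 * H' ω ^ 2)) +
        (c ^ 2 * ((G ω ^ 0 * G' ω ^ 2) * (H ω ^ 2 * H' ω ^ 0)) +
        ((2 * c ^ 3) * ((G ω ^ 0 * G' ω ^ 1) * (H ω ^ 2 * H' ω ^ 1)) +
        c ^ 4 * ((G ω ^ 0 * G' ω ^ 0) * (H ω ^ 2 * H' ω ^ 2))))))))) := fun ω => by ring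
    simp_rw [this]
    have i8 := (cc (2 * c ^ 3) 0 1 2 1).fun_add (cc (c ^ 4) 0 0 2 2)
    have i7 := (cc (c ^ 2) 0 2 2 0).fun_add i8
    have i6 := (cc (2 * c ^ 3) 1 0 1 2).fun_add i7
    have i5 := (cc (4 * c ^ 2) 1 1 1 1).fun_add i6
    have i4 := (cc (2 * c) 1 2 1 0).fun_add i5
    have i3 := (cc (c ^ 2) 2 0 0 2).fun_add i4
    have i2 := (cc (2 * c) 2 1 0 1).fun_add i3
    rw [integral_add (hint _ _ _ _) i2, integral_add (cc _ _ _ _ _) i3,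
      integral_add (cc _ _ _ _ _) i4, integral_add (cc _ _ _ _ _) i5,
      integral_add (cc _ _ _ _ _) i6, integral_add (cc _ _ _ _ _) i7,
      integral_add (cc _ _ _ _ _) i8, integral_add (cc _ _ _ _ _) (cc _ _ _ _ _)]
    simp only [integral_const_mul, hval]
    simp only [pow_one, hG0, hG'0, hH0, hH'0, pow_zero, one_mul, mul_one,
      integral_const, probReal_univ, smul_eq_mul]
    ring
  · have : ∀ ω, (G ω + c * H ω) ^ 2 =
        (G ω ^ 2 * G' ω ^ 0) * (H ω ^ 0 * H' ω ^ 0) +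
        ((2 * c) * ((G ω ^ 1 * G' ω ^ 0) * (H ω ^ 1 * H' ω ^ 0)) +
        c ^ 2 * ((G ω ^ 0 * G' ω ^ 0) * (H ω ^ 2 * H' ω ^ 0))) := fun ω => by ring
    simp_rw [this]
    rw [integral_add (hint _ _ _ _) ((cc (2 * c) 1 0 1 0).fun_add (cc (c ^ 2) 0 0 2 0)),
      integral_add (cc _ _ _ _ _) (cc _ _ _ _ _)]
    simp only [integral_const_mul, hval]
    simp only [pow_one, hG0, hH0, pow_zero, one_mul, mul_one,
      integral_const, probReal_univ, smul_eq_mul]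
    ring

end Gaussian
end Moments

/-! ### Squared log-price increments as functions of the driving sequence. -/

section SquaredIncrement

/-- The squared log-price increment of lag `L` from time `0` as a function of the driving
sequence. -/
noncomputable def sqIncr (S : ℝ) (L : ℕ) (x : ℕ → ℝ × ℝ) : ℝ :=
  (∑ m ∈ Finset.range L, (∏ l ∈ Finset.range m, (x l).1) * (x m).2
    + S / 2 * (∏ l ∈ Finset.range L, (x l).1 - 1)) ^ 2

lemma measurable_sqIncr (S : ℝ) (L : ℕ) : Measurable (sqIncr S L) := by
  unfold sqIncr
  fun_prop

lemma dependsOn_sqIncr (S : ℝ) (L : ℕ) : DependsOn (sqIncr S L) (Set.Iio L) := by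
  intro x y h
  have h1 : ∀ m ∈ Finset.range L, (∏ l ∈ Finset.range m, (x l).1) * (x m).2 =
      (∏ l ∈ Finset.range m, (y l).1) * (y m).2 := fun m hm => by
    rw [Finset.mem_range] at hm
    rw [h m hm, Finset.prod_congr rfl fun l hl => by
      rw [h l ((Finset.mem_range.1 hl).trans hm)]]
  have h2 : ∏ l ∈ Finset.range L, (x l).1 = ∏ l ∈ Finset.range L, (y l).1 :=
    Finset.prod_congr rfl fun l hl => by rw [h l (Finset.mem_range.1 hl)]
  unfold sqIncr
  rw [Finset.sum_congr rfl h1, h2]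

/-- The distance between the starting points of consecutive increments of lag `L`. -/
def Scheme.step : Scheme → ℕ → ℕ
  | .overlapping, _ => 1
  | .nonOverlapping, L => L
  | .disjoint, L => L + 1

lemma Scheme.start_eq (v : Scheme) (L i : ℕ) : v.start L i = i * v.step L := by
  cases v <;> simp [Scheme.start, Scheme.step, mul_add, add_comm]

lemma Scheme.zeta_eq (v : Scheme) (L : ℕ) : v.zeta L = v.step L := by
  cases v <;> simp [Scheme.zeta, Scheme.step]

lemma Scheme.step_pos (v : Scheme) {L : ℕ} (hL : 1 ≤ L) : 0 < v.step L := by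
  cases v <;> simp [Scheme.step]; omega

lemma Scheme.count_pos (v : Scheme) {n L : ℕ} (hL : 1 ≤ L) (hn : L < n) : 0 < v.count n L := by
  cases v <;> simp only [Scheme.count]
  · omega
  · exact Nat.div_pos (by omega) hL
  · exact Nat.div_pos hn (by omega)

/-- The number of increments is `n / step` up to a bounded error. This is all that the limit
theorems need to know about a sampling scheme. -/
lemma Scheme.abs_sub_step_mul_count_le (v : Scheme) {L : ℕ} (hL : 1 ≤ L) (n : ℕ) :
    |(n : ℝ) - v.step L * v.count n L| ≤ L + 1 := by
  have key : v.step L * v.count n L ≤ n ∧ n ≤ v.step L * v.count n L + (L + 1) := by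
    cases v <;> simp only [Scheme.step, Scheme.count]
    · omega
    · have h1 := Nat.div_add_mod (n - 1) L
      have h2 := Nat.mod_lt (n - 1) hL
      omega
    · have h1 := Nat.div_add_mod n (L + 1)
      have h2 := Nat.mod_lt n (show 0 < L + 1 by omega)
      omega
  obtain ⟨h1, h2⟩ := key
  have h1' : (v.step L : ℝ) * v.count n L ≤ n := by exact_mod_cast h1
  have h2' : (n : ℝ) ≤ v.step L * v.count n L + (L + 1) := by exact_mod_cast h2
  rw [abs_of_nonneg] <;> linarith

variable {Ω : Type*} {P X : ℝ≥0 → Ω → ℝ} {S : ℝ} {τ : ℝ≥0}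

lemma logPrice_sub (s t : ℝ≥0) (ω : Ω) : logPrice S P X t ω - logPrice S P X s ω =
    (P t ω - P s ω) + S / 2 * (tradeSign X t ω - tradeSign X s ω) := by
  simp only [logPrice, noise_eq]
  ring

/-- Products of sign changes telescope to `Y_a Y_{a+m}`, which turns each twisted increment into
`Y_a` times the efficient one. The bracket in `sqIncr` is then `Y_a` times the log-price increment,
and the sign disappears on squaring. -/
lemma sq_logPrice_sub_eq_sqIncr {ω : Ω} (h : ∀ j, gridSign X τ j ω ^ 2 = 1) (a L : ℕ) :
    (logPrice S P X (((a + L : ℕ) : ℝ≥0) * τ) ω - logPrice S P X ((a : ℝ≥0) * τ) ω) ^ 2 =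
      sqIncr S L (shift a (driver P X τ ω)) := by
  have hprod : ∀ m, ∏ l ∈ Finset.range m, (driver P X τ ω (a + l)).1 =
      gridSign X τ a ω * gridSign X τ (a + m) ω := by
    intro m
    induction m with
    | zero => simpa [sq] using (h a).symm
    | succ m ih =>
      rw [Finset.prod_range_succ, ih]
      simp only [driver]
      linear_combination (gridSign X τ a ω * gridSign X τ (a + (m + 1)) ω) * h (a + m)
  have hsum : ∀ m, ∑ l ∈ Finset.range m, (∏ l ∈ Finset.range l, (driver P X τ ω (a + l)).1) *
      (driver P X τ ω (a + l)).2 =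
        gridSign X τ a ω * (P (((a + m : ℕ) : ℝ≥0) * τ) ω - P ((a : ℝ≥0) * τ) ω) := by
    intro m
    induction m with
    | zero => simp
    | succ m ih =>
      rw [Finset.sum_range_succ, ih, hprod]
      simp only [driver, priceIncr, add_assoc]
      linear_combination (gridSign X τ a ω * (P (((a + (m + 1) : ℕ) : ℝ≥0) * τ) ω
        - P (((a + m : ℕ) : ℝ≥0) * τ) ω)) * h (a + m)
  simp only [sqIncr, shift_apply]
  rw [hprod, hsum, logPrice_sub]
  have h1 := h a
  simp only [gridSign] at h1 ⊢
  set y := tradeSign X ((a : ℝ≥0) * τ) ω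
  set u := tradeSign X (((a + L : ℕ) : ℝ≥0) * τ) ω
  set d := P (((a + L : ℕ) : ℝ≥0) * τ) ω - P ((a : ℝ≥0) * τ) ω
  rw [show y * d + S / 2 * (y * u - 1) = y * (d + S / 2 * (u - y)) by
    linear_combination (S / 2) * h1, mul_pow, h1, one_mul]

end SquaredIncrement

/-! ### Means and autocovariances of the squared increments. -/

section IncrementMoments

variable {Ω : Type*} [MeasurableSpace Ω] {μ : Measure Ω} [IsProbabilityMeasure μ]
  {P X : ℝ≥0 → Ω → ℝ} {σ S lam : ℝ} {τ : ℝ≥0}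

omit [IsProbabilityMeasure μ] in
lemma IsTradeDirection.ae_gridSign_sq (hX : IsTradeDirection X S lam μ) (j : ℕ) :
    ∀ᵐ ω ∂μ, gridSign X τ j ω ^ 2 = 1 := hX.ae_tradeSign_sq _

lemma IsTradeDirection.hasAllMoments_gridSign (hX : IsTradeDirection X S lam μ) (j : ℕ) :
    HasAllMoments (gridSign X τ j) μ := fun q _ => hX.memLp_tradeSign _ q

lemma IsTradeDirection.integral_gridSign_mul (hX : IsTradeDirection X S lam μ) (hS : 0 < S)
    {i j : ℕ} (hij : i ≤ j) :
    ∫ ω, gridSign X τ i ω * gridSign X τ j ω ∂μ = Real.exp (-τ / lam) ^ (j - i) := by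
  have hij' : (i : ℝ) ≤ j := by exact_mod_cast hij
  simp only [gridSign]
  rw [hX.integral_tradeSign_mul hS, ← Real.exp_nat_mul]
  congr 1
  push_cast [Nat.cast_sub hij]
  rw [← sub_mul, abs_of_nonneg (mul_nonneg (sub_nonneg.2 hij') (NNReal.coe_nonneg τ))]
  ring

lemma IsTradeDirection.integral_gridSign_mul_mul (hX : IsTradeDirection X S lam μ) (hS : 0 < S)
    {a b c d : ℕ} (hab : a ≤ b) (hbc : b ≤ c) (hcd : c ≤ d) :
    ∫ ω, (gridSign X τ a ω * gridSign X τ b ω) * (gridSign X τ c ω * gridSign X τ d ω) ∂μ =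
      Real.exp (-τ / lam) ^ (b - a) * Real.exp (-τ / lam) ^ (d - c) := by
  simp only [gridSign]
  rw [hX.integral_tradeSign_mul_mul hS (monotone_grid τ hab) (monotone_grid τ hbc)
    (monotone_grid τ hcd), ← Real.exp_nat_mul, ← Real.exp_nat_mul]
  push_cast [Nat.cast_sub hab, Nat.cast_sub hcd]
  congr 2 <;> ring

lemma IsTradeDirection.integral_gridSign_sub (hX : IsTradeDirection X S lam μ) (i j : ℕ) :
    ∫ ω, (gridSign X τ j ω - gridSign X τ i ω) ∂μ = 0 := by
  rw [integral_sub (hX.hasAllMoments_gridSign j).integrable (hX.hasAllMoments_gridSign i).integrable]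
  simp only [gridSign]
  rw [hX.integral_tradeSign, hX.integral_tradeSign, sub_zero]

lemma IsTradeDirection.integral_gridSign_sub_sq (hX : IsTradeDirection X S lam μ) (hS : 0 < S)
    {i j : ℕ} (hij : i ≤ j) : ∫ ω, (gridSign X τ j ω - gridSign X τ i ω) ^ 2 ∂μ =
      2 - 2 * Real.exp (-τ / lam) ^ (j - i) := by
  have h : (fun ω => (gridSign X τ j ω - gridSign X τ i ω) ^ 2) =ᵐ[μ]
      fun ω => 2 - 2 * (gridSign X τ i ω * gridSign X τ j ω) := by
    filter_upwards [hX.ae_gridSign_sq (τ := τ) i, hX.ae_gridSign_sq (τ := τ) j] with ω h1 h2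
    linear_combination h1 + h2
  have hm := ((hX.hasAllMoments_gridSign (τ := τ) i).mul
    (hX.hasAllMoments_gridSign (τ := τ) j)).integrable
  rw [integral_congr_ae h, integral_sub (integrable_const _) (hm.const_mul 2), integral_const_mul,
    hX.integral_gridSign_mul hS hij]
  simp

lemma IsTradeDirection.integral_gridSign_sub_mul (hX : IsTradeDirection X S lam μ) (hS : 0 < S)
    {k L : ℕ} (hkL : k ≤ L) :
    ∫ ω, (gridSign X τ L ω - gridSign X τ 0 ω) * (gridSign X τ (k + L) ω - gridSign X τ k ω) ∂μ =
      2 * Real.exp (-τ / lam) ^ k - Real.exp (-τ / lam) ^ (L - k)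
        - Real.exp (-τ / lam) ^ (L + k) := by
  have hm := fun i j =>
    ((hX.hasAllMoments_gridSign (τ := τ) i).mul (hX.hasAllMoments_gridSign (τ := τ) j)).integrable
  have h : ∀ ω, (gridSign X τ L ω - gridSign X τ 0 ω) *
      (gridSign X τ (k + L) ω - gridSign X τ k ω) =
      (gridSign X τ L ω * gridSign X τ (k + L) ω + gridSign X τ 0 ω * gridSign X τ k ω) -
      (gridSign X τ k ω * gridSign X τ L ω + gridSign X τ 0 ω * gridSign X τ (k + L) ω) :=
    fun ω => by ring
  simp_rw [h]
  rw [integral_sub ((hm _ _).fun_add (hm _ _)) ((hm _ _).fun_add (hm _ _)),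
    integral_add (hm _ _) (hm _ _), integral_add (hm _ _) (hm _ _),
    hX.integral_gridSign_mul hS (by lia), hX.integral_gridSign_mul hS (by lia),
    hX.integral_gridSign_mul hS hkL, hX.integral_gridSign_mul hS (by lia)]
  simp only [Nat.sub_zero, add_comm k L]
  rw [Nat.add_sub_cancel_left]
  ring

/-- Since signs square to one, a squared difference is `2 - 2 Y Y'`. The fourfold product is
regrouped as `(Y_0 Y_k)(Y_L Y_{k+L})`, with times in increasing order because `k ≤ L`; these two
pairs are independent, unlike the original ones. -/
lemma IsTradeDirection.integral_gridSign_sub_sq_mul_sq (hX : IsTradeDirection X S lam μ)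
    (hS : 0 < S) {k L : ℕ} (hkL : k ≤ L) :
    ∫ ω, (gridSign X τ L ω - gridSign X τ 0 ω) ^ 2 *
      (gridSign X τ (k + L) ω - gridSign X τ k ω) ^ 2 ∂μ =
      4 * (1 - 2 * Real.exp (-τ / lam) ^ L + Real.exp (-τ / lam) ^ (2 * k)) := by
  have hs := hX.hasAllMoments_gridSign (τ := τ)
  have h : (fun ω => (gridSign X τ L ω - gridSign X τ 0 ω) ^ 2 *
      (gridSign X τ (k + L) ω - gridSign X τ k ω) ^ 2) =ᵐ[μ]
      fun ω => (4 + 4 * ((gridSign X τ 0 ω * gridSign X τ k ω) *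
          (gridSign X τ L ω * gridSign X τ (k + L) ω))) -
        (4 * (gridSign X τ 0 ω * gridSign X τ L ω)
          + 4 * (gridSign X τ k ω * gridSign X τ (k + L) ω)) := by
    filter_upwards [hX.ae_gridSign_sq (τ := τ) 0, hX.ae_gridSign_sq (τ := τ) k,
      hX.ae_gridSign_sq (τ := τ) L, hX.ae_gridSign_sq (τ := τ) (k + L)] with ω h1 h2 h3 h4
    rw [sub_sq', sub_sq', h1, h2, h3, h4]
    ring
  have i1 := (((hs 0).mul (hs L)).const_mul 4).integrable
  have i2 := (((hs k).mul (hs (k + L))).const_mul 4).integrable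
  have i3 := ((((hs 0).mul (hs k)).mul ((hs L).mul (hs (k + L)))).const_mul 4).integrable
  rw [integral_congr_ae h]
  rw [integral_sub (Integrable.fun_add (integrable_const _) i3) (Integrable.fun_add i1 i2),
    integral_add (integrable_const _) i3, integral_add i1 i2]
  simp only [integral_const_mul]
  rw [hX.integral_gridSign_mul hS (Nat.zero_le L), hX.integral_gridSign_mul hS (by lia),
    hX.integral_gridSign_mul_mul hS (Nat.zero_le k) hkL (by lia)]
  simp only [integral_const, probReal_univ, smul_eq_mul, Nat.sub_zero, Nat.add_sub_cancel_left,
    Nat.add_sub_cancel]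
  ring

omit [IsProbabilityMeasure μ] in
lemma IsBrownianWithVolatility.hasLaw_grid_sub (hP : IsBrownianWithVolatility P σ μ) (hσ : 0 < σ)
    {i j : ℕ} (hij : i ≤ j) :
    HasLaw (fun ω => P ((j : ℝ≥0) * τ) ω - P ((i : ℝ≥0) * τ) ω)
      (gaussianReal 0 (.mk (σ ^ 2) (sq_nonneg _) * (((j - i : ℕ) : ℝ≥0) * τ))) μ := by
  have h := hP.hasLaw_sub hσ (monotone_grid τ hij)
  simp only [← tsub_mul] at h
  rwa [Nat.cast_tsub]

variable (hσ : 0 < σ) (hS : 0 < S) (hP : IsBrownianWithVolatility P σ μ)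
  (hX : IsTradeDirection X S lam μ)
  (hPX : IndepFun (fun ω t => P t ω) (fun ω t => noise S X t ω) μ)

include hS hPX in
omit [IsProbabilityMeasure μ] in
lemma indepFun_priceSub_gridSign (a b c d : ℕ) :
    IndepFun (fun ω => (P ((b : ℝ≥0) * τ) ω - P ((a : ℝ≥0) * τ) ω,
        P ((d : ℝ≥0) * τ) ω - P ((c : ℝ≥0) * τ) ω))
      (fun ω => (gridSign X τ b ω - gridSign X τ a ω, gridSign X τ d ω - gridSign X τ c ω)) μ := by
  have h := hPX.comp
    (φ := fun f : ℝ≥0 → ℝ => (f (b * τ) - f (a * τ), f (d * τ) - f (c * τ)))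
    (ψ := fun η : ℝ≥0 → ℝ => (2 / S * η (b * τ) - 2 / S * η (a * τ),
      2 / S * η (d * τ) - 2 / S * η (c * τ))) (by fun_prop) (by fun_prop)
  have hS' : ∀ t ω, tradeSign X t ω = 2 / S * noise S X t ω := fun t ω => by
    rw [noise_eq]
    field_simp
  simp only [gridSign, hS']
  exact h

omit [MeasurableSpace Ω] in
lemma logPrice_grid_sub (i j : ℕ) (ω : Ω) :
    logPrice S P X ((j : ℝ≥0) * τ) ω - logPrice S P X ((i : ℝ≥0) * τ) ω =
      (P ((j : ℝ≥0) * τ) ω - P ((i : ℝ≥0) * τ) ω)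
        + S / 2 * (gridSign X τ j ω - gridSign X τ i ω) := logPrice_sub _ _ _

/-- The autocovariance at distance `k` of the squared log-price increments of lag `L ≥ k`. -/
noncomputable def sqAutocov (σ S lam τ : ℝ) (L k : ℕ) : ℝ :=
  2 * (σ ^ 2 * τ * (L - k : ℕ)) ^ 2
    + S ^ 2 * (σ ^ 2 * τ * (L - k : ℕ)) * (2 * Real.exp (-τ / lam) ^ k
      - Real.exp (-τ / lam) ^ (L - k) - Real.exp (-τ / lam) ^ (L + k))
    + S ^ 4 / 4 * (Real.exp (-τ / lam) ^ (2 * k) - Real.exp (-τ / lam) ^ (2 * L))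

lemma priceVar_eq (σ S lam τ : ℝ) (L : ℕ) : priceVar σ S lam τ L =
    L * τ * σ ^ 2 + S ^ 2 / 2 * (1 - Real.exp (-τ / lam) ^ L) := by
  rw [priceVar, ← Real.exp_nat_mul]
  ring_nf

include hσ hS hP hX hPX

/-- The points `0 ≤ k ≤ L ≤ k + L` split both efficient increments into independent pieces that
share exactly the middle one, of length `L - k`. The noise differences are independent of all three,
so the mixed moment separates. -/
lemma integral_sq_logPrice_sub_mul {k L : ℕ} (hkL : k ≤ L) :
    ∫ ω, (logPrice S P X ((L : ℝ≥0) * τ) ω - logPrice S P X (((0 : ℕ) : ℝ≥0) * τ) ω) ^ 2 *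
      (logPrice S P X (((k + L : ℕ) : ℝ≥0) * τ) ω - logPrice S P X ((k : ℝ≥0) * τ) ω) ^ 2 ∂μ =
      priceVar σ S lam τ L ^ 2 + sqAutocov σ S lam τ L k ∧
    ∫ ω, (logPrice S P X ((L : ℝ≥0) * τ) ω - logPrice S P X (((0 : ℕ) : ℝ≥0) * τ) ω) ^ 2 ∂μ =
      priceVar σ S lam τ L := by
  let t : ℕ → ℕ
    | 0 => 0
    | 1 => k
    | 2 => L
    | _ => k + L
  have ht : Monotone t := monotone_nat_of_le_succ fun n => by
    match n with
    | 0 => exact Nat.zero_le _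
    | 1 => exact hkL
    | 2 => exact Nat.le_add_left _ _
    | n + 3 => exact le_rfl
  have hA := hP.iIndepFun_sub hσ ((monotone_grid τ).comp ht)
  have hv := fun i => hP.hasLaw_grid_sub (τ := τ) hσ (ht (Nat.le_succ i))
  obtain ⟨e1, e2⟩ := integral_sq_mul_sq_gaussian hA hv
  have hG := fun i j (h : i ≤ j) =>
    HasAllMoments.of_hasLaw_gaussianReal (hP.hasLaw_grid_sub (τ := τ) hσ h)
  have hG0 := fun i j (h : i ≤ j) =>
    integral_of_hasLaw_gaussianReal (hP.hasLaw_grid_sub (τ := τ) hσ h)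
  have hG2 := fun i j (h : i ≤ j) =>
    integral_sq_of_hasLaw_gaussianReal (hP.hasLaw_grid_sub (τ := τ) hσ h)
  have hH := fun i j => (hX.hasAllMoments_gridSign (τ := τ) j).sub
    (hX.hasAllMoments_gridSign (τ := τ) i)
  obtain ⟨f1, f2⟩ := integral_sq_mul_sq_add (hG 0 L (Nat.zero_le _)) (hG k (k + L) (by lia))
    (hH 0 L) (hH k (k + L)) (indepFun_priceSub_gridSign hS hPX 0 L k (k + L))
    (hG0 0 L (Nat.zero_le _)) (hG0 k (k + L) (by lia)) (hX.integral_gridSign_sub _ _) (hX.integral_gridSign_sub _ _) (S / 2)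
  simp only [logPrice_grid_sub]
  rw [f1, f2, hG2 0 L (Nat.zero_le _), hG2 k (k + L) (by lia), hX.integral_gridSign_sub_sq hS (Nat.zero_le _),
    hX.integral_gridSign_sub_sq hS (by lia), hX.integral_gridSign_sub_mul hS hkL,
    hX.integral_gridSign_sub_sq_mul_sq hS hkL, priceVar_eq, sqAutocov]
  have hval : ∀ d : ℕ, ((NNReal.mk (σ ^ 2) (sq_nonneg _) * ((d : ℝ≥0) * τ) : ℝ≥0) : ℝ) =
      σ ^ 2 * (d * τ) := fun d => by
    push_cast
    rfl
  simp only [hval] at e1 e2 ⊢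
  have hkL' : ((L - k : ℕ) : ℝ) = L - k := Nat.cast_sub hkL
  have e1' : ∫ ω, (P ((L : ℝ≥0) * τ) ω - P (((0 : ℕ) : ℝ≥0) * τ) ω) ^ 2 *
      (P (((k + L : ℕ) : ℝ≥0) * τ) ω - P ((k : ℝ≥0) * τ) ω) ^ 2 ∂μ =
      (σ ^ 2 * (L * τ)) ^ 2 + 2 * (σ ^ 2 * ((L - k : ℕ) * τ)) ^ 2 := by
    refine Eq.trans ?_ (e1.trans ?_)
    · congr 1 with ω
      change _ = (P ((k : ℝ≥0) * τ) ω - P (((0 : ℕ) : ℝ≥0) * τ) ω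
        + (P ((L : ℝ≥0) * τ) ω - P ((k : ℝ≥0) * τ) ω)) ^ 2 *
        (P ((L : ℝ≥0) * τ) ω - P ((k : ℝ≥0) * τ) ω
        + (P (((k + L : ℕ) : ℝ≥0) * τ) ω - P ((L : ℝ≥0) * τ) ω)) ^ 2
      ring
    · change (σ ^ 2 * ((k - 0 : ℕ) * τ) + σ ^ 2 * ((L - k : ℕ) * τ)) *
        (σ ^ 2 * ((L - k : ℕ) * τ) + σ ^ 2 * ((k + L - L : ℕ) * τ))
        + 2 * (σ ^ 2 * ((L - k : ℕ) * τ)) ^ 2 = _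
      rw [Nat.sub_zero, Nat.add_sub_cancel, hkL']
      ring
  have e2' : ∫ ω, (P ((L : ℝ≥0) * τ) ω - P (((0 : ℕ) : ℝ≥0) * τ) ω) *
      (P (((k + L : ℕ) : ℝ≥0) * τ) ω - P ((k : ℝ≥0) * τ) ω) ∂μ =
      σ ^ 2 * ((L - k : ℕ) * τ) := by
    refine Eq.trans ?_ e2
    congr 1 with ω
    change _ = (P ((k : ℝ≥0) * τ) ω - P (((0 : ℕ) : ℝ≥0) * τ) ω
      + (P ((L : ℝ≥0) * τ) ω - P ((k : ℝ≥0) * τ) ω)) *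
      (P ((L : ℝ≥0) * τ) ω - P ((k : ℝ≥0) * τ) ω
      + (P (((k + L : ℕ) : ℝ≥0) * τ) ω - P ((L : ℝ≥0) * τ) ω))
    ring
  rw [e1', e2', Nat.add_sub_cancel_left, Nat.sub_zero]
  constructor <;> ring

end IncrementMoments

/-! ### Limiting variance of a single moving average. -/

section VarianceLimit

lemma tendsto_of_abs_sub_mul_le {s : ℕ} (hs : 0 < s) {k : ℕ → ℕ} {C : ℝ}
    (hk : ∀ n : ℕ, |(n : ℝ) - s * k n| ≤ C) :
    Tendsto k atTop atTop ∧ Tendsto (fun n : ℕ => (n : ℝ) / k n) atTop (𝓝 s) := by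
  have hs' : (0 : ℝ) < s := by exact_mod_cast hs
  have h1 : Tendsto (fun n => (k n : ℝ)) atTop atTop := by
    refine tendsto_atTop_mono (f := fun n : ℕ => ((n : ℝ) - C) / s) (fun n => ?_) ?_
    · rw [div_le_iff₀ hs']
      linarith [(abs_le.1 (hk n)).2]
    · exact (tendsto_atTop_add_const_right _ _ tendsto_natCast_atTop_atTop).atTop_div_const hs'
  refine ⟨tendsto_natCast_atTop_iff.1 h1, ?_⟩
  rw [← tendsto_sub_nhds_zero_iff]
  refine squeeze_zero_norm' ?_ (h1.const_div_atTop C)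
  filter_upwards [h1.eventually_gt_atTop 0] with n hn
  rw [Real.norm_eq_abs, div_sub' hn.ne', abs_div, abs_of_pos hn, mul_comm]
  gcongr
  exact hk n

variable {E : Type*} [MeasurableSpace E] (ν : Measure E) [IsProbabilityMeasure ν]

local notation "ν∞" => Measure.infinitePi (fun _ : ℕ => ν)

/-- Limiting variance of a moving average in terms of autocovariances. -/
lemma tendsto_integral_sq_movingAvg {F : (ℕ → E) → ℝ} (hF : Measurable F) (hF2 : MemLp F 2 ν∞)
    {m s : ℕ} (hs : 0 < s) (hm : DependsOn F (Set.Iio m)) {k : ℕ → ℕ} {C : ℝ}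
    (hk : ∀ n : ℕ, |(n : ℝ) - s * k n| ≤ C) {r : ℕ → ℝ}
    (hr : ∀ j, ∫ x, F x * F (shift j x) ∂ν∞ = (∫ x, F x ∂ν∞) ^ 2 + r j) :
    Tendsto (fun n : ℕ => ∫ x, (√(n : ℝ) * (movingAvg F s (k n) x - ∫ y, F y ∂ν∞)) ^ 2 ∂ν∞) atTop
      (𝓝 (s * (r 0 + 2 * ∑ j ∈ Finset.range m, r ((j + 1) * s)))) := by
  obtain ⟨hk1, hk2⟩ := tendsto_of_abs_sub_mul_le hs hk
  set V := ∫ y, F y ∂ν∞ with hV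
  set G : (ℕ → E) → ℝ := fun x => F x - V with hG
  have hGm : Measurable G := by fun_prop
  have hG2 : MemLp G 2 ν∞ := hF2.sub (memLp_const _)
  have hGd : DependsOn G (Set.Iio m) := fun x y h => by simp only [hG, hm h]
  have hFi : ∀ a, Integrable (fun x => F (shift a x)) ν∞ := fun a =>
    (memLp_comp_shift ν hF2 a).integrable (by norm_num)
  have hG0 : ∫ x, G x ∂ν∞ = 0 := by
    rw [integral_sub (by simpa using hFi 0) (integrable_const _)]
    simp [hV]
  have hrG : ∀ j, ∫ x, G x * G (shift j x) ∂ν∞ = r j := fun j => by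
    have h1 : ∀ x, G x * G (shift j x) =
        F x * F (shift j x) - (V * F x + V * (F (shift j x) - V)) := fun x => by
      simp only [hG]; ring
    simp_rw [h1]
    have hF0 : Integrable F ν∞ := by simpa using hFi 0
    have i1 : Integrable (fun x => V * (F (shift j x) - V)) ν∞ :=
      ((hFi j).sub (integrable_const _)).const_mul _
    have i2 : Integrable (fun x => F x * F (shift j x)) ν∞ :=
      hF2.integrable_mul (memLp_comp_shift ν hF2 j)
    rw [integral_sub i2 (Integrable.fun_add (hF0.const_mul V) i1), integral_add (hF0.const_mul V) i1,
      integral_const_mul, integral_const_mul, integral_sub (hFi j) (integrable_const _), hr,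
      integral_comp_shift ν F hF]
    simp only [integral_const, probReal_univ, smul_eq_mul, ← hV]
    ring
  have h0 : ∀ j, m ≤ j → r ((j + 1) * s) = 0 := fun j hj => by
    have hsub : Set.Iio m ⊆ Set.Iio ((j + 1) * s) := Set.Iio_subset_Iio (by nlinarith)
    rw [← hrG]
    exact integral_mul_shift_eq_zero ν hGm hGm (hGd.mono hsub) (hGd.mono hsub) hG0
  have hlim := tendsto_integral_sq_sum_div (μ := ν∞) (X := fun i x => G (shift (i * s) x))
    (r := fun j => r (j * s)) (fun i => memLp_comp_shift ν hG2 _)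
    (fun i j => by rw [integral_shift_mul_shift ν hGm, hrG]) (m := m) h0
  have := hk2.mul (hlim.comp hk1)
  simp only [Function.comp_def, zero_mul] at this
  refine this.congr' ?_
  filter_upwards [hk1.eventually_gt_atTop 0] with n hn
  have hn' : (0 : ℝ) < k n := by exact_mod_cast hn
  rw [← mul_assoc, ← integral_const_mul]
  congr 1 with x
  have hsum : ∑ j ∈ Finset.range (k n), G (shift (j * s) x) =
      k n * (movingAvg F s (k n) x - V) := by
    simp only [hG, movingAvg, Finset.sum_sub_distrib, Finset.sum_const, Finset.card_range,
      nsmul_eq_mul]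
    field_simp
  rw [hsum, mul_pow, mul_pow, Real.sq_sqrt (Nat.cast_nonneg n)]
  field_simp

end VarianceLimit

/-! ### Transfer between the market model and the product space. -/

section Transfer

variable {Ω : Type*} [MeasurableSpace Ω] {μ : Measure Ω} [IsProbabilityMeasure μ]
  {P X : ℝ≥0 → Ω → ℝ} {σ S lam : ℝ} {τ : ℝ≥0}

lemma IsTradeDirection.isProbabilityMeasure_driverLaw (hX : IsTradeDirection X S lam μ) :
    IsProbabilityMeasure (driverLaw μ X σ τ) := by
  have := Measure.isProbabilityMeasure_map
    ((hX.aemeasurable_gridSign (τ := τ) 0).mul (hX.aemeasurable_gridSign (τ := τ) 1))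
  unfold driverLaw
  exact Measure.prod.instIsProbabilityMeasure _ _

omit [IsProbabilityMeasure μ] in
lemma IsTradeDirection.ae_forall_gridSign_sq (hX : IsTradeDirection X S lam μ) :
    ∀ᵐ ω ∂μ, ∀ j, gridSign X τ j ω ^ 2 = 1 := ae_all_iff.2 fun j => hX.ae_gridSign_sq j

omit [IsProbabilityMeasure μ] in
-- One null set serves all `n` and `L`: it is where some grid sign fails to square to one.
lemma IsTradeDirection.empVar_ae_eq (hX : IsTradeDirection X S lam μ) (v : Scheme) :
    ∀ᵐ ω ∂μ, ∀ n L : ℕ, empVar v (logPrice S P X) τ n L ω =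
      movingAvg (sqIncr S L) (v.step L) (v.count n L) (driver P X τ ω) := by
  filter_upwards [hX.ae_forall_gridSign_sq (τ := τ)] with ω h n L
  simp only [empVar, movingAvg, sq_logPrice_sub_eq_sqIncr h, v.start_eq]

variable (hσ : 0 < σ) (hS : 0 < S) (hP : IsBrownianWithVolatility P σ μ)
  (hX : IsTradeDirection X S lam μ)
  (hPX : IndepFun (fun ω t => P t ω) (fun ω t => noise S X t ω) μ)

local notation "ν∞" => Measure.infinitePi (fun _ : ℕ => driverLaw μ X σ τ)

include hσ hS hP hX hPX

lemma memLp_sqIncr (L : ℕ) : MemLp (sqIncr S L) 2 ν∞ := by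
  have hd := hasLaw_driver (τ := τ) hσ hS hP hX hPX
  have h : HasAllMoments (fun ω => (logPrice S P X ((L : ℝ≥0) * τ) ω
      - logPrice S P X (((0 : ℕ) : ℝ≥0) * τ) ω) ^ 2) μ := by
    simp only [logPrice_grid_sub]
    exact ((HasAllMoments.of_hasLaw_gaussianReal (hP.hasLaw_grid_sub hσ (Nat.zero_le L))).add
      (((hX.hasAllMoments_gridSign L).sub (hX.hasAllMoments_gridSign 0)).const_mul _)).pow 2
  rw [← hd.map_eq, memLp_map_measure_iff (measurable_sqIncr S L).aestronglyMeasurable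
    hd.aemeasurable]
  refine h.memLp_two.ae_eq ?_
  filter_upwards [hX.ae_forall_gridSign_sq (τ := τ)] with ω hω
  have := sq_logPrice_sub_eq_sqIncr (P := P) (S := S) hω 0 L
  rwa [zero_add, shift_zero] at this

lemma integral_sqIncr (L : ℕ) : ∫ x, sqIncr S L x ∂ν∞ = priceVar σ S lam τ L := by
  have hd := hasLaw_driver (τ := τ) hσ hS hP hX hPX
  rw [← (integral_sq_logPrice_sub_mul (τ := τ) hσ hS hP hX hPX (Nat.zero_le L)).2,
    ← hd.integral_comp (measurable_sqIncr S L).aestronglyMeasurable]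
  refine integral_congr_ae ?_
  filter_upwards [hX.ae_forall_gridSign_sq (τ := τ)] with ω hω
  have := sq_logPrice_sub_eq_sqIncr (P := P) (S := S) hω 0 L
  rw [zero_add, shift_zero] at this
  exact this.symm

lemma integral_sqIncr_mul_shift {k L : ℕ} (hkL : k ≤ L) :
    ∫ x, sqIncr S L x * sqIncr S L (shift k x) ∂ν∞ =
      priceVar σ S lam τ L ^ 2 + sqAutocov σ S lam τ L k := by
  have hd := hasLaw_driver (τ := τ) hσ hS hP hX hPX
  have hm := measurable_sqIncr S L
  rw [← (integral_sq_logPrice_sub_mul (τ := τ) hσ hS hP hX hPX hkL).1,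
    ← hd.integral_comp (f := fun x => sqIncr S L x * sqIncr S L (shift k x)) (by fun_prop)]
  refine integral_congr_ae ?_
  filter_upwards [hX.ae_forall_gridSign_sq (τ := τ)] with ω hω
  have := sq_logPrice_sub_eq_sqIncr (P := P) (S := S) hω 0 L
  rw [zero_add, shift_zero] at this
  simp only [Function.comp_apply]
  rw [this, sq_logPrice_sub_eq_sqIncr hω k L]

lemma integral_sqIncr_mul_shift_of_le {k L : ℕ} (hkL : L ≤ k) :
    ∫ x, sqIncr S L x * sqIncr S L (shift k x) ∂ν∞ = priceVar σ S lam τ L ^ 2 := by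
  have := hX.isProbabilityMeasure_driverLaw (σ := σ) (τ := τ)
  have hm := measurable_sqIncr S L
  have hsub : Set.Iio L ⊆ Set.Iio k := Set.Iio_subset_Iio hkL
  have hdep := (dependsOn_sqIncr S L).mono hsub
  have h := (indepFun_shift (driverLaw μ X σ τ) hm hm hdep hdep).integral_fun_mul_eq_mul_integral
    hm.aestronglyMeasurable (hm.comp (measurable_shift k)).aestronglyMeasurable
  rw [h, integral_comp_shift _ _ hm, integral_sqIncr hσ hS hP hX hPX, sq]

/-- Limiting variance of the empirical variances, as a sum of autocovariances. -/
lemma tendsto_integral_sq_movingAvg_sqIncr (v : Scheme) {L : ℕ} (hL : 1 ≤ L) :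
    Tendsto (fun n : ℕ => ∫ x, (√(n : ℝ) * (movingAvg (sqIncr S L) (v.step L) (v.count n L) x
        - ∫ y, sqIncr S L y ∂ν∞)) ^ 2 ∂ν∞) atTop
      (𝓝 (v.step L * (sqAutocov σ S lam τ L 0 + 2 * ∑ j ∈ Finset.range L,
        if (j + 1) * v.step L ≤ L then sqAutocov σ S lam τ L ((j + 1) * v.step L) else 0))) := by
  have := hX.isProbabilityMeasure_driverLaw (σ := σ) (τ := τ)
  have h := tendsto_integral_sq_movingAvg (driverLaw μ X σ τ) (measurable_sqIncr S L)
    (memLp_sqIncr hσ hS hP hX hPX L) (v.step_pos hL) (dependsOn_sqIncr S L)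
    (fun n => v.abs_sub_step_mul_count_le hL n)
    -- The formula for `sqAutocov` is the covariance only up to distance `L`; beyond it the windows
    -- are disjoint and the covariance is `0`, while the formula need not vanish.
    (r := fun j => if j ≤ L then sqAutocov σ S lam τ L j else 0) (fun j => by
      rw [integral_sqIncr hσ hS hP hX hPX]
      split_ifs with hj
      · rw [integral_sqIncr_mul_shift hσ hS hP hX hPX hj]
      · rw [integral_sqIncr_mul_shift_of_le hσ hS hP hX hPX (not_le.1 hj).le, add_zero])
  simpa using h

end Transfer

/-! ### Summation of the autocovariances and positivity of the limiting variances. -/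

section ClosedForms

/-- The `-1` removes the term `m = 0`; in this form the identity also holds for `L = 0`. -/
lemma geomSum_eq_sum {x : ℝ} (hx : x ≠ 0) (L : ℕ) :
    geomSum L x = ∑ m ∈ Finset.range L, Real.exp x ^ m - 1 := by
  have h1 : 1 - Real.exp x ≠ 0 := by
    rw [sub_ne_zero, ne_comm, Ne, Real.exp_eq_one_iff]
    exact hx
  rw [geomSum, mul_comm x, Real.exp_nat_mul, geom_sum_eq (by simpa using hx), eq_sub_iff_add_eq,
    div_add_one h1, ← neg_div_neg_eq]
  congr 1 <;> ring

lemma geomSumDeriv_eq_sum {x : ℝ} (hx : x ≠ 0) (L : ℕ) :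
    geomSumDeriv L x = ∑ m ∈ Finset.range L, m * Real.exp x ^ m := by
  have h1 : 1 - Real.exp x ≠ 0 := by
    rw [sub_ne_zero, ne_comm, Ne, Real.exp_eq_one_iff]
    exact hx
  have h2 : Real.exp (x * (L + 1)) = Real.exp x ^ (L + 1) := by
    rw [← Real.exp_nat_mul]
    push_cast
    ring_nf
  rw [geomSumDeriv, mul_comm x L, Real.exp_nat_mul, h2, div_eq_iff (pow_ne_zero 2 h1)]
  induction L with
  | zero => simp
  | succ L ih =>
    have h3 : Real.exp (x * (L + 1)) = Real.exp x ^ (L + 1) := by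
      rw [← Real.exp_nat_mul]
      push_cast
      ring_nf
    rw [Finset.sum_range_succ, add_mul, ← ih h3]
    push_cast
    ring

lemma sum_range_sq_eq (L : ℕ) :
    ∑ m ∈ Finset.range L, (m : ℝ) ^ 2 = (L - 1) * L * (2 * L - 1) / 6 := by
  induction L with
  | zero => simp
  | succ L ih =>
    rw [Finset.sum_range_succ, ih]
    push_cast
    ring

variable {σ S lam τ : ℝ}

/-- Adjacent increments share the sign at their common endpoint, yet their squares are uncorrelated.
This is why the non-overlapping and disjoint schemes have the same `sigmaSq`. -/
lemma sqAutocov_self (L : ℕ) : sqAutocov σ S lam τ L L = 0 := by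
  simp [sqAutocov]

lemma sqAutocov_zero (L : ℕ) : sqAutocov σ S lam τ L 0 = baseVar σ S lam τ L := by
  have h1 : Real.exp (-(2 * L * τ) / lam) = Real.exp (-τ / lam) ^ (2 * L) := by
    rw [← Real.exp_nat_mul]
    push_cast
    ring_nf
  have h2 : Real.exp (-(L * τ) / lam) = Real.exp (-τ / lam) ^ L := by
    rw [← Real.exp_nat_mul]
    ring_nf
  rw [sqAutocov, baseVar, h1, h2]
  simp
  ring

/-- The autocovariances of the squared increments, summed in reverse order. -/
lemma sum_sqAutocov_eq (L : ℕ) :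
    ∑ j ∈ Finset.range L, sqAutocov σ S lam τ L (j + 1) =
      ∑ m ∈ Finset.range L, sqAutocov σ S lam τ L (L - m) := by
  rw [← Finset.sum_range_reflect]
  refine Finset.sum_congr rfl fun j hj => ?_
  rw [Finset.mem_range] at hj
  congr 1
  lia

lemma sqAutocov_sub {L m : ℕ} (hm : m ≤ L) :
    sqAutocov σ S lam τ L (L - m) = 2 * (σ ^ 2 * τ) ^ 2 * (m : ℝ) ^ 2 +
      S ^ 2 * (σ ^ 2 * τ) * (m * (2 * Real.exp (-τ / lam) ^ (L - m) - Real.exp (-τ / lam) ^ m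
        - Real.exp (-τ / lam) ^ (2 * L - m))) +
      S ^ 4 / 4 * (Real.exp (-τ / lam) ^ (2 * (L - m)) - Real.exp (-τ / lam) ^ (2 * L)) := by
  rw [sqAutocov, Nat.sub_sub_self hm, show L + (L - m) = 2 * L - m by lia]
  ring

/-- Indexing by the overlap `m = L - k` and writing `ρ ^ (L - m) = ρ ^ L * q ^ m` with `q = exp (τ /
lam)` reduces everything to the sums of `m²`, `q^(2m)`, `m q^m` and `m ρ^m`. -/
lemma sqAutocov_add_sum_eq_sigmaSq (hlam : 0 < lam) (hτ : 0 < τ) (L : ℕ) :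
    sqAutocov σ S lam τ L 0 + 2 * ∑ j ∈ Finset.range L, sqAutocov σ S lam τ L (j + 1) =
      sigmaSq σ S lam τ .overlapping L := by
  have hx : τ / lam ≠ 0 := (div_pos hτ hlam).ne'
  have h2x : 2 * τ / lam ≠ 0 := by positivity
  have hnx : -τ / lam ≠ 0 := by rw [neg_div]; exact neg_ne_zero.2 hx
  have h1 : Real.exp (-(2 * L * τ) / lam) = Real.exp (-τ / lam) ^ (2 * L) := by
    rw [← Real.exp_nat_mul]
    push_cast
    ring_nf
  have h2 : Real.exp (-(L * τ) / lam) = Real.exp (-τ / lam) ^ L := by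
    rw [← Real.exp_nat_mul]
    ring_nf
  have h3 : Real.exp (2 * τ / lam) = Real.exp (τ / lam) ^ 2 := by
    rw [← Real.exp_nat_mul]
    push_cast
    ring_nf
  have h4 : Real.exp (-τ / lam) * Real.exp (τ / lam) = 1 := by
    rw [← Real.exp_add, ← add_div]
    simp
  rw [sqAutocov_zero, sum_sqAutocov_eq, sigmaSq, geomSum_eq_sum h2x, geomSumDeriv_eq_sum hx,
    geomSumDeriv_eq_sum hnx, h1, h2, h3]
  set ρ := Real.exp (-τ / lam) with hρ
  set q := Real.exp (τ / lam)
  have hq : ∀ m, m ≤ L → ∀ a, L ≤ a → ρ ^ (a - m) = ρ ^ a * q ^ m := fun m hm a ha => by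
    conv_rhs => rw [← Nat.sub_add_cancel (hm.trans ha), pow_add, mul_assoc, ← mul_pow, h4, one_pow,
      mul_one]
  have hterm : ∀ m ∈ Finset.range L, sqAutocov σ S lam τ L (L - m) =
      2 * (σ ^ 2 * τ) ^ 2 * (m : ℝ) ^ 2 +
      S ^ 2 * (σ ^ 2 * τ) * (2 * ρ ^ L * (m * q ^ m) - m * ρ ^ m - ρ ^ (2 * L) * (m * q ^ m)) +
      S ^ 4 / 4 * (ρ ^ (2 * L) * (q ^ 2) ^ m - ρ ^ (2 * L)) := fun m hm => by
    have hm' := (Finset.mem_range.1 hm).le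
    have e1 : ρ ^ (2 * (L - m)) = (ρ ^ L * q ^ m) ^ 2 := by
      rw [mul_comm, pow_mul, hq m hm' L le_rfl]
    rw [sqAutocov_sub hm', ← hρ, hq m hm' L le_rfl, hq m hm' (2 * L) (by lia), e1]
    ring
  rw [Finset.sum_congr rfl hterm]
  simp only [Finset.sum_add_distrib, Finset.sum_sub_distrib, ← Finset.mul_sum, sum_range_sq_eq,
    Finset.sum_const, Finset.card_range, nsmul_eq_mul]
  ring

/-- Averaging the sum with its reflection `m ↦ L - m` gives half the sum of `(L - 2m)(ρ^m -
ρ^(L-m))`, in which both factors change sign together at `m = L / 2`. -/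
lemma sum_mul_sub_pow_nonneg {ρ : ℝ} (h0 : 0 ≤ ρ) (h1 : ρ ≤ 1) (L : ℕ) :
    0 ≤ ∑ m ∈ Finset.range (L + 1), (m : ℝ) * (ρ ^ (L - m) - ρ ^ m) := by
  have h : ∑ m ∈ Finset.range (L + 1), (m : ℝ) * (ρ ^ (L - m) - ρ ^ m) =
      ∑ m ∈ Finset.range (L + 1), ((L : ℝ) - m) * (ρ ^ m - ρ ^ (L - m)) := by
    rw [← Finset.sum_range_reflect]
    refine Finset.sum_congr rfl fun m hm => ?_
    have hm' : m ≤ L := Nat.lt_succ_iff.1 (Finset.mem_range.1 hm)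
    rw [show L + 1 - 1 - m = L - m by lia, Nat.sub_sub_self hm', Nat.cast_sub hm']
  have h2 : 0 ≤ ∑ m ∈ Finset.range (L + 1), ((L : ℝ) - 2 * m) * (ρ ^ m - ρ ^ (L - m)) := by
    refine Finset.sum_nonneg fun m hm => ?_
    rcases le_total (2 * m) L with hc | hc
    · have : (2 * m : ℝ) ≤ L := by exact_mod_cast hc
      exact mul_nonneg (by linarith)
        (sub_nonneg.2 (pow_le_pow_of_le_one h0 h1 (by lia)))
    · have : (L : ℝ) ≤ 2 * m := by exact_mod_cast hc
      exact mul_nonneg_of_nonpos_of_nonpos (by linarith)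
        (sub_nonpos.2 (pow_le_pow_of_le_one h0 h1 (by lia)))
  have h3 : ∑ m ∈ Finset.range (L + 1), ((L : ℝ) - 2 * m) * (ρ ^ m - ρ ^ (L - m)) =
      ∑ m ∈ Finset.range (L + 1), ((L : ℝ) - m) * (ρ ^ m - ρ ^ (L - m)) +
      ∑ m ∈ Finset.range (L + 1), (m : ℝ) * (ρ ^ (L - m) - ρ ^ m) := by
    rw [← Finset.sum_add_distrib]
    exact Finset.sum_congr rfl fun m _ => by ring
  linarith

lemma baseVar_pos (hσ : 0 < σ) (hlam : 0 < lam) (hτ : 0 < τ) {L : ℕ} (hL : 1 ≤ L) :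
    0 < baseVar σ S lam τ L := by
  have hL' : (0 : ℝ) < L := by exact_mod_cast hL
  have h1 : Real.exp (-(2 * L * τ) / lam) ≤ 1 :=
    Real.exp_le_one_iff.2 (div_nonpos_of_nonpos_of_nonneg (by nlinarith [mul_pos hL' hτ]) hlam.le)
  have h2 : Real.exp (-(L * τ) / lam) ≤ 1 :=
    Real.exp_le_one_iff.2 (div_nonpos_of_nonpos_of_nonneg (by nlinarith [mul_pos hL' hτ]) hlam.le)
  have h3 : 0 < 2 * (L : ℝ) ^ 2 * τ ^ 2 * σ ^ 4 := by positivity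
  have h4 : 0 ≤ S ^ 4 / 4 * (1 - Real.exp (-(2 * L * τ) / lam)) :=
    mul_nonneg (by positivity) (sub_nonneg.2 h1)
  have h5 : 0 ≤ 2 * L * τ * σ ^ 2 * S ^ 2 * (1 - Real.exp (-(L * τ) / lam)) :=
    mul_nonneg (by positivity) (sub_nonneg.2 h2)
  rw [baseVar]
  linarith

/-- In the overlapping case single mixed terms may be negative. They are bounded below by the
summands of `sum_mul_sub_pow_nonneg`, whose missing term `m = L` is supplied by the variance at
distance `0`; strict positivity comes from the Brownian part. -/
lemma sigmaSq_pos (hσ : 0 < σ) (hlam : 0 < lam) (hτ : 0 < τ) (v : Scheme)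
    {L : ℕ} (hL : 1 ≤ L) : 0 < sigmaSq σ S lam τ v L := by
  cases v with
  | nonOverlapping => exact baseVar_pos hσ hlam hτ hL
  | disjoint => exact baseVar_pos hσ hlam hτ hL
  | overlapping =>
    rw [← sqAutocov_add_sum_eq_sigmaSq hlam hτ, sum_sqAutocov_eq]
    set ρ := Real.exp (-τ / lam) with hρ
    have h0 : 0 ≤ ρ := (Real.exp_pos _).le
    have h1 : ρ ≤ 1 :=
      Real.exp_le_one_iff.2 (div_nonpos_of_nonpos_of_nonneg (by linarith) hlam.le)
    have hL' : (0 : ℝ) < L := by exact_mod_cast hL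
    have hterm : ∀ m ∈ Finset.range L, S ^ 2 * (σ ^ 2 * τ) * (m * (ρ ^ (L - m) - ρ ^ m)) ≤
        sqAutocov σ S lam τ L (L - m) := fun m hm => by
      have hm' := (Finset.mem_range.1 hm).le
      rw [sqAutocov_sub hm', ← hρ]
      have e1 : ρ ^ (2 * L) ≤ ρ ^ (2 * (L - m)) := pow_le_pow_of_le_one h0 h1 (by lia)
      have e2 : ρ ^ (2 * L - m) ≤ ρ ^ (L - m) := pow_le_pow_of_le_one h0 h1 (by lia)
      have e3 : 0 ≤ S ^ 4 / 4 * (ρ ^ (2 * (L - m)) - ρ ^ (2 * L)) :=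
        mul_nonneg (by positivity) (sub_nonneg.2 e1)
      have e4 : S ^ 2 * (σ ^ 2 * τ) * (m * (ρ ^ (L - m) - ρ ^ m)) ≤
          S ^ 2 * (σ ^ 2 * τ) * (m * (2 * ρ ^ (L - m) - ρ ^ m - ρ ^ (2 * L - m))) := by
        gcongr ?_ * (?_ * ?_)
        linarith
      have e5 : 0 ≤ 2 * (σ ^ 2 * τ) ^ 2 * (m : ℝ) ^ 2 := by positivity
      linarith
    have hsum := Finset.sum_le_sum hterm
    rw [← Finset.mul_sum] at hsum
    have hnn := sum_mul_sub_pow_nonneg h0 h1 L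
    rw [Finset.sum_range_succ, Nat.sub_self, pow_zero] at hnn
    have hb : sqAutocov σ S lam τ L 0 = 2 * (σ ^ 2 * τ * L) ^ 2 +
        S ^ 2 * (σ ^ 2 * τ) * (2 * (L * (1 - ρ ^ L))) + S ^ 4 / 4 * (1 - ρ ^ (2 * L)) := by
      simp only [sqAutocov, ← hρ, Nat.sub_zero, pow_zero, mul_zero, Nat.add_zero]
      ring
    have f1 : 0 < 2 * (σ ^ 2 * τ * L) ^ 2 := by positivity
    have f2 : 0 ≤ S ^ 4 / 4 * (1 - ρ ^ (2 * L)) :=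
      mul_nonneg (by positivity) (sub_nonneg.2 (pow_le_one₀ h0 h1))
    have f3 := mul_nonneg (by positivity : 0 ≤ S ^ 2 * (σ ^ 2 * τ)) hnn
    rw [hb]
    linarith

/-- The sum of autocovariances along multiples of the step of a scheme. -/
lemma sqAutocov_add_sum_step (hlam : 0 < lam) (hτ : 0 < τ) (v : Scheme) (L : ℕ) :
    sqAutocov σ S lam τ L 0 + 2 * ∑ j ∈ Finset.range L,
      (if (j + 1) * v.step L ≤ L then sqAutocov σ S lam τ L ((j + 1) * v.step L) else 0) =
      sigmaSq σ S lam τ v L := by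
  cases v with
  | overlapping =>
    rw [← sqAutocov_add_sum_eq_sigmaSq hlam hτ]
    congr 2
    refine Finset.sum_congr rfl fun j hj => ?_
    rw [Finset.mem_range] at hj
    simp only [Scheme.step, mul_one]
    exact if_pos hj
  | nonOverlapping =>
    rw [Finset.sum_eq_zero, mul_zero, add_zero, sqAutocov_zero]
    · rfl
    · intro j _
      split_ifs with h
      · simp only [Scheme.step] at h ⊢
        -- Only distance `L` itself can satisfy the bound, and there the autocovariance vanishes.
        rw [show (j + 1) * L = L by nlinarith, sqAutocov_self]
      · rfl
  | disjoint =>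
    rw [Finset.sum_eq_zero, mul_zero, add_zero, sqAutocov_zero]
    · rfl
    · intro j _
      refine if_neg ?_
      simp only [Scheme.step, not_le]
      nlinarith

end ClosedForms

/-! ### Limit theorems for the empirical variances in the market model. -/

lemma integral_movingAvg {E : Type*} [MeasurableSpace E] (ν : Measure E) [IsProbabilityMeasure ν]
    {F : (ℕ → E) → ℝ} (hF : Measurable F)
    (hF2 : MemLp F 2 (Measure.infinitePi fun _ : ℕ => ν)) (s : ℕ) {k : ℕ} (hk : 0 < k) :
    ∫ x, movingAvg F s k x ∂(Measure.infinitePi fun _ : ℕ => ν) =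
      ∫ x, F x ∂(Measure.infinitePi fun _ : ℕ => ν) := by
  have hk' : (k : ℝ) ≠ 0 := by exact_mod_cast hk.ne'
  simp only [movingAvg]
  rw [integral_const_mul, integral_finsetSum _ fun j _ =>
    (memLp_comp_shift ν hF2 (j * s)).integrable (by norm_num)]
  simp only [integral_comp_shift ν F hF, Finset.sum_const, Finset.card_range, nsmul_eq_mul]
  field_simp

lemma _root_.MeasureTheory.TendstoInDistribution.comp_hasLaw {Ω Ω' E : Type*} [MeasurableSpace Ω]
    [MeasurableSpace Ω'] [MeasurableSpace E] {μ : Measure Ω} {μ' : Measure Ω'} {ν : Measure E}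
    [IsProbabilityMeasure μ] [IsProbabilityMeasure μ'] [IsProbabilityMeasure ν] {Z : Ω' → ℝ}
    {T : ℕ → E → ℝ} (h : TendstoInDistribution T atTop Z (fun _ => ν) μ') {d : Ω → E}
    (hd : HasLaw d ν μ) :
    TendstoInDistribution (fun n ω => T n (d ω)) atTop Z (fun _ => μ) μ' where
  forall_aemeasurable n :=
    (hd.map_eq.symm ▸ h.forall_aemeasurable n : AEMeasurable (T n) (μ.map d)).comp_aemeasurable
      hd.aemeasurable
  aemeasurable_limit := h.aemeasurable_limit
  tendsto := by
    refine h.tendsto.congr fun n => Subtype.ext ?_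
    change ν.map (T n) = μ.map (T n ∘ d)
    have hT : AEMeasurable (T n) (μ.map d) := hd.map_eq.symm ▸ h.forall_aemeasurable n
    rw [← AEMeasurable.map_map_of_aemeasurable hT hd.aemeasurable, hd.map_eq]

section Asymptotics

variable {Ω : Type*} [MeasurableSpace Ω] {μ : Measure Ω} [IsProbabilityMeasure μ]
  {P X : ℝ≥0 → Ω → ℝ} {σ S lam : ℝ} {τ : ℝ≥0}

/-- The deviation of `V̂_v(n, L)` from `V L`, scaled by `√n`. -/
noncomputable def scaledDev (v : Scheme) (p : ℝ≥0 → Ω → ℝ) (τ : ℝ≥0) (V : ℕ → ℝ) (n L : ℕ)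
    (ω : Ω) : ℝ := √(n : ℝ) * (empVar v p τ n L ω - V L)

variable (hσ : 0 < σ) (hS : 0 < S) (hP : IsBrownianWithVolatility P σ μ)
  (hX : IsTradeDirection X S lam μ)
  (hPX : IndepFun (fun ω t => P t ω) (fun ω t => noise S X t ω) μ)

local notation "ν∞" => Measure.infinitePi (fun _ : ℕ => driverLaw μ X σ τ)

include hσ hS hP hX hPX

lemma memLp_empVar (v : Scheme) (n L : ℕ) : MemLp (empVar v (logPrice S P X) τ n L) 2 μ := by
  have := hX.isProbabilityMeasure_driverLaw (σ := σ) (τ := τ)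
  have hd := hasLaw_driver (τ := τ) hσ hS hP hX hPX
  have h := memLp_movingAvg (driverLaw μ X σ τ) (memLp_sqIncr (τ := τ) hσ hS hP hX hPX L)
    (v.step L) (v.count n L)
  rw [← hd.map_eq] at h
  refine (h.comp_of_map hd.aemeasurable).ae_eq ?_
  filter_upwards [hX.empVar_ae_eq (P := P) (τ := τ) v] with ω hω
  exact (hω n L).symm

lemma memLp_scaledDev (v : Scheme) (V : ℕ → ℝ) (n L : ℕ) :
    MemLp (scaledDev v (logPrice S P X) τ V n L) 2 μ :=
  ((memLp_empVar hσ hS hP hX hPX v n L).sub (memLp_const _)).const_mul _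

lemma integral_empVar (v : Scheme) {n L : ℕ} (hL : 1 ≤ L) (hn : L < n) :
    ∫ ω, empVar v (logPrice S P X) τ n L ω ∂μ = priceVar σ S lam τ L := by
  have := hX.isProbabilityMeasure_driverLaw (σ := σ) (τ := τ)
  have hd := hasLaw_driver (τ := τ) hσ hS hP hX hPX
  have hF2 := memLp_sqIncr (τ := τ) hσ hS hP hX hPX L
  rw [← integral_sqIncr (τ := τ) hσ hS hP hX hPX L,
    ← integral_movingAvg _ (measurable_sqIncr S L) hF2 (v.step L) (v.count_pos hL hn),
    ← hd.integral_comp (memLp_movingAvg _ hF2 _ _).aestronglyMeasurable]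
  refine integral_congr_ae ?_
  filter_upwards [hX.empVar_ae_eq (P := P) (τ := τ) v] with ω hω
  exact hω n L

lemma exists_limit_scaledDev (v : Scheme) {ι : Type*} [Fintype ι] (c : ι → ℝ) (l : ι → ℕ)
    (hl : ∀ i, 1 ≤ l i) : ∃ w : ℝ,
      Tendsto (fun n : ℕ => ∫ ω, (∑ i, c i *
        scaledDev v (logPrice S P X) τ (priceVar σ S lam τ) n (l i) ω) ^ 2 ∂μ) atTop (𝓝 w) ∧
      TendstoInDistribution (fun (n : ℕ) ω => ∑ i, c i *
        scaledDev v (logPrice S P X) τ (priceVar σ S lam τ) n (l i) ω) atTop (id : ℝ → ℝ)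
        (fun _ => μ) (gaussianReal 0 w.toNNReal) := by
  have := hX.isProbabilityMeasure_driverLaw (σ := σ) (τ := τ)
  have hd := hasLaw_driver (τ := τ) hσ hS hP hX hPX
  obtain ⟨w, hw1, hw2⟩ := exists_limit_movingAvg (driverLaw μ X σ τ) c
    (F := fun i => sqIncr S (l i)) (s := fun i => v.step (l i)) (k := fun i n => v.count n (l i))
    (m := l) (C := ∑ i, ((l i : ℝ) + 1))
    (fun i => measurable_sqIncr S (l i)) (fun i => memLp_sqIncr hσ hS hP hX hPX (l i))
    (fun i => v.step_pos (hl i)) (fun i => dependsOn_sqIncr S (l i))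
    (fun i n => (v.abs_sub_step_mul_count_le (hl i) n).trans
      (Finset.single_le_sum (f := fun i => (l i : ℝ) + 1) (fun _ _ => by positivity)
        (Finset.mem_univ i)))
  simp only [integral_sqIncr hσ hS hP hX hPX] at hw1 hw2
  have hae : ∀ᵐ ω ∂μ, ∀ n : ℕ, √(n : ℝ) * ∑ i, c i * (movingAvg (sqIncr S (l i)) (v.step (l i))
      (v.count n (l i)) (driver P X τ ω) - priceVar σ S lam τ (l i)) =
      ∑ i, c i * scaledDev v (logPrice S P X) τ (priceVar σ S lam τ) n (l i) ω := by
    filter_upwards [hX.empVar_ae_eq (P := P) (τ := τ) v] with ω hω n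
    rw [Finset.mul_sum]
    refine Finset.sum_congr rfl fun i _ => ?_
    rw [scaledDev, hω]
    ring
  refine ⟨w, hw1.congr fun n => ?_, (hw2.comp_hasLaw hd).congr (fun n => ?_) (by rfl)⟩
  · have hm : AEStronglyMeasurable (fun x => (√(n : ℝ) * ∑ i, c i * (movingAvg (sqIncr S (l i))
        (v.step (l i)) (v.count n (l i)) x - priceVar σ S lam τ (l i))) ^ 2) ν∞ :=
      ((hw2.forall_aemeasurable n).pow_const 2).aestronglyMeasurable
    rw [← hd.integral_comp hm]
    refine integral_congr_ae ?_
    filter_upwards [hae] with ω hω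
    simp only [Function.comp_apply, hω]
  · filter_upwards [hae] with ω hω
    exact hω n

lemma tendsto_integral_sq_scaledDev (hlam : 0 < lam) (hτ : 0 < τ) (v : Scheme) {L : ℕ}
    (hL : 1 ≤ L) :
    Tendsto (fun n : ℕ => ∫ ω,
      scaledDev v (logPrice S P X) τ (priceVar σ S lam τ) n L ω ^ 2 ∂μ) atTop
      (𝓝 (v.zeta L * sigmaSq σ S lam τ v L)) := by
  have := hX.isProbabilityMeasure_driverLaw (σ := σ) (τ := τ)
  have hd := hasLaw_driver (τ := τ) hσ hS hP hX hPX
  have h := tendsto_integral_sq_movingAvg_sqIncr (τ := τ) hσ hS hP hX hPX v hL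
  rw [sqAutocov_add_sum_step hlam (NNReal.coe_pos.2 hτ), ← v.zeta_eq] at h
  refine h.congr fun n => ?_
  rw [integral_sqIncr hσ hS hP hX hPX]
  have hm : AEStronglyMeasurable (fun x => (√(n : ℝ) * (movingAvg (sqIncr S L)
      (v.step L) (v.count n L) x - priceVar σ S lam τ L)) ^ 2) ν∞ := by
    have := (memLp_movingAvg (driverLaw μ X σ τ) (memLp_sqIncr (τ := τ) hσ hS hP hX hPX L)
      (v.step L) (v.count n L)).aestronglyMeasurable
    fun_prop
  rw [← hd.integral_comp hm]
  refine integral_congr_ae ?_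
  filter_upwards [hX.empVar_ae_eq (P := P) (τ := τ) v] with ω hω
  simp only [Function.comp_apply, scaledDev, hω]

/-- The scaled covariances of the empirical variances converge. -/
lemma exists_limit_integral_scaledDev_mul (v : Scheme) {L L' : ℕ} (hL : 1 ≤ L) (hL' : 1 ≤ L') :
    ∃ g : ℝ, Tendsto (fun n : ℕ => ∫ ω,
      scaledDev v (logPrice S P X) τ (priceVar σ S lam τ) n L ω *
        scaledDev v (logPrice S P X) τ (priceVar σ S lam τ) n L' ω ∂μ) atTop (𝓝 g) := by
  obtain ⟨w, hw, -⟩ := exists_limit_scaledDev (τ := τ) hσ hS hP hX hPX v ![1, 1] ![L, L']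
    (by simp [Fin.forall_fin_two, hL, hL'])
  obtain ⟨w', hw', -⟩ := exists_limit_scaledDev (τ := τ) hσ hS hP hX hPX v ![1, -1] ![L, L']
    (by simp [Fin.forall_fin_two, hL, hL'])
  -- Polarisation: `w` and `w'` are the limiting second moments of the sum and of the difference.
  refine ⟨4⁻¹ * (w - w'), ((hw.sub hw').const_mul 4⁻¹).congr fun n => ?_⟩
  simp only [Fin.sum_univ_two, Matrix.cons_val_zero, Matrix.cons_val_one, one_mul]
  have h1 := memLp_scaledDev (τ := τ) hσ hS hP hX hPX v (priceVar σ S lam τ) n L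
  have h2 := memLp_scaledDev (τ := τ) hσ hS hP hX hPX v (priceVar σ S lam τ) n L'
  have i1 : Integrable (fun ω => (scaledDev v (logPrice S P X) τ (priceVar σ S lam τ) n L ω +
      scaledDev v (logPrice S P X) τ (priceVar σ S lam τ) n L' ω) ^ 2) μ := (h1.add h2).integrable_sq
  have i2 : Integrable (fun ω => (scaledDev v (logPrice S P X) τ (priceVar σ S lam τ) n L ω +
      -1 * scaledDev v (logPrice S P X) τ (priceVar σ S lam τ) n L' ω) ^ 2) μ :=
    (h1.add (h2.const_mul (-1))).integrable_sq
  rw [← integral_sub i1 i2, ← integral_const_mul]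
  congr 1 with ω
  ring

end Asymptotics

/-! ### Limit correlations and the asymptotic covariances. -/

section LimitCorrelation

variable {Ω : Type*} [MeasurableSpace Ω] {μ : Measure Ω} [IsProbabilityMeasure μ]
  {P X : ℝ≥0 → Ω → ℝ} {σ S lam : ℝ} {τ : ℝ≥0}

lemma Scheme.zeta_pos (v : Scheme) {L : ℕ} (hL : 1 ≤ L) : 0 < v.zeta L := by
  rw [v.zeta_eq]
  exact_mod_cast v.step_pos hL

variable (hσ : 0 < σ) (hS : 0 < S) (hP : IsBrownianWithVolatility P σ μ)
  (hX : IsTradeDirection X S lam μ)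
  (hPX : IndepFun (fun ω t => P t ω) (fun ω t => noise S X t ω) μ)

include hσ hS hP hX hPX

lemma integral_scaledDev_mul (v : Scheme) {n L L' : ℕ} (hL : 1 ≤ L) (hL' : 1 ≤ L') (hn : L < n)
    (hn' : L' < n) :
    ∫ ω, scaledDev v (logPrice S P X) τ (priceVar σ S lam τ) n L ω *
      scaledDev v (logPrice S P X) τ (priceVar σ S lam τ) n L' ω ∂μ =
      n * cov[empVar v (logPrice S P X) τ n L, empVar v (logPrice S P X) τ n L'; μ] := by
  rw [covariance, integral_empVar hσ hS hP hX hPX v hL hn,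
    integral_empVar hσ hS hP hX hPX v hL' hn', ← integral_const_mul]
  congr 1 with ω
  simp only [scaledDev]
  linear_combination (empVar v (logPrice S P X) τ n L ω - priceVar σ S lam τ L) *
    (empVar v (logPrice S P X) τ n L' ω - priceVar σ S lam τ L') *
    Real.mul_self_sqrt (Nat.cast_nonneg n)

variable (hlam : 0 < lam) (hτ : 0 < τ)

include hlam hτ

/-- The correlations of the empirical variances converge, and the scaled covariances converge to
the asymptotic covariances. -/
theorem tendsto_corr_empVar (v : Scheme) {L L' : ℕ} (hL : 1 ≤ L) (hL' : 1 ≤ L') :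
    Tendsto (fun n : ℕ => corr μ (empVar v (logPrice S P X) τ n L)
      (empVar v (logPrice S P X) τ n L')) atTop (𝓝 (limCorr μ v (logPrice S P X) τ L L')) ∧
    Tendsto (fun n : ℕ => ∫ ω,
      scaledDev v (logPrice S P X) τ (priceVar σ S lam τ) n L ω *
        scaledDev v (logPrice S P X) τ (priceVar σ S lam τ) n L' ω ∂μ) atTop
      (𝓝 (asympCov σ S lam τ v L L' (limCorr μ v (logPrice S P X) τ L L'))) := by
  have hτ' : (0 : ℝ) < τ := NNReal.coe_pos.2 hτ
  obtain ⟨g, hg⟩ := exists_limit_integral_scaledDev_mul (τ := τ) hσ hS hP hX hPX v hL hL'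
  have hs := fun {L : ℕ} (hL : 1 ≤ L) => sigmaSq_pos (S := S) hσ hlam hτ' v hL
  have hz := fun {L : ℕ} (hL : 1 ≤ L) => v.zeta_pos hL
  have hsd : ∀ {L : ℕ}, 1 ≤ L → Tendsto (fun n : ℕ => √(∫ ω,
      scaledDev v (logPrice S P X) τ (priceVar σ S lam τ) n L ω *
        scaledDev v (logPrice S P X) τ (priceVar σ S lam τ) n L ω ∂μ)) atTop
      (𝓝 (√(v.zeta L) * √(sigmaSq σ S lam τ v L))) := fun {L} hL => by
    have := (tendsto_integral_sq_scaledDev (τ := τ) hσ hS hP hX hPX hlam hτ v hL).sqrt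
    rw [Real.sqrt_mul (hz hL).le] at this
    simpa only [sq] using this
  have hcorr : Tendsto (fun n : ℕ => corr μ (empVar v (logPrice S P X) τ n L)
      (empVar v (logPrice S P X) τ n L')) atTop
      (𝓝 (g / ((√(v.zeta L) * √(sigmaSq σ S lam τ v L)) *
        (√(v.zeta L') * √(sigmaSq σ S lam τ v L'))))) := by
    have hne : (√(v.zeta L) * √(sigmaSq σ S lam τ v L)) *
        (√(v.zeta L') * √(sigmaSq σ S lam τ v L')) ≠ 0 := by
      have := Real.sqrt_pos.2 (hs hL)
      have := Real.sqrt_pos.2 (hs hL')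
      have := Real.sqrt_pos.2 (hz hL)
      have := Real.sqrt_pos.2 (hz hL')
      positivity
    refine (hg.div ((hsd hL).mul (hsd hL')) hne).congr' ?_
    filter_upwards [eventually_gt_atTop L, eventually_gt_atTop L'] with n hn hn'
    have hn0 : (0 : ℝ) < n := by exact_mod_cast (Nat.zero_le L).trans_lt hn
    have hm := fun L => (memLp_empVar (τ := τ) hσ hS hP hX hPX v n
      L).aestronglyMeasurable.aemeasurable
    simp only [Pi.div_apply]
    rw [integral_scaledDev_mul hσ hS hP hX hPX v hL hL' hn hn',
      integral_scaledDev_mul hσ hS hP hX hPX v hL hL hn hn,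
      integral_scaledDev_mul hσ hS hP hX hPX v hL' hL' hn' hn', covariance_self (hm L),
      covariance_self (hm L'), Real.sqrt_mul hn0.le, Real.sqrt_mul hn0.le, corr,
      mul_mul_mul_comm, Real.mul_self_sqrt hn0.le, mul_div_mul_left _ _ hn0.ne']
  -- `limCorr` is a `limUnder`, meaningful only once convergence is known; here it receives its
  -- value.
  have hlim := hcorr.limUnder_eq
  change limCorr μ v (logPrice S P X) τ L L' = _ at hlim
  rw [hlim]
  refine ⟨hcorr, ?_⟩
  convert hg using 2
  rw [asympCov, Real.sqrt_mul (hz hL).le]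
  have := Real.sqrt_pos.2 (hs hL)
  have := Real.sqrt_pos.2 (hs hL')
  have := Real.sqrt_pos.2 (hz hL)
  have := Real.sqrt_pos.2 (hz hL')
  field_simp

/-- Both sides are limits of the same second moments, so uniqueness of limits suffices. -/
lemma asympCov_self (v : Scheme) {L : ℕ} (hL : 1 ≤ L) :
    asympCov σ S lam τ v L L (limCorr μ v (logPrice S P X) τ L L) =
      v.zeta L * sigmaSq σ S lam τ v L := by
  have h := (tendsto_corr_empVar hσ hS hP hX hPX hlam hτ v hL hL).2
  simp only [← sq] at h
  exact tendsto_nhds_unique h (tendsto_integral_sq_scaledDev hσ hS hP hX hPX hlam hτ v hL)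

lemma asympCov_comm (v : Scheme) {L L' : ℕ} (hL : 1 ≤ L) (hL' : 1 ≤ L') :
    asympCov σ S lam τ v L L' (limCorr μ v (logPrice S P X) τ L L') =
      asympCov σ S lam τ v L' L (limCorr μ v (logPrice S P X) τ L' L) := by
  have h := (tendsto_corr_empVar hσ hS hP hX hPX hlam hτ v hL hL').2
  have h' := (tendsto_corr_empVar hσ hS hP hX hPX hlam hτ v hL' hL).2
  exact tendsto_nhds_unique (h.congr fun n => by
    congr 1 with ω
    exact mul_comm _ _) h'

/-- Joint asymptotic normality of the empirical variances, in Cramér–Wold form. -/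
theorem tendstoInDistribution_sum_scaledDev (v : Scheme) {ι : Type*} [Fintype ι] (c : ι → ℝ)
    (l : ι → ℕ) (hl : ∀ i, 1 ≤ l i) {w : ℝ}
    (hw : w = ∑ i, ∑ j, c i * c j *
      asympCov σ S lam τ v (l i) (l j) (limCorr μ v (logPrice S P X) τ (l i) (l j))) :
    0 ≤ w ∧ TendstoInDistribution (fun (n : ℕ) ω => ∑ i, c i *
        scaledDev v (logPrice S P X) τ (priceVar σ S lam τ) n (l i) ω) atTop (id : ℝ → ℝ)
        (fun _ => μ) (gaussianReal 0 w.toNNReal) := by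
  obtain ⟨w', hw1, hw2⟩ := exists_limit_scaledDev (τ := τ) hσ hS hP hX hPX v c l hl
  -- The central limit theorem supplies some variance `w'`. It equals the quadratic form `w` because
  -- the second moments of the same linear combination converge to both.
  have hm := memLp_scaledDev (τ := τ) hσ hS hP hX hPX v (priceVar σ S lam τ)
  have h : Tendsto (fun n : ℕ => ∫ ω, (∑ i, c i *
        scaledDev v (logPrice S P X) τ (priceVar σ S lam τ) n (l i) ω) ^ 2 ∂μ) atTop (𝓝 w) := by
    rw [hw]
    refine (tendsto_finsetSum _ fun i _ => tendsto_finsetSum _ fun j _ =>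
      (tendsto_corr_empVar hσ hS hP hX hPX hlam hτ v (hl i) (hl j)).2.const_mul
        (c i * c j)).congr fun n => ?_
    have hint : ∀ i j, Integrable (fun ω => c i * c j *
        (scaledDev v (logPrice S P X) τ (priceVar σ S lam τ) n (l i) ω *
        scaledDev v (logPrice S P X) τ (priceVar σ S lam τ) n (l j) ω)) μ := fun i j =>
      ((hm n (l i)).integrable_mul (hm n (l j))).const_mul _
    simp only [← integral_const_mul]
    simp only [← integral_finsetSum _ fun j _ => hint _ j]
    rw [← integral_finsetSum _ fun i _ => integrable_finsetSum _ fun j _ => hint i j]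
    congr 1 with ω
    rw [sq, Finset.sum_mul_sum]
    exact Finset.sum_congr rfl fun i _ => Finset.sum_congr rfl fun j _ => by ring
  rw [tendsto_nhds_unique h hw1]
  exact ⟨ge_of_tendsto' hw1 fun n => integral_nonneg fun ω => sq_nonneg _, hw2⟩

end LimitCorrelation

/-! ### Continuous mapping and the delta method at a constant limit. -/

section DeltaMethod

variable {Ω : Type*} [MeasurableSpace Ω] {μ : Measure Ω}

/-- Convergence in probability to a constant is preserved by functions continuous there. -/
lemma _root_.MeasureTheory.TendstoInMeasure.comp_continuousAt {E F : Type*} [PseudoEMetricSpace E]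
    [PseudoEMetricSpace F] {U : ℕ → Ω → E} {a : E} (hU : TendstoInMeasure μ U atTop (fun _ => a))
    {g : E → F} (hg : ContinuousAt g a) :
    TendstoInMeasure μ (fun n ω => g (U n ω)) atTop (fun _ => g a) := by
  intro ε hε
  obtain ⟨δ, hδ, h⟩ := Metric.nhds_basis_eball.eventually_iff.1
    (hg.eventually (Metric.eball_mem_nhds (g a) hε))
  refine tendsto_of_tendsto_of_tendsto_of_le_of_le tendsto_const_nhds (hU δ hδ)
    (fun _ => zero_le) fun n => measure_mono fun ω hω => ?_
  rw [Set.mem_ofPred_eq] at hω ⊢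
  by_contra hc
  exact absurd hω (not_le.2 (h (Metric.mem_eball.2 (not_le.1 hc))))

variable [IsProbabilityMeasure μ]

/-- If `X n → 0` in probability and `Y n` is bounded in `L²`, then `X n * Y n → 0` in
probability. -/
lemma tendstoInMeasure_mul_of_integral_sq_le {X Y : ℕ → Ω → ℝ}
    (hX : TendstoInMeasure μ X atTop (fun _ => 0)) (hY : ∀ n, Integrable (fun ω => Y n ω ^ 2) μ)
    {K : ℝ} (hK : ∀ n, ∫ ω, Y n ω ^ 2 ∂μ ≤ K) :
    TendstoInMeasure μ (fun n ω => X n ω * Y n ω) atTop (fun _ => 0) := by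
  have hK0 : 0 ≤ K := (integral_nonneg fun ω => sq_nonneg (Y 0 ω)).trans (hK 0)
  rw [tendstoInMeasure_iff_measureReal_norm] at hX ⊢
  intro ε hε
  simp only [sub_zero, Real.norm_eq_abs] at hX ⊢
  rw [Metric.tendsto_atTop]
  intro η hη
  -- With this threshold `K < M * (η / 2)` and `M ≤ M ^ 2`, so Markov's inequality for `Y n ^ 2`
  -- leaves a probability below `η / 2`.
  set M : ℝ := 1 + 2 * K / η with hM
  have hM1 : 1 ≤ M := le_add_of_nonneg_right (by positivity)
  have hM0 : 0 < M := by linarith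
  obtain ⟨N, hN⟩ := Metric.tendsto_atTop.1 (hX (ε / M) (by positivity)) (η / 2) (by positivity)
  refine ⟨N, fun n hn => ?_⟩
  have h1 := hN n hn
  rw [Real.dist_eq, sub_zero, abs_of_nonneg measureReal_nonneg] at h1 ⊢
  have h2 : M ^ 2 * μ.real {ω | M ^ 2 ≤ Y n ω ^ 2} ≤ K :=
    (mul_meas_ge_le_integral_of_nonneg (ae_of_all _ fun ω => sq_nonneg (Y n ω)) (hY n) _).trans
      (hK n)
  have h3 : μ.real {ω | M ^ 2 ≤ Y n ω ^ 2} < η / 2 := by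
    have : M * μ.real {ω | M ^ 2 ≤ Y n ω ^ 2} ≤ K := by
      refine le_trans ?_ h2
      gcongr
      nlinarith
    by_contra! hc
    have h4 : M * (η / 2) ≤ K := le_trans (by gcongr) this
    have h5 : M * (η / 2) = η / 2 + K := by
      rw [hM]
      field_simp
    linarith
  have hsub : {ω | ε ≤ |X n ω * Y n ω|} ⊆
      {ω | ε / M ≤ |X n ω|} ∪ {ω | M ^ 2 ≤ Y n ω ^ 2} := by
    intro ω hω
    by_contra hc
    simp only [Set.mem_union, Set.mem_ofPred_eq, not_or, not_le] at hc hω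
    have h5 : |Y n ω| < M := abs_lt_of_sq_lt_sq hc.2 hM0.le
    rw [abs_mul] at hω
    have h6 := hc.1
    rw [lt_div_iff₀ hM0] at h6
    nlinarith [abs_nonneg (X n ω), abs_nonneg (Y n ω)]
  calc μ.real {ω | ε ≤ |X n ω * Y n ω|} ≤
      μ.real {ω | ε / M ≤ |X n ω|} + μ.real {ω | M ^ 2 ≤ Y n ω ^ 2} :=
        (measureReal_mono hsub).trans (measureReal_union_le _ _)
    _ < η := by linarith

variable {E : Type*} [NormedAddCommGroup E] [InnerProductSpace ℝ E] {U : ℕ → Ω → E} {a : E}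
  {K : ℝ}

omit [InnerProductSpace ℝ E] in
-- The deviation is `1 / √n` times a quantity bounded in `L²`.
lemma tendstoInMeasure_of_integral_norm_sq_le
    (hU : ∀ n : ℕ, Integrable (fun ω => (√(n : ℝ) * ‖U n ω - a‖) ^ 2) μ)
    (hK : ∀ n : ℕ, ∫ ω, (√(n : ℝ) * ‖U n ω - a‖) ^ 2 ∂μ ≤ K) :
    TendstoInMeasure μ U atTop (fun _ => a) := by
  have h0 : TendstoInMeasure μ (fun (n : ℕ) (_ : Ω) => (√(n : ℝ))⁻¹) atTop (fun _ => 0) := by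
    refine tendstoInMeasure_of_tendsto_ae (fun n => aestronglyMeasurable_const)
      (ae_of_all _ fun _ => ?_)
    exact (Real.tendsto_sqrt_atTop.comp tendsto_natCast_atTop_atTop).inv_tendsto_atTop
  have h := tendstoInMeasure_mul_of_integral_sq_le h0 hU hK
  rw [tendstoInMeasure_iff_norm] at h ⊢
  intro ε hε
  refine (h ε hε).congr' ?_
  filter_upwards [eventually_gt_atTop 0] with n hn
  have hn' : √(n : ℝ) ≠ 0 := (Real.sqrt_pos.2 (by exact_mod_cast hn)).ne'
  simp only [sub_zero, inv_mul_cancel_left₀ hn', norm_norm]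

/-- The first-order remainder in the delta method vanishes in probability. -/
lemma tendstoInMeasure_delta_remainder [CompleteSpace E]
    (hU : ∀ n : ℕ, Integrable (fun ω => (√(n : ℝ) * ‖U n ω - a‖) ^ 2) μ)
    (hK : ∀ n : ℕ, ∫ ω, (√(n : ℝ) * ‖U n ω - a‖) ^ 2 ∂μ ≤ K) {g : E → ℝ} {W : E}
    (hg : HasGradientAt g W a) :
    TendstoInMeasure μ (fun (n : ℕ) ω => √(n : ℝ) * (g (U n ω) - g a) -
      √(n : ℝ) * inner ℝ W (U n ω - a)) atTop (fun _ => 0) := by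
  -- The relative remainder, equal to `0` at `a` because the inverse of `0` is `0`; its continuity
  -- there is exactly differentiability of `g`. It tends to `0` in probability and multiplies the
  -- `L²`-bounded `√n ‖U n - a‖`.
  have hr : ContinuousAt (fun u => ‖u - a‖⁻¹ * (g u - g a - inner ℝ W (u - a))) a := by
    have := hasFDerivAt_iff_tendsto.1 hg.hasFDerivAt
    rw [ContinuousAt, sub_self, norm_zero, inv_zero, zero_mul, tendsto_zero_iff_norm_tendsto_zero]
    refine this.congr fun u => ?_
    rw [norm_mul, norm_inv, norm_norm, InnerProductSpace.toDual_apply_apply]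
  have h := tendstoInMeasure_mul_of_integral_sq_le
    (by simpa using (tendstoInMeasure_of_integral_norm_sq_le hU hK).comp_continuousAt hr) hU hK
  refine h.congr_left fun n => ae_of_all _ fun ω => ?_
  by_cases hz : U n ω = a
  · simp [hz]
  · have : ‖U n ω - a‖ ≠ 0 := norm_ne_zero_iff.2 (sub_ne_zero.2 hz)
    field_simp

end DeltaMethod

/-! ### Functions of the vector of empirical variances. -/

section SmoothFunctions

variable {Ω : Type*} [MeasurableSpace Ω] {μ : Measure Ω} [IsProbabilityMeasure μ]
  {P X : ℝ≥0 → Ω → ℝ} {σ S lam : ℝ} {τ : ℝ≥0} {ι : Type*}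

/-- The vector of empirical variances at the lags `l`. -/
noncomputable def empVarVec (v : Scheme) (p : ℝ≥0 → Ω → ℝ) (τ : ℝ≥0) (l : ι → ℕ) (n : ℕ) (ω : Ω) :
    EuclideanSpace ℝ ι := WithLp.toLp 2 fun i => empVar v p τ n (l i) ω

/-- The vector of variances of the log-price increments at the lags `l`. -/
noncomputable def varVec (σ S lam τ : ℝ) (l : ι → ℕ) : EuclideanSpace ℝ ι :=
  WithLp.toLp 2 fun i => priceVar σ S lam τ (l i)

variable [Fintype ι]

omit [MeasurableSpace Ω] in
lemma sq_sqrt_mul_norm_empVarVec_sub (v : Scheme) (p : ℝ≥0 → Ω → ℝ) (l : ι → ℕ) (n : ℕ) (ω : Ω) :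
    (√(n : ℝ) * ‖empVarVec v p τ l n ω - varVec σ S lam τ l‖) ^ 2 =
      ∑ i, scaledDev v p τ (priceVar σ S lam τ) n (l i) ω ^ 2 := by
  rw [mul_pow, EuclideanSpace.norm_sq_eq, Finset.mul_sum]
  refine Finset.sum_congr rfl fun i _ => ?_
  rw [scaledDev, mul_pow, Real.norm_eq_abs, sq_abs]
  rfl

omit [MeasurableSpace Ω] in
lemma sqrt_mul_inner_empVarVec_sub (v : Scheme) (p : ℝ≥0 → Ω → ℝ) (l : ι → ℕ) (n : ℕ) (ω : Ω)
    (W : EuclideanSpace ℝ ι) :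
    √(n : ℝ) * inner ℝ W (empVarVec v p τ l n ω - varVec σ S lam τ l) =
      ∑ i, W i * scaledDev v p τ (priceVar σ S lam τ) n (l i) ω := by
  rw [PiLp.inner_apply, Finset.mul_sum]
  refine Finset.sum_congr rfl fun i _ => ?_
  simp only [scaledDev, empVarVec, varVec, PiLp.sub_apply, RCLike.inner_apply, conj_trivial]
  ring

variable (hσ : 0 < σ) (hS : 0 < S) (hP : IsBrownianWithVolatility P σ μ)
  (hX : IsTradeDirection X S lam μ)
  (hPX : IndepFun (fun ω t => P t ω) (fun ω t => noise S X t ω) μ)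
  (hlam : 0 < lam) (hτ : 0 < τ)

include hσ hS hP hX hPX

lemma aemeasurable_empVarVec (v : Scheme) (l : ι → ℕ) (n : ℕ) :
    AEMeasurable (empVarVec v (logPrice S P X) τ l n) μ :=
  (WithLp.measurable_toLp 2 _).comp_aemeasurable (aemeasurable_pi_iff.2 fun i =>
    (memLp_empVar hσ hS hP hX hPX v n (l i)).aestronglyMeasurable.aemeasurable)

include hlam hτ

lemma exists_integral_norm_empVarVec_sub_le (v : Scheme) (l : ι → ℕ) (hl : ∀ i, 1 ≤ l i) :
    (∀ n : ℕ, Integrable (fun ω => (√(n : ℝ) *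
      ‖empVarVec v (logPrice S P X) τ l n ω - varVec σ S lam τ l‖) ^ 2) μ) ∧
    ∃ K, ∀ n : ℕ, ∫ ω, (√(n : ℝ) *
      ‖empVarVec v (logPrice S P X) τ l n ω - varVec σ S lam τ l‖) ^ 2 ∂μ ≤ K := by
  simp only [sq_sqrt_mul_norm_empVarVec_sub]
  have hint := fun n (i : ι) => (memLp_scaledDev (τ := τ) hσ hS hP hX hPX v
    (priceVar σ S lam τ) n (l i)).integrable_sq
  refine ⟨fun n => integrable_finsetSum _ fun i _ => hint n i, ?_⟩
  obtain ⟨K, hK⟩ := (tendsto_finsetSum Finset.univ fun i _ =>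
    tendsto_integral_sq_scaledDev (τ := τ) hσ hS hP hX hPX hlam hτ v (hl i)).bddAbove_range
  refine ⟨K, fun n => ?_⟩
  rw [integral_finsetSum _ fun i _ => hint n i]
  exact hK ⟨n, rfl⟩

/-- Consistency of continuous functions of the empirical variances. -/
theorem tendstoInMeasure_comp_empVarVec (v : Scheme) (l : ι → ℕ) (hl : ∀ i, 1 ≤ l i)
    {g : EuclideanSpace ℝ ι → ℝ} (hg : ContinuousAt g (varVec σ S lam τ l)) :
    TendstoInMeasure μ (fun n ω => g (empVarVec v (logPrice S P X) τ l n ω)) atTop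
      (fun _ => g (varVec σ S lam τ l)) := by
  obtain ⟨h, K, hK⟩ := exists_integral_norm_empVarVec_sub_le hσ hS hP hX hPX hlam hτ v l hl
  exact (tendstoInMeasure_of_integral_norm_sq_le h hK).comp_continuousAt hg

/-- Asymptotic normality of functions of the empirical variances that are differentiable at the
limit. -/
theorem asymptoticallyNormal_comp_empVarVec (v : Scheme) (l : ι → ℕ) (hl : ∀ i, 1 ≤ l i)
    {g : EuclideanSpace ℝ ι → ℝ} (hgm : Measurable g) {W : EuclideanSpace ℝ ι}
    (hg : HasGradientAt g W (varVec σ S lam τ l)) {w : ℝ}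
    (hw : w = ∑ i, ∑ j, W i * W j *
      asympCov σ S lam τ v (l i) (l j) (limCorr μ v (logPrice S P X) τ (l i) (l j))) :
    AsymptoticallyNormal μ (fun n ω => g (empVarVec v (logPrice S P X) τ l n ω))
      (g (varVec σ S lam τ l)) w := by
  obtain ⟨h, K, hK⟩ := exists_integral_norm_empVarVec_sub_le hσ hS hP hX hPX hlam hτ v l hl
  obtain ⟨hw0, hlim⟩ := tendstoInDistribution_sum_scaledDev hσ hS hP hX hPX hlam hτ v
    (fun i => W i) l hl hw
  refine ⟨hw0, tendstoInDistribution_of_tendstoInMeasure_sub _ _ hlim ?_ fun n => ?_⟩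
  · have := tendstoInMeasure_delta_remainder h hK hg
    simp only [sqrt_mul_inner_empVarVec_sub] at this
    exact this
  · exact ((hgm.comp_aemeasurable (aemeasurable_empVarVec hσ hS hP hX hPX v l n)).sub_const
      _).const_mul _

end SmoothFunctions

/-! ### Nonvanishing denominators and values at the limit. -/

section Denominators

/-- This is the cross-multiplied form of the strict decrease of `(1 - ρ^L) / L`. Passing from `L` to
`L + 1` adds the positive amount `(L + 2) ρ^(L+1) (1 - ρ)²`. -/
lemma one_sub_pow_add_pos {ρ : ℝ} (h0 : 0 < ρ) (h1 : ρ < 1) (L : ℕ) :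
    0 < 1 - ((L : ℝ) + 2) * ρ ^ (L + 1) + (L + 1) * ρ ^ (L + 2) := by
  induction L with
  | zero =>
    have : 0 < (1 - ρ) ^ 2 := pow_pos (sub_pos.2 h1) 2
    push_cast
    linarith
  | succ L ih =>
    have h2 : 0 < ((L : ℝ) + 2) * ρ ^ (L + 1) * (1 - ρ) ^ 2 := by
      have := sub_pos.2 h1
      positivity
    push_cast
    have h3 : 1 - ((L : ℝ) + 1 + 2) * ρ ^ (L + 1 + 1) + (L + 1 + 1) * ρ ^ (L + 1 + 2) =
        (1 - ((L : ℝ) + 2) * ρ ^ (L + 1) + (L + 1) * ρ ^ (L + 2)) +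
        ((L : ℝ) + 2) * ρ ^ (L + 1) * (1 - ρ) ^ 2 := by ring
    rw [h3]
    linarith

lemma strictAnti_one_sub_pow_div {ρ : ℝ} (h0 : 0 < ρ) (h1 : ρ < 1) :
    StrictAnti fun L : ℕ => (1 - ρ ^ (L + 1)) / ((L : ℝ) + 1) := by
  refine strictAnti_nat_of_succ_lt fun L => ?_
  have h := one_sub_pow_add_pos h0 h1 L
  rw [div_lt_div_iff₀ (by positivity) (by positivity)]
  push_cast
  nlinarith [h, pow_succ ρ (L + 1)]

lemma spread_denom_ne_zero {ρ : ℝ} (h0 : 0 < ρ) (h1 : ρ < 1) {L L' : ℕ} (hL : 1 ≤ L)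
    (hL' : 1 ≤ L') (hne : L' ≠ L) : (L' : ℝ) * (1 - ρ ^ L) - L * (1 - ρ ^ L') ≠ 0 := by
  intro h
  obtain ⟨a, rfl⟩ := Nat.exists_eq_add_of_le' hL
  obtain ⟨b, rfl⟩ := Nat.exists_eq_add_of_le' hL'
  refine hne (congrArg (· + 1) ((strictAnti_one_sub_pow_div h0 h1).injective (a₁ := b) (a₂ := a) ?_))
  rw [div_eq_div_iff (by positivity) (by positivity)]
  push_cast at h
  linarith

end Denominators

section DeterministicLimits

variable {σ S lam τ : ℝ}

/-- Doubling the lag doubles the Brownian variance, which cancels and leaves a perfect square of the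
noise. -/
lemma two_mul_priceVar_sub (L : ℕ) :
    2 * priceVar σ S lam τ L - priceVar σ S lam τ (2 * L) =
      S ^ 2 / 2 * (1 - Real.exp (-τ / lam) ^ L) ^ 2 := by
  rw [priceVar_eq, priceVar_eq, mul_comm 2 L, pow_mul]
  push_cast
  ring

lemma two_mul_priceVar_two_mul_sub (L : ℕ) :
    2 * priceVar σ S lam τ (2 * L) - priceVar σ S lam τ (4 * L) =
      S ^ 2 / 2 * (1 - (Real.exp (-τ / lam) ^ L) ^ 2) ^ 2 := by
  rw [show 4 * L = 2 * (2 * L) by ring, two_mul_priceVar_sub, mul_comm 2 L, pow_mul]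

lemma spreadFormula_priceVar (hlam : 0 < lam) (hτ : 0 < τ) {L L' : ℕ} (hL : 1 ≤ L) (hL' : 1 ≤ L')
    (hne : L' ≠ L) : spreadFormula L L' (Real.exp (-τ / lam)) (priceVar σ S lam τ L)
      (priceVar σ S lam τ L') = S ^ 2 := by
  have h1 : Real.exp (-τ / lam) < 1 :=
    Real.exp_lt_one_iff.2 (div_neg_of_neg_of_pos (by linarith) hlam)
  rw [spreadFormula, priceVar_eq, priceVar_eq,
    div_eq_iff (spread_denom_ne_zero (Real.exp_pos _) h1 hL hL' hne)]
  ring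

lemma sqrt_two_mul_priceVar_sub (hS : 0 < S) (hlam : 0 < lam) (hτ : 0 < τ) (L : ℕ) :
    √(2 * priceVar σ S lam τ L - priceVar σ S lam τ (2 * L)) =
      √(S ^ 2 / 2) * (1 - Real.exp (-τ / lam) ^ L) ∧
    √(2 * priceVar σ S lam τ (2 * L) - priceVar σ S lam τ (4 * L)) =
      √(S ^ 2 / 2) * (1 - (Real.exp (-τ / lam) ^ L) ^ 2) := by
  have h1 : Real.exp (-τ / lam) < 1 :=
    Real.exp_lt_one_iff.2 (div_neg_of_neg_of_pos (by linarith) hlam)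
  have h2 : Real.exp (-τ / lam) ^ L ≤ 1 := pow_le_one₀ (Real.exp_pos _).le h1.le
  have h3 : (Real.exp (-τ / lam) ^ L) ^ 2 ≤ 1 := pow_le_one₀ (by positivity) h2
  rw [two_mul_priceVar_sub, two_mul_priceVar_two_mul_sub, Real.sqrt_mul (by positivity),
    Real.sqrt_mul (by positivity), Real.sqrt_sq (by linarith), Real.sqrt_sq (by linarith)]
  exact ⟨rfl, rfl⟩

end DeterministicLimits

/-! ### The estimators as functions of three or five empirical variances. -/

section EstimatorFunctions

/-- The estimator of `ρ ^ L` as a function of the empirical variances at the lags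
`L, 2L, 4L`. -/
noncomputable def rhoPowFun (x y z : ℝ) : ℝ := √|(2 * y - z) / (2 * x - y)| - 1

/-- The closed-form estimator as a function of the empirical variances. -/
noncomputable def closedFun (u : EuclideanSpace ℝ (Fin 3)) : ℝ :=
  2 * (2 * u 0 - u 1) ^ 2 / (2 * √|2 * u 0 - u 1| - √|2 * u 1 - u 2|) ^ 2

/-- The plug-in estimator for `(L', L'') = (2L, L)` as a function of the empirical variances. -/
noncomputable def plugInFun (L : ℕ) (u : EuclideanSpace ℝ (Fin 3)) : ℝ :=
  spreadFormula L (2 * L) (rhoPowFun (u 0) (u 1) (u 2) ^ (1 / (L : ℝ))) (u 0) (u 1)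

lemma measurable_closedFun : Measurable closedFun := by
  unfold closedFun
  fun_prop

lemma measurable_plugInFun (L : ℕ) : Measurable (plugInFun L) := by
  unfold plugInFun spreadFormula rhoPowFun
  fun_prop

lemma closedFun_eq_hFun {u : EuclideanSpace ℝ (Fin 3)} (hx : 0 < 2 * u 0 - u 1)
    (hy : 0 < 2 * u 1 - u 2) : closedFun u = hFun u := by
  rw [closedFun, hFun, abs_of_pos hx, abs_of_pos hy]

/-- With `t` the estimate of `ρ^L`, the denominator `2L(1 - t) - L(1 - t²)` is `L(1 - t)²`, and `1 -
t` is a quotient of the square roots in `hFun`. Positivity of `t` is needed to undo the `L`-th root.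
-/
lemma plugInFun_eq_hFun {L : ℕ} (hL : 1 ≤ L) {u : EuclideanSpace ℝ (Fin 3)}
    (hx : 0 < 2 * u 0 - u 1) (hy : 0 < 2 * u 1 - u 2)
    (hr : 0 < rhoPowFun (u 0) (u 1) (u 2)) : plugInFun L u = hFun u := by
  have hL' : (L : ℝ) ≠ 0 := by exact_mod_cast (Nat.one_le_iff_ne_zero.1 hL)
  set t := rhoPowFun (u 0) (u 1) (u 2) with ht
  have h1 : (t ^ (1 / (L : ℝ))) ^ L = t := by
    rw [one_div, Real.rpow_inv_natCast_pow hr.le (Nat.one_le_iff_ne_zero.1 hL)]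
  have hsx := Real.sqrt_pos.2 hx
  have h2 : 1 - t = (2 * √(2 * u 0 - u 1) - √(2 * u 1 - u 2)) / √(2 * u 0 - u 1) := by
    rw [ht, rhoPowFun, abs_of_pos (div_pos hy hx), Real.sqrt_div hy.le]
    field_simp
    ring
  rw [plugInFun, ← ht, spreadFormula, mul_comm 2 L, pow_mul, h1, hFun]
  push_cast
  rw [show 2 * ((L : ℝ) * 2 * u 0 - L * u 1) = L * (2 * (2 * u 0 - u 1)) by ring,
    show (L : ℝ) * 2 * (1 - t) - L * (1 - t ^ 2) = L * (1 - t) ^ 2 by ring,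
    mul_div_mul_left _ _ hL', h2, div_pow, Real.sq_sqrt hx.le, div_div_eq_mul_div]
  ring

variable {σ S lam τ : ℝ}

/-- The ratio of the two noise terms is `(1 - r²)² / (1 - r)² = (1 + r)²` with `r = ρ^L`. -/
lemma rhoPowFun_priceVar (hS : 0 < S) (hlam : 0 < lam) (hτ : 0 < τ) {L : ℕ} (hL : 1 ≤ L) :
    rhoPowFun (priceVar σ S lam τ L) (priceVar σ S lam τ (2 * L)) (priceVar σ S lam τ (4 * L)) =
      Real.exp (-τ / lam) ^ L := by
  have h1 : Real.exp (-τ / lam) < 1 :=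
    Real.exp_lt_one_iff.2 (div_neg_of_neg_of_pos (by linarith) hlam)
  have h2 : Real.exp (-τ / lam) ^ L < 1 :=
    pow_lt_one₀ (Real.exp_pos _).le h1 (Nat.one_le_iff_ne_zero.1 hL)
  rw [rhoPowFun, two_mul_priceVar_sub, two_mul_priceVar_two_mul_sub]
  set r := Real.exp (-τ / lam) ^ L
  have hr : 0 < r := pow_pos (Real.exp_pos _) L
  have h3 : 1 - r ≠ 0 := (sub_pos.2 h2).ne'
  rw [show S ^ 2 / 2 * (1 - r ^ 2) ^ 2 / (S ^ 2 / 2 * (1 - r) ^ 2) = (1 + r) ^ 2 by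
    field_simp
    ring, abs_of_nonneg (by positivity), Real.sqrt_sq (by positivity)]
  ring

lemma two_mul_priceVar_sub_pos (hS : 0 < S) (hlam : 0 < lam) (hτ : 0 < τ) {L : ℕ} (hL : 1 ≤ L) :
    0 < 2 * priceVar σ S lam τ L - priceVar σ S lam τ (2 * L) := by
  have h1 : Real.exp (-τ / lam) < 1 :=
    Real.exp_lt_one_iff.2 (div_neg_of_neg_of_pos (by linarith) hlam)
  have h2 : Real.exp (-τ / lam) ^ L < 1 :=
    pow_lt_one₀ (Real.exp_pos _).le h1 (Nat.one_le_iff_ne_zero.1 hL)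
  rw [two_mul_priceVar_sub]
  have := sub_pos.2 h2
  positivity

/-- The plug-in estimator as a function of empirical variances is continuous at their limits. -/
lemma continuousAt_spreadFormula_rhoPowFun (hS : 0 < S) (hlam : 0 < lam) (hτ : 0 < τ)
    {L L' L'' : ℕ} (hL : 1 ≤ L) (hL' : 1 ≤ L') (hL'' : 1 ≤ L'') (hne : L' ≠ L) {E : Type*}
    [TopologicalSpace E] {a : E} {f : Fin 5 → E → ℝ} (hf : ∀ i, ContinuousAt (f i) a)
    (h0 : f 0 a = priceVar σ S lam τ L) (h1 : f 1 a = priceVar σ S lam τ L')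
    (h2 : f 2 a = priceVar σ S lam τ L'') (h3 : f 3 a = priceVar σ S lam τ (2 * L''))
    (h4 : f 4 a = priceVar σ S lam τ (4 * L'')) :
    ContinuousAt (fun u => spreadFormula L L'
      (rhoPowFun (f 2 u) (f 3 u) (f 4 u) ^ (1 / (L'' : ℝ))) (f 0 u) (f 1 u)) a ∧
    spreadFormula L L' (rhoPowFun (f 2 a) (f 3 a) (f 4 a) ^ (1 / (L'' : ℝ))) (f 0 a) (f 1 a) =
      S ^ 2 := by
  have hρ0 := Real.exp_pos (-τ / lam)
  have hρ1 : Real.exp (-τ / lam) < 1 :=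
    Real.exp_lt_one_iff.2 (div_neg_of_neg_of_pos (by linarith) hlam)
  have hr : rhoPowFun (f 2 a) (f 3 a) (f 4 a) = Real.exp (-τ / lam) ^ L'' := by
    rw [h2, h3, h4, rhoPowFun_priceVar hS hlam hτ hL'']
  have hroot : rhoPowFun (f 2 a) (f 3 a) (f 4 a) ^ (1 / (L'' : ℝ)) = Real.exp (-τ / lam) := by
    rw [hr, one_div, Real.pow_rpow_inv_natCast hρ0.le (Nat.one_le_iff_ne_zero.1 hL'')]
  have hrc : ContinuousAt (fun u => rhoPowFun (f 2 u) (f 3 u) (f 4 u)) a := by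
    unfold rhoPowFun
    have hden : 2 * f 2 a - f 3 a ≠ 0 := by
      rw [h2, h3]
      exact (two_mul_priceVar_sub_pos hS hlam hτ hL'').ne'
    exact (((((hf 3).const_mul 2).sub (hf 4)).div (((hf 2).const_mul 2).sub (hf 3))
      hden).abs.sqrt).sub continuousAt_const
  have hpc : ContinuousAt (fun u => rhoPowFun (f 2 u) (f 3 u) (f 4 u) ^ (1 / (L'' : ℝ))) a :=
    hrc.rpow_const (Or.inl (by rw [hr]; positivity))
  constructor
  · unfold spreadFormula
    refine ContinuousAt.div ?_ ?_ ?_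
    · exact (((hf 0).const_mul _).sub ((hf 1).const_mul _)).const_mul _
    · exact ((continuousAt_const.sub (hpc.pow L)).const_mul _).sub
        ((continuousAt_const.sub (hpc.pow L')).const_mul _)
    · rw [hroot]
      exact spread_denom_ne_zero hρ0 hρ1 hL hL' hne
  · rw [hroot, h0, h1, spreadFormula_priceVar hlam hτ hL hL' hne]

lemma priceVarVec_apply (L : ℕ) : priceVarVec σ S lam τ L 0 = priceVar σ S lam τ L ∧
    priceVarVec σ S lam τ L 1 = priceVar σ S lam τ (2 * L) ∧
    priceVarVec σ S lam τ L 2 = priceVar σ S lam τ (4 * L) := ⟨rfl, rfl, rfl⟩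

/-- At the limit both radicands are positive and the difference of roots is `√(S²/2) (1 - ρ^L)²`,
which is nonzero, so only smooth operations are involved. -/
lemma hFun_priceVarVec (hS : 0 < S) (hlam : 0 < lam) (hτ : 0 < τ) {L : ℕ} (hL : 1 ≤ L) :
    DifferentiableAt ℝ hFun (priceVarVec σ S lam τ L) ∧ hFun (priceVarVec σ S lam τ L) = S ^ 2 := by
  obtain ⟨h0, h1, h2⟩ := priceVarVec_apply (σ := σ) (S := S) (lam := lam) (τ := τ) L
  obtain ⟨e1, e2⟩ := sqrt_two_mul_priceVar_sub (σ := σ) hS hlam hτ L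
  have hρ1 : Real.exp (-τ / lam) < 1 :=
    Real.exp_lt_one_iff.2 (div_neg_of_neg_of_pos (by linarith) hlam)
  have hr : Real.exp (-τ / lam) ^ L < 1 :=
    pow_lt_one₀ (Real.exp_pos _).le hρ1 (Nat.one_le_iff_ne_zero.1 hL)
  have hx := two_mul_priceVar_sub_pos (σ := σ) hS hlam hτ hL
  have hy := two_mul_priceVar_sub_pos (σ := σ) hS hlam hτ (L := 2 * L) (by lia)
  rw [show 2 * (2 * L) = 4 * L by ring] at hy
  have hden : 2 * √(2 * priceVar σ S lam τ L - priceVar σ S lam τ (2 * L)) -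
      √(2 * priceVar σ S lam τ (2 * L) - priceVar σ S lam τ (4 * L)) =
      √(S ^ 2 / 2) * (1 - Real.exp (-τ / lam) ^ L) ^ 2 := by
    rw [e1, e2]
    ring
  have hc : 0 < √(S ^ 2 / 2) := Real.sqrt_pos.2 (by positivity)
  have hc2 : √(S ^ 2 / 2) ^ 2 = S ^ 2 / 2 := Real.sq_sqrt (by positivity)
  have h1r := sub_pos.2 hr
  constructor
  · have dx : DifferentiableAt ℝ (fun u : EuclideanSpace ℝ (Fin 3) => 2 * u 0 - u 1)
        (priceVarVec σ S lam τ L) := by fun_prop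
    have dy : DifferentiableAt ℝ (fun u : EuclideanSpace ℝ (Fin 3) => 2 * u 1 - u 2)
        (priceVarVec σ S lam τ L) := by fun_prop
    have sx := dx.sqrt (by rw [h0, h1]; exact hx.ne')
    have sy := dy.sqrt (by rw [h1, h2]; exact hy.ne')
    have num := (dx.fun_pow 2).const_mul 2
    have den := ((sx.const_mul 2).fun_sub sy).fun_pow 2
    have hinv := den.fun_inv (by
      rw [h0, h1, h2, hden]
      positivity)
    exact num.fun_mul hinv
  · rw [hFun, h0, h1, h2, hden, two_mul_priceVar_sub, mul_pow, mul_pow (√(S ^ 2 / 2)), hc2]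
    generalize 1 - Real.exp (-τ / lam) ^ L = q at h1r
    field_simp

/-- Near the limit, the estimators coincide with `h`. -/
lemma eventually_eq_hFun (hS : 0 < S) (hlam : 0 < lam) (hτ : 0 < τ) {L : ℕ} (hL : 1 ≤ L) :
    closedFun =ᶠ[𝓝 (priceVarVec σ S lam τ L)] hFun ∧
    plugInFun L =ᶠ[𝓝 (priceVarVec σ S lam τ L)] hFun := by
  obtain ⟨h0, h1, h2⟩ := priceVarVec_apply (σ := σ) (S := S) (lam := lam) (τ := τ) L
  have hx := two_mul_priceVar_sub_pos (σ := σ) hS hlam hτ hL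
  have hy := two_mul_priceVar_sub_pos (σ := σ) hS hlam hτ (L := 2 * L) (by lia)
  rw [show 2 * (2 * L) = 4 * L by ring] at hy
  have hr := rhoPowFun_priceVar (σ := σ) hS hlam hτ hL
  have cx : Continuous fun u : EuclideanSpace ℝ (Fin 3) => 2 * u 0 - u 1 := by fun_prop
  have cy : Continuous fun u : EuclideanSpace ℝ (Fin 3) => 2 * u 1 - u 2 := by fun_prop
  have ex := (cx.continuousAt (x := priceVarVec σ S lam τ L)).eventually_const_lt (u := 0)
    (by simpa only [h0, h1] using hx)
  have ey := (cy.continuousAt (x := priceVarVec σ S lam τ L)).eventually_const_lt (u := 0)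
    (by simpa only [h1, h2] using hy)
  have cr : ContinuousAt (fun u : EuclideanSpace ℝ (Fin 3) => rhoPowFun (u 0) (u 1) (u 2))
      (priceVarVec σ S lam τ L) := by
    unfold rhoPowFun
    exact ((cy.continuousAt.div cx.continuousAt (by rw [h0, h1]; exact hx.ne')).abs.sqrt).sub
      continuousAt_const
  have er := cr.eventually_const_lt (u := 0)
    (by simpa only [h0, h1, h2, hr] using pow_pos (Real.exp_pos (-τ / lam)) L)
  constructor
  · filter_upwards [ex, ey] with u hux huy
    exact closedFun_eq_hFun hux huy
  · filter_upwards [ex, ey, er] with u hux huy hur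
    exact plugInFun_eq_hFun hL hux huy hur

end EstimatorFunctions

/-! ### Consistency and asymptotic normality of the estimators. -/

section Estimators

variable {Ω : Type*} [MeasurableSpace Ω] {μ : Measure Ω} [IsProbabilityMeasure μ]
  {P X : ℝ≥0 → Ω → ℝ} {σ S lam : ℝ} {τ : ℝ≥0}

variable (hσ : 0 < σ) (hS : 0 < S) (hP : IsBrownianWithVolatility P σ μ)
  (hX : IsTradeDirection X S lam μ)
  (hPX : IndepFun (fun ω t => P t ω) (fun ω t => noise S X t ω) μ)
  (hlam : 0 < lam) (hτ : 0 < τ)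

include hσ hS hP hX hPX hlam hτ

/-- Unbiasedness, consistency and asymptotic normality for a known dependence parameter. -/
theorem spreadEst_spec (v : Scheme) {L L' : ℕ} (hL : 1 ≤ L) (hL' : 1 ≤ L') (hne : L' ≠ L) :
    (∀ n : ℕ, L < n → L' < n →
      Integrable (spreadEst v (logPrice S P X) τ n L L' (Real.exp (-τ / lam))) μ ∧
      ∫ ω, spreadEst v (logPrice S P X) τ n L L' (Real.exp (-τ / lam)) ω ∂μ = S ^ 2) ∧
    TendstoInMeasure μ
      (fun n : ℕ => spreadEst v (logPrice S P X) τ n L L' (Real.exp (-τ / lam))) atTop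
      (fun _ => S ^ 2) ∧
    AsymptoticallyNormal μ
      (fun n : ℕ => spreadEst v (logPrice S P X) τ n L L' (Real.exp (-τ / lam))) (S ^ 2)
      (gammaVar σ S lam τ v L L' (Real.exp (-τ / lam))
        (limCorr μ v (logPrice S P X) τ L L')) := by
  have hτ' : (0 : ℝ) < τ := NNReal.coe_pos.2 hτ
  set ρ := Real.exp (-τ / lam) with hρ
  set d : ℝ := (L' : ℝ) * (1 - ρ ^ L) - L * (1 - ρ ^ L') with hd
  have hval := spreadFormula_priceVar (σ := σ) (S := S) hlam hτ' hL hL' hne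
  have hlin : ∀ x y : ℝ, spreadFormula L L' ρ x y = 2 * L' / d * x + -(2 * L / d) * y :=
    fun x y => by
      rw [spreadFormula, ← hd]
      ring
  let l : Fin 2 → ℕ := ![L, L']
  have hl : ∀ i, 1 ≤ l i := by simp [l, Fin.forall_fin_two, hL, hL']
  let g : EuclideanSpace ℝ (Fin 2) → ℝ := fun u => spreadFormula L L' ρ (u 0) (u 1)
  let W : EuclideanSpace ℝ (Fin 2) := !₂[2 * L' / d, -(2 * L / d)]
  -- For known `ρ` the estimator is linear in the two empirical variances, so its gradient is the
  -- constant vector `W`.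
  have hgW : g = InnerProductSpace.toDual ℝ _ W := by
    ext u
    simp only [g, hlin, InnerProductSpace.toDual_apply_apply, PiLp.inner_apply, Fin.sum_univ_two,
      RCLike.inner_apply, conj_trivial]
    simp only [W, Matrix.cons_val_zero, Matrix.cons_val_one]
    ring
  have hgc : Continuous g := hgW ▸ (InnerProductSpace.toDual ℝ _ W).continuous
  have hgrad : ∀ u, HasGradientAt g W u := fun u => by
    rw [hasGradientAt_iff_hasFDerivAt, hgW]
    exact (InnerProductSpace.toDual ℝ _ W).hasFDerivAt
  have hga : g (varVec σ S lam τ l) = S ^ 2 := hval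
  refine ⟨fun n hn hn' => ?_, ?_, ?_⟩
  · have hi := fun L => (memLp_empVar (τ := τ) hσ hS hP hX hPX v n L).integrable (by norm_num)
    have h1 := (hi L).const_mul (2 * L' / d)
    have h2 := (hi L').const_mul (-(2 * L / d))
    have he : spreadEst v (logPrice S P X) τ n L L' ρ = fun ω =>
        2 * L' / d * empVar v (logPrice S P X) τ n L ω
          + -(2 * L / d) * empVar v (logPrice S P X) τ n L' ω := by
      ext ω
      rw [spreadEst, hlin]
    rw [he]
    refine ⟨h1.add h2, ?_⟩
    rw [integral_add h1 h2, integral_const_mul, integral_const_mul,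
      integral_empVar hσ hS hP hX hPX v hL hn, integral_empVar hσ hS hP hX hPX v hL' hn', ← hlin]
    exact hval
  · have h := tendstoInMeasure_comp_empVarVec hσ hS hP hX hPX hlam hτ v l hl
      (g := g) hgc.continuousAt
    rw [hga] at h
    exact h
  · have h := asymptoticallyNormal_comp_empVarVec hσ hS hP hX hPX hlam hτ v l hl hgc.measurable
      (hgrad _) (w := gammaVar σ S lam τ v L L' ρ (limCorr μ v (logPrice S P X) τ L L')) (by
        simp only [Fin.sum_univ_two, W, l, Matrix.cons_val_zero, Matrix.cons_val_one]
        rw [asympCov_self hσ hS hP hX hPX hlam hτ v hL, asympCov_self hσ hS hP hX hPX hlam hτ v hL',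
          asympCov_comm hσ hS hP hX hPX hlam hτ v hL' hL, gammaVar, ← hd]
        ring_nf)
    rw [hga] at h
    exact h

/-- Consistency of the plug-in estimator. -/
theorem tendstoInMeasure_spreadPlugIn (v : Scheme) {L L' L'' : ℕ} (hL : 1 ≤ L) (hL' : 1 ≤ L')
    (hL'' : 1 ≤ L'') (hne : L' ≠ L) :
    TendstoInMeasure μ (fun n : ℕ => spreadPlugIn v (logPrice S P X) τ n L L' L'') atTop
      (fun _ => S ^ 2) := by
  let l : Fin 5 → ℕ := ![L, L', L'', 2 * L'', 4 * L'']
  have hl : ∀ i, 1 ≤ l i := by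
    intro i
    fin_cases i <;> simp only [l] <;> simp <;> lia
  obtain ⟨hc, hv⟩ := continuousAt_spreadFormula_rhoPowFun (σ := σ) hS hlam (NNReal.coe_pos.2 hτ)
    hL hL' hL'' hne (a := varVec σ S lam τ l)
    (f := fun i (u : EuclideanSpace ℝ (Fin 5)) => u i) (fun i => by fun_prop) rfl rfl rfl rfl rfl
  have h := tendstoInMeasure_comp_empVarVec hσ hS hP hX hPX hlam hτ v l hl hc
  rw [hv] at h
  exact h

/-- Functions that coincide with `h` near the limit give consistent and asymptotically normal
estimators. -/
theorem consistent_asymptoticallyNormal_of_eventuallyEq_hFun (v : Scheme) {L : ℕ} (hL : 1 ≤ L)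
    {g : EuclideanSpace ℝ (Fin 3) → ℝ} (hgm : Measurable g)
    (hg : g =ᶠ[𝓝 (priceVarVec σ S lam τ L)] hFun) {T : ℕ → Ω → ℝ}
    (hT : ∀ n ω, T n ω = g !₂[empVar v (logPrice S P X) τ n L ω,
      empVar v (logPrice S P X) τ n (2 * L) ω, empVar v (logPrice S P X) τ n (4 * L) ω]) :
    TendstoInMeasure μ T atTop (fun _ => S ^ 2) ∧
    AsymptoticallyNormal μ T (S ^ 2) (plugInVar μ σ S lam τ v (logPrice S P X) L) := by
  obtain ⟨hdiff, hval⟩ := hFun_priceVarVec (σ := σ) hS hlam (NNReal.coe_pos.2 hτ) hL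
  let l : Fin 3 → ℕ := fun i => 2 ^ (i : ℕ) * L
  have hl : ∀ i, 1 ≤ l i := fun i => Nat.mul_pos (by positivity) hL
  have hl3 : l = ![L, 2 * L, 4 * L] := by
    ext i
    fin_cases i <;> simp [l]
  have hvec : varVec σ S lam τ l = priceVarVec σ S lam τ L := by
    rw [hl3]
    ext i
    fin_cases i <;> rfl
  have hTl : T = fun n ω => g (empVarVec v (logPrice S P X) τ l n ω) := by
    ext n ω
    rw [hT, hl3]
    congr 1
    ext i
    fin_cases i <;> rfl
  have hgrad : HasGradientAt g (gradient hFun (priceVarVec σ S lam τ L)) (varVec σ S lam τ l) := by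
    rw [hvec]
    exact hdiff.hasGradientAt.congr_of_eventuallyEq hg
  have hga : g (varVec σ S lam τ l) = S ^ 2 := by
    rw [hvec, hg.eq_of_nhds, hval]
  rw [hTl, ← hga]
  refine ⟨tendstoInMeasure_comp_empVarVec hσ hS hP hX hPX hlam hτ v l hl
    hgrad.differentiableAt.continuousAt,
    asymptoticallyNormal_comp_empVarVec hσ hS hP hX hPX hlam hτ v l hl hgm hgrad ?_⟩
  simp only [plugInVar, covMatrix, dotProduct, Matrix.mulVec, Matrix.of_apply, Finset.mul_sum]
  exact Finset.sum_congr rfl fun i _ => Finset.sum_congr rfl fun j _ => by ring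

end Estimators
end SpreadEstimation

open SpreadEstimation in
theorem mainTheorem3 {Ω : Type*} [MeasurableSpace Ω] (μ : Measure Ω) [IsProbabilityMeasure μ]
    (σ S lam : ℝ) (τ : ℝ≥0) (hσ : 0 < σ) (hS : 0 < S) (hlam : 0 < lam) (hτ : 0 < τ)
    (P X : ℝ≥0 → Ω → ℝ)
    (hP : IsBrownianWithVolatility P σ μ)
    (hX : IsTradeDirection X S lam μ)
    (hPX : IndepFun (fun ω t => P t ω) (fun ω t => noise S X t ω) μ)
    (v : Scheme) (p : ℝ≥0 → Ω → ℝ) (hp : p = logPrice S P X)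
    (ρ : ℝ) (hρ : ρ = Real.exp (-(τ : ℝ) / lam)) :
    -- the limit correlations exist
    (∀ L L' : ℕ, 1 ≤ L → 1 ≤ L' →
      Tendsto (fun n : ℕ => corr μ (empVar v p τ n L) (empVar v p τ n L')) atTop
        (𝓝 (limCorr μ v p τ L L'))) ∧
    -- known dependence parameter: unbiased, consistent, asymptotically normal
    (∀ L L' : ℕ, 1 ≤ L → 1 ≤ L' → L' ≠ L →
      (∀ n : ℕ, L < n → L' < n →
        Integrable (spreadEst v p τ n L L' ρ) μ ∧ ∫ ω, spreadEst v p τ n L L' ρ ω ∂μ = S ^ 2) ∧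
      TendstoInMeasure μ (fun n : ℕ => spreadEst v p τ n L L' ρ) atTop (fun _ => S ^ 2) ∧
      AsymptoticallyNormal μ (fun n : ℕ => spreadEst v p τ n L L' ρ) (S ^ 2)
        (gammaVar σ S lam τ v L L' ρ (limCorr μ v p τ L L'))) ∧
    -- estimated dependence parameter: consistent
    (∀ L L' L'' : ℕ, 1 ≤ L → 1 ≤ L' → 1 ≤ L'' → L' ≠ L →
      TendstoInMeasure μ (fun n : ℕ => spreadPlugIn v p τ n L L' L'') atTop (fun _ => S ^ 2)) ∧
    -- estimated dependence parameter: asymptotically normal for `(L', L'') = (2L, L)`,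
    -- and likewise for the closed form of this estimator
    (∀ L : ℕ, 1 ≤ L →
      DifferentiableAt ℝ hFun (priceVarVec σ S lam τ L) ∧
      AsymptoticallyNormal μ (fun n : ℕ => spreadPlugIn v p τ n L (2 * L) L) (S ^ 2)
        (plugInVar μ σ S lam τ v p L) ∧
      TendstoInMeasure μ (fun n : ℕ => spreadClosed v p τ n L) atTop (fun _ => S ^ 2) ∧
      AsymptoticallyNormal μ (fun n : ℕ => spreadClosed v p τ n L) (S ^ 2)
        (plugInVar μ σ S lam τ v p L)) := by
  subst hp hρ
  refine ⟨fun L L' hL hL' => (tendsto_corr_empVar hσ hS hP hX hPX hlam hτ v hL hL').1,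
    fun L L' hL hL' hne => spreadEst_spec hσ hS hP hX hPX hlam hτ v hL hL' hne,
    fun L L' L'' hL hL' hL'' hne =>
      tendstoInMeasure_spreadPlugIn hσ hS hP hX hPX hlam hτ v hL hL' hL'' hne,
    fun L hL => ?_⟩
  have hτ' : (0 : ℝ) < τ := NNReal.coe_pos.2 hτ
  -- Both versions agree with `hFun` near the limit point, hence share its value and gradient there
  -- and have the same asymptotic variance.
  obtain ⟨hclosed, hplug⟩ := eventually_eq_hFun (σ := σ) hS hlam hτ' hL
  have h1 := consistent_asymptoticallyNormal_of_eventuallyEq_hFun hσ hS hP hX hPX hlam hτ v hL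
    measurable_closedFun hclosed (T := fun n => spreadClosed v (logPrice S P X) τ n L)
    fun n ω => rfl
  have h2 := consistent_asymptoticallyNormal_of_eventuallyEq_hFun hσ hS hP hX hPX hlam hτ v hL
    (measurable_plugInFun L) hplug (T := fun n => spreadPlugIn v (logPrice S P X) τ n L (2 * L) L)
    fun n ω => rfl
  exact ⟨(hFun_priceVarVec hS hlam hτ' hL).1, h2.2, h1.1, h1.2⟩
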